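/- Fix $\rho,\sigma>0$ and $0<\tau_1<\tau_2$. Consider the single-file system of Brownian point particles with hard-core repulsion on $\mathbb R$, labelled by $k\in\mathbb Z$: let $Y_k\le Y_{k+1}$ $(k\in\mathbb Z)$, $Y_0=0$, be the initial positions, and let $Z_k(t)$ be Brownian motions driven by independent noises that are also independent of the initial positions, with $Z_k(0)=Y_k$ and $\operatorname{Var}(Z_k(t)-Y_k)=\sigma^2t/2$; the single-file trajectories $X_k$ are obtained by exchanging labels whenever two trajectories meet, i.e. almost surely $X_k(0)=Y_k$, each $X_k$ is continuous, $X_k(t)\le X_{k+1}(t)$ for all $k,t$, and at each time $t$ the families $(X_k(t))_k$ and $(Z_k(t))_k$ agree up to a permutation of $\mathbb Z$. The tracer is $x(t)=X_0(t)$. Two settings are considered. * *Annealed*: $(Y_k)_{k\ne0}$ is a Poisson point process of intensity $\rho$ on $\mathbb R$, and probabilities are taken over the evolution and the initial condition. * *Quenched*: $Y_k=y_k$ is any deterministic configuration with macroscopically uniform density $\rho$, i.e. $\#\{k: aL<y_k\le bL\}/L\to\rho(b-a)$ as $L\to\infty$ for all $a<b$, and probabilities are taken over the evolution. For $\eta\in\mathbb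 R$, $\mathbf B=(B_1,B_2)$ and $\boldsymbol\xi=(\xi_1,\xi_2)\in\mathbb R^2$ put, with $\operatorname{erfc}(x)=\frac2{\sqrt\pi}\int_x^\infty e^{-u^2}du$, $$f(\eta,\mathbf B,\boldsymbol\xi)=1+\sum_{j=1}^2\frac{e^{B_j}-1}{2}\operatorname{erfc}\Big(\frac{\xi_j+\eta}{\sigma\sqrt{\tau_j}}\Big)+\frac{(e^{B_1}-1)(e^{B_2}-1)}{\pi}\int_{\xi_1}^\infty\!du_1\int_{\xi_2}^\infty\!du_2\,\frac{\exp\Big[-\frac{(u_2-u_1)^2}{\sigma^2(\tau_2-\tau_1)}-\frac{(u_1+\eta)^2}{\sigma^2\tau_1}\Big]}{\sigma^2\sqrt{\tau_1(\tau_2-\tau_1)}}.$$ Then $f>0$, the functions $f(\cdot,\mathbf B,\boldsymbol\xi)-1$ and $\ln f(\cdot,\mathbf B,\boldsymbol\xi)$ are integrable on $(0,\infty)$ for all $\mathbf B,\boldsymbol\xi$, and with $$\Phi_a(\boldsymbol\xi,\mathbf B)=-\rho\int_0^\infty\{f(\eta,\mathbf B,\boldsymbol\xi)-1\}\,d\eta-\rho\int_0^\infty\{f(\eta,-\mathbf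 B,-\boldsymbol\xi)-1\}\,d\eta,$$ $$\Phi_q(\boldsymbol\xi,\mathbf B)=-\rho\int_0^\infty\ln f(\eta,\mathbf B,\boldsymbol\xi)\,d\eta-\rho\int_0^\infty\ln f(\eta,-\mathbf B,-\boldsymbol\xi)\,d\eta,$$ the following holds for $\alpha=a$ (annealed) and $\alpha=q$ (quenched). For every $\boldsymbol\xi\in\mathbb R^2$ there is exactly one $\mathbf B\in\mathbb R^2$ with $\partial\Phi_\alpha/\partial B_1=\partial\Phi_\alpha/\partial B_2=0$ at $(\boldsymbol\xi,\mathbf B)$, and with this $\mathbf B=\mathbf B(\boldsymbol\xi)$ the function $\phi_\alpha(\boldsymbol\xi)=\Phi_\alpha(\boldsymbol\xi,\mathbf B(\boldsymbol\xi))$ is the large deviation function of the tracer positions at the two times $\tau_1t,\tau_2t$: $$P_\alpha\big(x(\tau_1t)\approx\xi_1\sqrt t,\;x(\tau_2t)\approx\xi_2\sqrt t\big)\asymp e^{-\sqrt t\,\phi_\alpha(\xi_1,\xi_2)}\qquad(t\to\infty),$$ in the sense that $\phi_\alpha$ is lower semicontinuous and the laws of $\big(x(\tau_1t),x(\tau_2t)\big)/\sqrt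 t$ satisfy the large deviation principle with speed $\sqrt t$ and rate function $\phi_\alpha$: $\limsup_{t\to\infty} t^{-1/2}\ln P_\alpha(\cdot\in C)\le-\inf_C\phi_\alpha$ for closed $C\subseteq\mathbb R^2$ and $\liminf_{t\to\infty} t^{-1/2}\ln P_\alpha(\cdot\in U)\ge-\inf_U\phi_\alpha$ for open $U\subseteq\mathbb R^2$. -/

import Mathlib

open MeasureTheory ProbabilityTheory Filter Topology
open scoped NNReal ENNReal

namespace SingleFile

/-! ### The interacting particle system -/

/-- The single-file system of Brownian point particles on the line with hard-core repulsion,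
on the probability space `(Ω, P)`.

Particle `k : ℤ` starts at `Y k`; the free motions `Y k + (σ / √2) W k` are independent Brownian
motions whose displacement in unit time has variance `σ ^ 2 / 2`, and they are independent of the
initial configuration. Particles exchange labels when they meet: the single-file trajectories
`X k` start at `Y k`, are continuous, never overtake each other, and at every time they occupy
exactly the sites (with multiplicity) of the free particles. -/
structure IsSingleFile {Ω : Type*} [MeasurableSpace Ω] (P : Measure Ω) (σ : ℝ)
    (Y : ℤ → Ω → ℝ) (W X : ℤ → ℝ≥0 → Ω → ℝ) : Prop where
  measurable_init : ∀ k, Measurable (Y k)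
  measurable_noise : ∀ k t, Measurable (W k t)
  brownian : ∀ k, IsBrownianReal (W k) P
  indep_noise : iIndepFun (fun (k : ℤ) (ω : Ω) (t : ℝ≥0) => W k t ω) P
  indep_init : IndepFun (fun (ω : Ω) (k : ℤ) => Y k ω)
    (fun (ω : Ω) (k : ℤ) (t : ℝ≥0) => W k t ω) P
  start : ∀ᵐ ω ∂P, ∀ k, X k 0 ω = Y k ω
  continuous_path : ∀ᵐ ω ∂P, ∀ k, Continuous fun t => X k t ω
  ordered : ∀ᵐ ω ∂P, ∀ t, Monotone fun k => X k t ω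
  relabel : ∀ᵐ ω ∂P, ∀ t, ∃ π : Equiv.Perm ℤ,
    ∀ k, X k t ω = Y (π k) ω + σ / √2 * W (π k) t ω

/-- The annealed initial condition: ordered positions with the tracer (rank `0`) at the origin,
all other particles forming a Poisson point process of intensity `ρ` on the line. -/
structure IsAnnealedInitial {Ω : Type*} [MeasurableSpace Ω] (P : Measure Ω) (ρ : ℝ)
    (Y : ℤ → Ω → ℝ) : Prop where
  tracer : ∀ᵐ ω ∂P, Y 0 ω = 0
  ordered : ∀ᵐ ω ∂P, Monotone fun k => Y k ω
  count_law : ∀ A : Set ℝ, MeasurableSet A → volume A ≠ ∞ →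
    HasLaw (fun ω => {k : ℤ | k ≠ 0 ∧ Y k ω ∈ A}.encard)
      ((poissonMeasure (Real.toNNReal (ρ * (volume A).toReal))).map
        (Nat.cast : ℕ → ℕ∞)) P
  count_indep : ∀ (n : ℕ) (A : Fin n → Set ℝ), (∀ i, MeasurableSet (A i)) →
    Pairwise (fun i j => Disjoint (A i) (A j)) →
    iIndepFun (fun (i : Fin n) (ω : Ω) => {k : ℤ | k ≠ 0 ∧ Y k ω ∈ A i}.encard) P

/-- A quenched initial condition: a deterministic ordered configuration with the tracer (rank `0`)
at the origin, whose density profile is uniformly `ρ` on the macroscopic scale. -/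
structure IsQuenchedInitial (ρ : ℝ) (y : ℤ → ℝ) : Prop where
  tracer : y 0 = 0
  ordered : Monotone y
  density : ∀ a b : ℝ, a < b →
    Tendsto (fun L : ℝ => ({k : ℤ | a * L < y k ∧ y k ≤ b * L}.ncard : ℝ) / L) atTop
      (𝓝 (ρ * (b - a)))

/-- The rescaled tracer positions `(x(τ₁ t), x(τ₂ t)) / √t`. -/
noncomputable def rescaledTracer {Ω : Type*} (τ₁ τ₂ : ℝ≥0) (X : ℤ → ℝ≥0 → Ω → ℝ) (t : ℝ≥0)
    (ω : Ω) : ℝ × ℝ :=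
  (X 0 (τ₁ * t) ω / √(t : ℝ), X 0 (τ₂ * t) ω / √(t : ℝ))

/-- `φ` is the large deviation function of the family `V t`, as `t → ∞`, with speed `√t`:
`P (V t ≈ ξ) ≍ exp (-√t φ(ξ))`, in the sense of a large deviation principle. -/
structure HasLargeDeviationFunction {Ω : Type*} [MeasurableSpace Ω] (P : Measure Ω)
    (V : ℝ≥0 → Ω → ℝ × ℝ) (φ : ℝ × ℝ → ℝ) : Prop where
  lowerSemicontinuous : LowerSemicontinuous φ
  upper : ∀ C : Set (ℝ × ℝ), IsClosed C →
    limsup (fun t : ℝ≥0 => ENNReal.log (P {ω | V t ω ∈ C}) / ((√(t : ℝ) : ℝ) : EReal)) atTop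
      ≤ -(⨅ ξ ∈ C, (φ ξ : EReal))
  lower : ∀ U : Set (ℝ × ℝ), IsOpen U →
    -(⨅ ξ ∈ U, (φ ξ : EReal)) ≤
      liminf (fun t : ℝ≥0 => ENNReal.log (P {ω | V t ω ∈ U}) / ((√(t : ℝ) : ℝ) : EReal)) atTop

/-! ### The explicit functions -/

/-- The complementary error function. -/
noncomputable def erfc (x : ℝ) : ℝ := 2 / √Real.pi * ∫ u in Set.Ioi x, Real.exp (-u ^ 2)

/-- The two-time single-particle function `f(η, B, ξ)`. -/
noncomputable def singleParticle (σ τ₁ τ₂ η : ℝ) (B ξ : ℝ × ℝ) : ℝ :=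
  1 + (Real.exp B.1 - 1) / 2 * erfc ((ξ.1 + η) / (σ * √τ₁))
    + (Real.exp B.2 - 1) / 2 * erfc ((ξ.2 + η) / (σ * √τ₂))
    + (Real.exp B.1 - 1) * (Real.exp B.2 - 1) * (1 / Real.pi) *
      ∫ u₁ in Set.Ioi ξ.1, ∫ u₂ in Set.Ioi ξ.2,
        Real.exp (-(u₂ - u₁) ^ 2 / (σ ^ 2 * (τ₂ - τ₁)) - (u₁ + η) ^ 2 / (σ ^ 2 * τ₁))
          / (σ ^ 2 * √(τ₁ * (τ₂ - τ₁)))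

/-- The right-hand side of the annealed formula. -/
noncomputable def annealedFormula (ρ σ τ₁ τ₂ : ℝ) (ξ B : ℝ × ℝ) : ℝ :=
  -ρ * (∫ η in Set.Ioi (0 : ℝ), (singleParticle σ τ₁ τ₂ η B ξ - 1))
    - ρ * (∫ η in Set.Ioi (0 : ℝ), (singleParticle σ τ₁ τ₂ η (-B) (-ξ) - 1))

/-- The right-hand side of the quenched formula. -/
noncomputable def quenchedFormula (ρ σ τ₁ τ₂ : ℝ) (ξ B : ℝ × ℝ) : ℝ :=
  -ρ * (∫ η in Set.Ioi (0 : ℝ), Real.log (singleParticle σ τ₁ τ₂ η B ξ))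
    - ρ * (∫ η in Set.Ioi (0 : ℝ), Real.log (singleParticle σ τ₁ τ₂ η (-B) (-ξ)))

/-- The stationarity conditions `∂Φ/∂B₁ = ∂Φ/∂B₂ = 0` at `B`. -/
def IsStationary (Φ : ℝ × ℝ → ℝ) (B : ℝ × ℝ) : Prop :=
  HasDerivAt (fun b => Φ (b, B.2)) 0 B.1 ∧ HasDerivAt (fun b => Φ (B.1, b)) 0 B.2

/-- `φ` is given parametrically by `φ(ξ) = Φ(ξ, B)`, where `B` is determined by `ξ` through the
stationarity conditions. -/
def IsParametrizedBy (φ : ℝ × ℝ → ℝ) (Φ : ℝ × ℝ → ℝ × ℝ → ℝ) : Prop :=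
  ∀ ξ, (∃! B, IsStationary (Φ ξ) B) ∧ ∀ B, IsStationary (Φ ξ) B → φ ξ = Φ ξ B

end SingleFile

/-! The tracer is read off from the free particles. Relabelling only restores the order, so the
tracer is beyond a level exactly when the number of free particles beyond it, counted relative to
the positive labels, is at least one (`excess_free`). Both numbers are infinite, and a relative
count is not invariant under every permutation of ℤ: a shift of labels changes it. Two facts save
the argument. Almost surely the labels of the free paths are sorted far away, uniformly on bounded
time intervals (`IsSingleFile.ae_isSortedAtInfinity`), because a Brownian path rarely travels a
distance comparable to the starting position. And smoothed counts of the two families are continuous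
in time, differ by an integer and agree at time zero (`sum_relabel_eq`).

Given the initial positions, the counts at the two times and levels `ξ` are sums of independent
one-particle terms (`crossing`), and `f` is the generating function of such a term for a particle
started at `-η` (`singleParticle_eq_integral`). On the scale `√t` the logarithm of the generating
function of the weighted counts, with weights `B`, converges to `ρ * pressure`, an integral over
starting points of `ψ` applied to the one-particle generating function. For deterministic positions
the sum of logarithms is a Riemann sum and `ψ = log`; for Poisson positions the Laplace functional
gives `ψ x = x - 1`. `IsRateTransform` collects what the two have in common, and everything after
the limit is done once. A reflection of the line turns starting points on the right into the terms
with `-B` and `-ξ`, so `Φ` is `-ρ * pressure`.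

As a function of `B` the pressure is strictly convex, since the displacement law charges all open
sets (`tiltMean_lt_pressure_sub`, `crossings_not_const`), and coercive
(`exists_le_pressure_crossings`). Hence it has one critical point, its minimum, and `φ` is a
supremum over `B` of functions continuous in `ξ`.

The large deviation principle is a version of the Gärtner–Ellis theorem at the value zero of the
counts. For the upper bound, levels slightly shifted according to the signs of `B` make the weighted
count nonnegative whenever the tracer is near `ξ`, and Chernoff's bound applies
(`exists_nhds_measure_le`); one-level bounds give exponential tightness (`exists_measure_compl_le`).
For the lower bound, tilt by the weighted count at the critical `B`. Criticality says that the
tilted means of the counts at `ξ` vanish, while strict monotonicity in the level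
(`tiltMean_crossing_lt`) gives the counts at shifted levels tilted means of the sign that keeps the
tracer near `ξ`. All other behaviour is exponentially unlikely after tilting, and on the remaining
event the tilt costs little (`eventually_le_measure_open`). -/

namespace SingleFile

/-! ### Transforms turning one-particle generating functions into pressures -/

/-- The common properties of `Real.log` (quenched) and `x ↦ x - 1` (annealed) by which
one-particle generating functions enter the large deviation function. -/
structure IsRateTransform (ψ ψ' : ℝ → ℝ) : Prop where
  hasDerivAt : ∀ x, 0 < x → HasDerivAt ψ (ψ' x) x
  deriv_pos : ∀ x, 0 < x → 0 < ψ' x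
  deriv_le : ∀ x, 0 < x → ψ' x ≤ 1 + x⁻¹
  log_le : ∀ x, 0 < x → Real.log x ≤ ψ x
  le_sub_one : ∀ x, 0 < x → ψ x ≤ x - 1
  -- Convexity of `ψ ∘ exp`, as the tangent inequality at `log x`: there the slope is `x * ψ' x`.
  convex : ∀ x y, 0 < x → 0 < y → x * ψ' x * (Real.log y - Real.log x) ≤ ψ y - ψ x
  measurable : Measurable ψ
  measurable_deriv : Measurable ψ'

lemma isRateTransform_log : IsRateTransform Real.log (fun x => x⁻¹) where
  hasDerivAt x hx := Real.hasDerivAt_log hx.ne'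
  deriv_pos x hx := inv_pos.2 hx
  deriv_le x hx := by linarith
  log_le x hx := le_rfl
  le_sub_one x hx := Real.log_le_sub_one_of_pos hx
  convex x y hx hy := by rw [mul_inv_cancel₀ hx.ne', one_mul]
  measurable := Real.measurable_log
  measurable_deriv := measurable_inv

lemma isRateTransform_sub_one : IsRateTransform (fun x => x - 1) (fun _ => 1) where
  hasDerivAt x hx := (hasDerivAt_id x).sub_const 1
  deriv_pos x hx := one_pos
  deriv_le x hx := by have := inv_pos.2 hx; linarith
  log_le x hx := Real.log_le_sub_one_of_pos hx
  le_sub_one x hx := le_rfl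
  convex x y hx hy := by
    have h := Real.log_le_sub_one_of_pos (div_pos hy hx)
    rw [Real.log_div hy.ne' hx.ne'] at h
    have h2 := mul_le_mul_of_nonneg_left h hx.le
    have h3 : x * (y / x - 1) = y - x := by field_simp
    linarith
  measurable := measurable_id.sub_const 1
  measurable_deriv := measurable_const

namespace IsRateTransform

variable {ψ ψ' : ℝ → ℝ}

/-- Squeezed between `1 - x⁻¹` and `x - 1`, `ψ` vanishes to first order at one. Decay of the
generating function to one thus becomes decay of `ψ` of it. -/
lemma abs_le (hψ : IsRateTransform ψ ψ') {x : ℝ} (hx : 0 < x) :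
    |ψ x| ≤ (1 + x⁻¹) * |x - 1| := by
  have hi := inv_pos.2 hx
  have h1 := hψ.le_sub_one x hx
  have h2 := hψ.log_le x hx
  have h3 := Real.one_sub_inv_le_log_of_pos hx
  have h4 : 1 - x⁻¹ = x⁻¹ * (x - 1) := by field_simp
  have h5 := neg_abs_le (x - 1)
  have h6 := le_abs_self (x - 1)
  have h7 := abs_nonneg (x - 1)
  rw [_root_.abs_le]
  constructor
  · nlinarith
  · nlinarith

lemma abs_sub_le (hψ : IsRateTransform ψ ψ') {a x y : ℝ} (ha : 0 < a) (hx : a ≤ x) (hy : a ≤ y) :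
    |ψ x - ψ y| ≤ (1 + a⁻¹) * |x - y| := by
  have := Convex.norm_image_sub_le_of_norm_hasDerivWithin_le (f := ψ) (f' := ψ') (s := Set.Ici a)
    (C := 1 + a⁻¹) (fun z hz => (hψ.hasDerivAt z (ha.trans_le hz)).hasDerivWithinAt)
    (fun z hz => ?_) (convex_Ici a) hy hx
  · simpa using this
  · have hz0 : 0 < z := ha.trans_le hz
    rw [Real.norm_of_nonneg (hψ.deriv_pos z hz0).le]
    exact (hψ.deriv_le z hz0).trans (by gcongr; exact hz)

end IsRateTransform

lemma abs_exp_sub_one_le_mul_exp (x : ℝ) : |Real.exp x - 1| ≤ |x| * Real.exp |x| := by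
  rcases le_total 0 x with hx | hx
  · rw [abs_of_nonneg hx, abs_of_nonneg (by linarith [Real.add_one_le_exp x])]
    have h := Real.add_one_le_exp (-x)
    have h2 : Real.exp x * Real.exp (-x) = 1 := by rw [← Real.exp_add]; simp
    nlinarith [Real.exp_pos x]
  · have h1 : Real.exp x ≤ 1 := Real.exp_le_one_iff.2 hx
    rw [abs_of_nonpos hx, abs_of_nonpos (by linarith)]
    have h := Real.add_one_le_exp x
    have h3 : 1 ≤ Real.exp (-x) := Real.one_le_exp (by linarith)
    nlinarith

lemma abs_exp_sub_exp_le {x y A : ℝ} (hx : |x| ≤ A) (hy : |y| ≤ A) :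
    |Real.exp x - Real.exp y| ≤ Real.exp A * |x - y| := by
  have := Convex.norm_image_sub_le_of_norm_hasDerivWithin_le (f := Real.exp) (f' := Real.exp)
    (s := Set.Iic A) (C := Real.exp A) (fun z hz => (Real.hasDerivAt_exp z).hasDerivWithinAt)
    (fun z hz => ?_) (convex_Iic A) (abs_le.1 hy).2 (abs_le.1 hx).2
  · simpa using this
  · rw [Real.norm_of_nonneg (Real.exp_pos z).le]
    exact Real.exp_le_exp.2 hz

/-! ### Displacement laws and local exponents -/

/-- The properties of the joint law of the displacements of a free particle at the two times. -/
structure IsDisplacementLaw (m : Measure (ℝ × ℝ)) : Prop where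
  isProbabilityMeasure : IsProbabilityMeasure m
  integrable_sq : Integrable (fun u => ‖u‖ ^ 2) m
  fst_ne : ∀ a, ∀ᵐ u ∂m, u.1 ≠ a
  snd_ne : ∀ a, ∀ᵐ u ∂m, u.2 ≠ a
  open_pos : ∀ U : Set (ℝ × ℝ), IsOpen U → U.Nonempty → 0 < m U

/-- `near M y u` is the indicator that a particle started at `y` with displacements `u`
may have come within distance `M` of the origin. -/
noncomputable def near (M y : ℝ) (u : ℝ × ℝ) : ℝ := if |y| ≤ ‖u‖ + M then 1 else 0

/-- An exponent `θ y u`, attached to a particle started at `y` with displacements `u`, is local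
if it is bounded and vanishes unless the particle comes near the origin. -/
structure IsLocal (θ : ℝ → ℝ × ℝ → ℝ) : Prop where
  measurable : Measurable (Function.uncurry θ)
  bound : ∃ A M, 0 ≤ A ∧ 0 ≤ M ∧ ∀ y u, |θ y u| ≤ A * near M y u

/-- One-particle generating function. -/
noncomputable def expMean (m : Measure (ℝ × ℝ)) (θ : ℝ → ℝ × ℝ → ℝ) (y : ℝ) : ℝ :=
  ∫ u, Real.exp (θ y u) ∂m

/-- The scaled cumulant generating function (per unit density) of the sum of `θ` over all
particles. -/
noncomputable def pressure (ψ : ℝ → ℝ) (m : Measure (ℝ × ℝ)) (θ : ℝ → ℝ × ℝ → ℝ) : ℝ :=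
  ∫ y, ψ (expMean m θ y)

/-- The derivative of `pressure ψ m` at `θ` in direction `χ`. -/
noncomputable def tiltMean (ψ' : ℝ → ℝ) (m : Measure (ℝ × ℝ)) (θ χ : ℝ → ℝ × ℝ → ℝ) : ℝ :=
  ∫ y, ψ' (expMean m θ y) * ∫ u, Real.exp (θ y u) * χ y u ∂m

lemma near_nonneg (M y : ℝ) (u : ℝ × ℝ) : 0 ≤ near M y u := by
  unfold near; split_ifs <;> simp

lemma near_le_one (M y : ℝ) (u : ℝ × ℝ) : near M y u ≤ 1 := by
  unfold near; split_ifs <;> simp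

lemma near_mono {M M' : ℝ} (h : M ≤ M') (y : ℝ) (u : ℝ × ℝ) : near M y u ≤ near M' y u := by
  unfold near; split_ifs <;> first | simp | linarith

lemma measurable_near (M : ℝ) : Measurable (Function.uncurry (near M)) := by
  unfold near Function.uncurry
  exact Measurable.ite (measurableSet_le (by fun_prop) (by fun_prop)) measurable_const
    measurable_const

/-- Chebyshev's inequality before taking the mean: second moments of `u` give decay like `(1 + y ^
2)⁻¹`, which is integrable in the starting point. -/
lemma near_le {M : ℝ} (y : ℝ) (u : ℝ × ℝ) :
    near M y u ≤ (1 + (‖u‖ + M) ^ 2) / (1 + y ^ 2) := by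
  unfold near
  split_ifs with h
  · rw [le_div_iff₀ (by positivity)]
    have : y ^ 2 ≤ (‖u‖ + M) ^ 2 := by
      rw [← sq_abs y]; exact pow_le_pow_left₀ (abs_nonneg y) h 2
    linarith
  · positivity

/-! ### Decay in the starting point -/

section Decay

variable {m : Measure (ℝ × ℝ)}

lemma IsDisplacementLaw.integrable_norm (hm : IsDisplacementLaw m) :
    Integrable (fun u => ‖u‖) m := by
  have := hm.isProbabilityMeasure
  refine ((integrable_const (1 : ℝ)).add hm.integrable_sq).mono' (by fun_prop) ?_
  filter_upwards with u
  simp only [norm_norm, Pi.add_apply]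
  nlinarith [sq_nonneg (‖u‖ - 1), norm_nonneg u]

lemma IsDisplacementLaw.integrable_near_bound (hm : IsDisplacementLaw m) (M : ℝ) :
    Integrable (fun u => 1 + (‖u‖ + M) ^ 2) m := by
  have := hm.isProbabilityMeasure
  have h : (fun u : ℝ × ℝ => 1 + (‖u‖ + M) ^ 2)
      = fun u => ‖u‖ ^ 2 + 2 * M * ‖u‖ + (1 + M ^ 2) := by
    ext u; ring
  rw [h]
  exact (hm.integrable_sq.add (hm.integrable_norm.const_mul _)).add (integrable_const _)

lemma measurable_near_right (M y : ℝ) : Measurable (near M y) :=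
  (measurable_near M).comp measurable_prodMk_left

lemma integrable_near [IsFiniteMeasure m] (M y : ℝ) : Integrable (near M y) m :=
  (integrable_const (1 : ℝ)).mono' (measurable_near_right M y).aestronglyMeasurable
    (ae_of_all _ fun u => by
      rw [Real.norm_of_nonneg (near_nonneg _ _ _)]; exact near_le_one _ _ _)

lemma IsDisplacementLaw.integral_near_le (hm : IsDisplacementLaw m) (M : ℝ) :
    ∃ K, 0 ≤ K ∧ ∀ y, ∫ u, near M y u ∂m ≤ K * (1 + y ^ 2)⁻¹ := by
  have := hm.isProbabilityMeasure
  refine ⟨∫ u, (1 + (‖u‖ + M) ^ 2) ∂m, integral_nonneg fun u => by positivity, fun y => ?_⟩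
  rw [← integral_mul_const]
  refine integral_mono (integrable_near M y) ((hm.integrable_near_bound M).mul_const _) fun u => ?_
  exact near_le y u

lemma integrable_of_le_inv_one_add_sq {f : ℝ → ℝ} (hf : Measurable f) {K : ℝ}
    (h : ∀ y, |f y| ≤ K * (1 + y ^ 2)⁻¹) : Integrable f :=
  (integrable_inv_one_add_sq.const_mul K).mono' hf.aestronglyMeasurable (ae_of_all _ h)

end Decay

/-! ### Calculus of local exponents -/

namespace IsLocal

variable {m : Measure (ℝ × ℝ)} {θ χ : ℝ → ℝ × ℝ → ℝ}

lemma add (h : IsLocal θ) (h' : IsLocal χ) : IsLocal (fun y u => θ y u + χ y u) := by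
  obtain ⟨A, M, hA, hM, hb⟩ := h.bound
  obtain ⟨A', M', hA', hM', hb'⟩ := h'.bound
  refine ⟨h.measurable.add h'.measurable, A + A', max M M', by positivity, by positivity,
    fun y u => (abs_add_le _ _).trans ?_⟩
  rw [add_mul]
  exact add_le_add ((hb y u).trans (by gcongr; exact near_mono (le_max_left _ _) y u))
    ((hb' y u).trans (by gcongr; exact near_mono (le_max_right _ _) y u))

lemma const_mul (h : IsLocal θ) (s : ℝ) : IsLocal (fun y u => s * θ y u) := by
  obtain ⟨A, M, hA, hM, hb⟩ := h.bound
  refine ⟨h.measurable.const_mul s, |s| * A, M, by positivity, hM, fun y u => ?_⟩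
  rw [abs_mul, mul_assoc]
  exact mul_le_mul_of_nonneg_left (hb y u) (abs_nonneg s)

lemma sub (h : IsLocal θ) (h' : IsLocal χ) : IsLocal (fun y u => θ y u - χ y u) := by
  have := h.add (h'.const_mul (-1))
  simpa [sub_eq_add_neg] using this

lemma abs (h : IsLocal θ) : IsLocal (fun y u => |θ y u|) := by
  obtain ⟨A, M, hA, hM, hb⟩ := h.bound
  exact ⟨h.measurable.abs, A, M, hA, hM, fun y u => by simpa using hb y u⟩

lemma measurable_right (h : IsLocal θ) (y : ℝ) : Measurable (θ y) :=
  h.measurable.comp measurable_prodMk_left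

lemma abs_le_const {A M : ℝ} (hA : 0 ≤ A) (hb : ∀ y u, |θ y u| ≤ A * near M y u) (y : ℝ)
    (u : ℝ × ℝ) : |θ y u| ≤ A :=
  (hb y u).trans (mul_le_of_le_one_right hA (near_le_one _ _ _))

lemma exists_bound (h : IsLocal θ) : ∃ A, 0 ≤ A ∧ ∀ y u, |θ y u| ≤ A := by
  obtain ⟨A, M, hA, hM, hb⟩ := h.bound
  exact ⟨A, hA, abs_le_const hA hb⟩

lemma integrable_right [IsFiniteMeasure m] (h : IsLocal θ) (y : ℝ) : Integrable (θ y) m := by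
  obtain ⟨A, hA, hb⟩ := h.exists_bound
  exact (integrable_const A).mono' (h.measurable_right y).aestronglyMeasurable (ae_of_all _ (hb y))

lemma exp_sub_one (h : IsLocal θ) : IsLocal (fun y u => Real.exp (θ y u) - 1) := by
  obtain ⟨A, M, hA, hM, hb⟩ := h.bound
  refine ⟨(Real.measurable_exp.comp h.measurable).sub_const 1, A * Real.exp A, M, by positivity,
    hM, fun y u => (abs_exp_sub_one_le_mul_exp _).trans ?_⟩
  calc |θ y u| * Real.exp |θ y u| ≤ (A * near M y u) * Real.exp A := by
        gcongr
        · exact mul_nonneg hA (near_nonneg _ _ _)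
        · exact hb y u
        · exact abs_le_const hA hb y u
    _ = _ := by ring

lemma exp_mul (h : IsLocal θ) (h' : IsLocal χ) :
    IsLocal (fun y u => Real.exp (θ y u) * χ y u) := by
  obtain ⟨A, hA, hb⟩ := h.exists_bound
  obtain ⟨A', M', hA', hM', hb'⟩ := h'.bound
  refine ⟨(Real.measurable_exp.comp h.measurable).mul h'.measurable, Real.exp A * A', M',
    by positivity, hM', fun y u => ?_⟩
  rw [abs_mul, Real.abs_exp, mul_assoc]
  gcongr
  · exact (le_abs_self _).trans (hb y u)
  · exact hb' y u

lemma measurable_integral [SFinite m] (h : IsLocal θ) : Measurable (fun y => ∫ u, θ y u ∂m) :=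
  (h.measurable.stronglyMeasurable.integral_prod_right (ν := m)).measurable

lemma integral_abs_le (hm : IsDisplacementLaw m) (h : IsLocal θ) :
    ∃ K, 0 ≤ K ∧ ∀ y, ∫ u, |θ y u| ∂m ≤ K * (1 + y ^ 2)⁻¹ := by
  have := hm.isProbabilityMeasure
  obtain ⟨A, M, hA, hM, hb⟩ := h.bound
  obtain ⟨K, hK, hn⟩ := hm.integral_near_le M
  refine ⟨A * K, by positivity, fun y => ?_⟩
  calc ∫ u, |θ y u| ∂m ≤ ∫ u, A * near M y u ∂m :=
        integral_mono (h.abs.integrable_right y) ((integrable_near M y).const_mul A) (hb y)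
    _ = A * ∫ u, near M y u ∂m := integral_const_mul _ _
    _ ≤ A * (K * (1 + y ^ 2)⁻¹) := by gcongr; exact hn y
    _ = _ := by ring

lemma abs_integral_le (hm : IsDisplacementLaw m) (h : IsLocal θ) :
    ∃ K, 0 ≤ K ∧ ∀ y, |∫ u, θ y u ∂m| ≤ K * (1 + y ^ 2)⁻¹ := by
  obtain ⟨K, hK, hb⟩ := h.integral_abs_le hm
  exact ⟨K, hK, fun y => (abs_integral_le_integral_abs).trans (hb y)⟩

lemma integrable_integral (hm : IsDisplacementLaw m) (h : IsLocal θ) :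
    Integrable (fun y => ∫ u, θ y u ∂m) := by
  have := hm.isProbabilityMeasure
  obtain ⟨K, hK, hb⟩ := h.abs_integral_le hm
  exact integrable_of_le_inv_one_add_sq h.measurable_integral hb

lemma integrable_exp [IsFiniteMeasure m] (h : IsLocal θ) (y : ℝ) :
    Integrable (fun u => Real.exp (θ y u)) m := by
  refine ((h.exp_sub_one.integrable_right (m := m) y).add (integrable_const 1)).congr
    (ae_of_all _ fun u => ?_)
  simp

lemma expMean_eq (hm : IsDisplacementLaw m) (h : IsLocal θ) (y : ℝ) :
    expMean m θ y = 1 + ∫ u, (Real.exp (θ y u) - 1) ∂m := by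
  have := hm.isProbabilityMeasure
  rw [integral_sub (h.integrable_exp y) (integrable_const _)]
  simp [expMean]

lemma measurable_expMean (hm : IsDisplacementLaw m) (h : IsLocal θ) :
    Measurable (expMean m θ) := by
  have := hm.isProbabilityMeasure
  rw [funext (h.expMean_eq hm)]
  exact measurable_const.add h.exp_sub_one.measurable_integral

lemma exp_neg_le_expMean (hm : IsDisplacementLaw m) (h : IsLocal θ) {A : ℝ}
    (hA : ∀ y u, |θ y u| ≤ A) (y : ℝ) : Real.exp (-A) ≤ expMean m θ y := by
  have := hm.isProbabilityMeasure
  calc Real.exp (-A) = ∫ u, Real.exp (-A) ∂m := by simp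
    _ ≤ _ := integral_mono (integrable_const _) (h.integrable_exp y) fun u =>
        Real.exp_le_exp.2 (abs_le.1 (hA y u)).1

lemma expMean_pos (hm : IsDisplacementLaw m) (h : IsLocal θ) (y : ℝ) : 0 < expMean m θ y := by
  obtain ⟨A, hA, hb⟩ := h.exists_bound
  exact (Real.exp_pos _).trans_le (h.exp_neg_le_expMean hm hb y)

/-- The generating function differs from one by the mean of the local exponent `exp θ - 1`, and
boundedness of `θ` keeps it away from zero, where `ψ` may be singular. -/
lemma abs_transform_le {ψ ψ' : ℝ → ℝ} (hψ : IsRateTransform ψ ψ') (hm : IsDisplacementLaw m)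
    (h : IsLocal θ) : ∃ K, 0 ≤ K ∧ ∀ y, |ψ (expMean m θ y)| ≤ K * (1 + y ^ 2)⁻¹ := by
  obtain ⟨A, hA, hb⟩ := h.exists_bound
  obtain ⟨K, hK, hk⟩ := h.exp_sub_one.abs_integral_le hm
  refine ⟨(1 + (Real.exp (-A))⁻¹) * K, by positivity,
    fun y => (hψ.abs_le (h.expMean_pos hm y)).trans ?_⟩
  have h1 := h.exp_neg_le_expMean hm hb y
  have h2 := hk y
  rw [mul_assoc]
  gcongr
  rw [h.expMean_eq hm]
  simpa using h2

lemma integrable_transform {ψ ψ' : ℝ → ℝ} (hψ : IsRateTransform ψ ψ') (hm : IsDisplacementLaw m)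
    (h : IsLocal θ) : Integrable (fun y => ψ (expMean m θ y)) := by
  obtain ⟨K, hK, hb⟩ := h.abs_transform_le hψ hm
  exact integrable_of_le_inv_one_add_sq (hψ.measurable.comp (h.measurable_expMean hm)) hb

lemma integrable_tilt {ψ ψ' : ℝ → ℝ} (hψ : IsRateTransform ψ ψ') (hm : IsDisplacementLaw m)
    (h : IsLocal θ) (h' : IsLocal χ) :
    Integrable (fun y => ψ' (expMean m θ y) * ∫ u, Real.exp (θ y u) * χ y u ∂m) := by
  have := hm.isProbabilityMeasure
  obtain ⟨A, hA, hb⟩ := h.exists_bound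
  obtain ⟨K, hK, hk⟩ := (h.exp_mul h').abs_integral_le hm
  refine integrable_of_le_inv_one_add_sq (K := (1 + (Real.exp (-A))⁻¹) * K)
    ((hψ.measurable_deriv.comp (h.measurable_expMean hm)).mul (h.exp_mul h').measurable_integral)
    fun y => ?_
  have h1 := h.exp_neg_le_expMean hm hb y
  have h0 := h.expMean_pos hm y
  rw [abs_mul, abs_of_pos (hψ.deriv_pos _ h0), mul_assoc]
  gcongr
  · exact (hψ.deriv_le _ h0).trans (by gcongr)
  · exact hk y

end IsLocal

end SingleFile

namespace SingleFile

variable {m : Measure (ℝ × ℝ)} {ψ ψ' : ℝ → ℝ} {θ χ : ℝ → ℝ × ℝ → ℝ}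

/-! ### Derivatives and convexity of the pressure -/

lemma IsLocal.hasDerivAt_expMean (hm : IsDisplacementLaw m) (h : IsLocal θ) (h' : IsLocal χ)
    (y s₀ : ℝ) : HasDerivAt (fun s => expMean m (fun y u => θ y u + s * χ y u) y)
      (∫ u, Real.exp (θ y u + s₀ * χ y u) * χ y u ∂m) s₀ := by
  have := hm.isProbabilityMeasure
  obtain ⟨A, hA, hb⟩ := h.exists_bound
  obtain ⟨A', hA', hb'⟩ := h'.exists_bound
  have hs : ∀ s, IsLocal (fun y u => θ y u + s * χ y u) := fun s => h.add (h'.const_mul s)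
  refine (hasDerivAt_integral_of_dominated_loc_of_deriv_le (μ := m)
    (F := fun s u => Real.exp (θ y u + s * χ y u))
    (F' := fun s u => Real.exp (θ y u + s * χ y u) * χ y u)
    (bound := fun _ => Real.exp (A + (|s₀| + 1) * A') * A') (Metric.ball_mem_nhds s₀ one_pos)
    (Eventually.of_forall fun s => ((hs s).integrable_exp y).aestronglyMeasurable)
    ((hs s₀).integrable_exp y)
    (((hs s₀).exp_mul h').integrable_right y).aestronglyMeasurable
    (ae_of_all _ fun u s hsb => ?_) (integrable_const _) (ae_of_all _ fun u s _ => ?_)).2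
  · have h1 : |s| ≤ |s₀| + 1 := by
      have : |s - s₀| < 1 := hsb
      have := abs_sub_abs_le_abs_sub s s₀
      linarith
    rw [norm_mul, Real.norm_eq_abs, Real.abs_exp, Real.norm_eq_abs]
    refine mul_le_mul (Real.exp_le_exp.2 ?_) (hb' y u) (abs_nonneg _) (Real.exp_pos _).le
    · calc θ y u + s * χ y u ≤ |θ y u| + |s| * |χ y u| := by
            rw [← abs_mul]; exact add_le_add (le_abs_self _) (le_abs_self _)
        _ ≤ A + (|s₀| + 1) * A' := add_le_add (hb y u)
            (mul_le_mul h1 (hb' y u) (abs_nonneg _) (by positivity))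
  · have := (((hasDerivAt_id s).mul_const (χ y u)).const_add (θ y u)).exp
    simpa using this

/-- Differentiation under both integrals. For `|s| < 1` all exponents share the bound `A + A'`, so
the generating functions stay above a positive constant and the derivatives are dominated by a
multiple of `(1 + y ^ 2)⁻¹`. -/
lemma hasDerivAt_pressure (hψ : IsRateTransform ψ ψ') (hm : IsDisplacementLaw m)
    (h : IsLocal θ) (h' : IsLocal χ) :
    HasDerivAt (fun s => pressure ψ m (fun y u => θ y u + s * χ y u))
      (tiltMean ψ' m θ χ) 0 := by
  have := hm.isProbabilityMeasure
  obtain ⟨A, hA, hb⟩ := h.exists_bound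
  obtain ⟨A', hA', hb'⟩ := h'.exists_bound
  obtain ⟨K, hK, hk⟩ := h'.integral_abs_le hm
  have hs : ∀ s, IsLocal (fun y u => θ y u + s * χ y u) := fun s => h.add (h'.const_mul s)
  have hbs : ∀ s ∈ Metric.ball (0 : ℝ) 1, ∀ y u, |θ y u + s * χ y u| ≤ A + A' := by
    intro s hsb y u
    have h1 : |s| ≤ 1 := by
      have : |s - 0| < 1 := hsb
      simpa using this.le
    refine (abs_add_le _ _).trans (add_le_add (hb y u) ?_)
    rw [abs_mul]
    exact (mul_le_of_le_one_left (abs_nonneg _) h1).trans (hb' y u)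
  have key := (hasDerivAt_integral_of_dominated_loc_of_deriv_le (μ := (volume : Measure ℝ))
    (F := fun s y => ψ (expMean m (fun y u => θ y u + s * χ y u) y))
    (F' := fun s y => ψ' (expMean m (fun y u => θ y u + s * χ y u) y) *
      ∫ u, Real.exp (θ y u + s * χ y u) * χ y u ∂m)
    (bound := fun y => (1 + (Real.exp (-(A + A')))⁻¹) * (Real.exp (A + A') *
      (K * (1 + y ^ 2)⁻¹))) (x₀ := 0) (Metric.ball_mem_nhds 0 one_pos)
    (Eventually.of_forall fun s => ((hs s).integrable_transform hψ hm).aestronglyMeasurable)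
    ((hs 0).integrable_transform hψ hm)
    ((hs 0).integrable_tilt hψ hm h').aestronglyMeasurable
    (ae_of_all _ fun y s hsb => ?_) ?_ (ae_of_all _ fun y s hsb => ?_)).2
  · simp only [zero_mul, add_zero] at key
    exact key
  · have h0 := (hs s).expMean_pos hm y
    rw [norm_mul, Real.norm_of_nonneg (hψ.deriv_pos _ h0).le]
    gcongr
    · refine (hψ.deriv_le _ h0).trans ?_
      gcongr
      exact (hs s).exp_neg_le_expMean hm (hbs s hsb) y
    · calc ‖∫ u, Real.exp (θ y u + s * χ y u) * χ y u ∂m‖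
          ≤ ∫ u, ‖Real.exp (θ y u + s * χ y u) * χ y u‖ ∂m := norm_integral_le_integral_norm _
        _ ≤ ∫ u, Real.exp (A + A') * |χ y u| ∂m := by
            refine integral_mono (((hs s).exp_mul h').abs.integrable_right y)
              ((h'.abs.integrable_right y).const_mul _) fun u => ?_
            simp only [norm_mul, Real.norm_eq_abs, Real.abs_exp]
            exact mul_le_mul_of_nonneg_right
              (Real.exp_le_exp.2 ((le_abs_self _).trans (hbs s hsb y u))) (abs_nonneg _)
        _ ≤ _ := by rw [integral_const_mul]; gcongr; exact hk y
  · exact ((integrable_inv_one_add_sq.const_mul K).const_mul _).const_mul _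
  · exact (hψ.hasDerivAt _ ((hs s).expMean_pos hm y)).comp s (h.hasDerivAt_expMean hm h' y s)

lemma tiltMean_add (hψ : IsRateTransform ψ ψ') (hm : IsDisplacementLaw m) (h : IsLocal θ)
    {χ' : ℝ → ℝ × ℝ → ℝ} (h' : IsLocal χ) (h'' : IsLocal χ') :
    tiltMean ψ' m θ (fun y u => χ y u + χ' y u) = tiltMean ψ' m θ χ + tiltMean ψ' m θ χ' := by
  have := hm.isProbabilityMeasure
  unfold tiltMean
  rw [← integral_add (h.integrable_tilt hψ hm h') (h.integrable_tilt hψ hm h'')]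
  congr 1; ext y
  rw [← mul_add, ← integral_add ((h.exp_mul h').integrable_right y)
    ((h.exp_mul h'').integrable_right y)]
  simp only [mul_add]

lemma tiltMean_const_mul (s : ℝ) :
    tiltMean ψ' m θ (fun y u => s * χ y u) = s * tiltMean ψ' m θ χ := by
  unfold tiltMean
  rw [← integral_const_mul]
  congr 1; ext y
  have h : ∫ u, Real.exp (θ y u) * (s * χ y u) ∂m = s * ∫ u, Real.exp (θ y u) * χ y u ∂m := by
    rw [← integral_const_mul]
    exact integral_congr_ae (ae_of_all _ fun u => by ring)
  rw [h]; ring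

/-- Jensen's inequality for the tilted law. -/
lemma IsLocal.tilt_le_log (hm : IsDisplacementLaw m) (h : IsLocal θ) (h' : IsLocal χ) (y : ℝ) :
    (∫ u, Real.exp (θ y u) * χ y u ∂m) ≤
      expMean m θ y * (Real.log (expMean m (fun y u => θ y u + χ y u) y) -
        Real.log (expMean m θ y)) ∧
    ((¬ ∃ k, ∀ᵐ u ∂m, χ y u = k) → (∫ u, Real.exp (θ y u) * χ y u ∂m) <
      expMean m θ y * (Real.log (expMean m (fun y u => θ y u + χ y u) y) -
        Real.log (expMean m θ y))) := by
  have := hm.isProbabilityMeasure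
  set H := expMean m θ y with hH
  have hpos : 0 < H := h.expMean_pos hm y
  set D := ∫ u, Real.exp (θ y u) * χ y u ∂m with hD
  set k := D / H with hk
  have hDk : D = H * k := by rw [hk]; field_simp
  have i0 := h.integrable_exp (m := m) y
  have i1 := (h.exp_mul h').integrable_right (m := m) y
  have i2 := (h.add h').integrable_exp (m := m) y
  -- `R` is the gap in `1 + x ≤ exp x` at `x = χ - k`, weighted by `exp θ`, with `k` the tilted mean
  -- of `χ`. Because of this choice of `k` the linear term integrates to zero, and `R` vanishes only
  -- where `χ = k`.
  set R : ℝ × ℝ → ℝ := fun u => Real.exp (θ y u) * (Real.exp (χ y u - k) - (χ y u - k) - 1) with hR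
  have hR0 : ∀ u, 0 ≤ R u := fun u =>
    mul_nonneg (Real.exp_pos _).le (by linarith [Real.add_one_le_exp (χ y u - k)])
  have hRe : R = fun u => Real.exp (-k) * Real.exp (θ y u + χ y u) - Real.exp (θ y u) * χ y u
      + (k - 1) * Real.exp (θ y u) := by
    ext u
    simp only [hR]
    rw [sub_eq_add_neg (χ y u) k, Real.exp_add, Real.exp_add]; ring
  have hRi : Integrable R m := by
    rw [hRe]; exact ((i2.const_mul _).sub i1).add (i0.const_mul _)
  have hint : ∫ u, R u ∂m = Real.exp (-k) * expMean m (fun y u => θ y u + χ y u) y - H := by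
    have e1 := integral_add ((i2.const_mul (Real.exp (-k))).sub i1) (i0.const_mul (k - 1))
    have e2 := integral_sub (i2.const_mul (Real.exp (-k))) i1
    simp only [Pi.sub_apply] at e1
    rw [hRe, e1, e2, integral_const_mul, integral_const_mul]
    change Real.exp (-k) * expMean m (fun y u => θ y u + χ y u) y - D + (k - 1) * H = _
    rw [hDk]; ring
  have hpos2 := (h.add h').expMean_pos hm y
  set G := expMean m (fun y u => θ y u + χ y u) y with hG
  have hlog : Real.log (Real.exp (-k) * G) = Real.log G - k := by
    rw [Real.log_mul (Real.exp_pos _).ne' hpos2.ne', Real.log_exp]; ring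
  constructor
  · have h1 : H ≤ Real.exp (-k) * G := by
      have := integral_nonneg (μ := m) (f := R) hR0
      linarith
    have h2 := Real.log_le_log hpos h1
    rw [hDk]
    exact mul_le_mul_of_nonneg_left (by linarith) hpos.le
  · intro hne
    have h1 : H < Real.exp (-k) * G := by
      by_contra hcon
      have h0 : ∫ u, R u ∂m = 0 := le_antisymm (by linarith) (integral_nonneg hR0)
      rw [integral_eq_zero_iff_of_nonneg hR0 hRi] at h0
      refine hne ⟨k, ?_⟩
      filter_upwards [h0] with u hu
      by_contra hcon2
      have := Real.add_one_lt_exp (sub_ne_zero.2 hcon2)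
      have h3 : 0 < R u := mul_pos (Real.exp_pos _) (by linarith)
      exact h3.ne' hu
    have h2 := Real.log_lt_log hpos h1
    rw [hDk]
    exact mul_lt_mul_of_pos_left (by linarith) hpos

/-- The pressure lies strictly above its tangents. -/
lemma tiltMean_lt_pressure_sub (hψ : IsRateTransform ψ ψ') (hm : IsDisplacementLaw m)
    (h : IsLocal θ) (h' : IsLocal χ) (hne : ∀ y, ¬ ∃ k, ∀ᵐ u ∂m, χ y u = k) :
    tiltMean ψ' m θ χ < pressure ψ m (fun y u => θ y u + χ y u) - pressure ψ m θ := by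
  unfold pressure tiltMean
  rw [← integral_sub ((h.add h').integrable_transform hψ hm) (h.integrable_transform hψ hm)]
  have hi2 := ((h.add h').integrable_transform hψ hm).sub (h.integrable_transform hψ hm)
  have hi1 := h.integrable_tilt hψ hm h'
  have e1 := integral_sub hi2 hi1
  simp only [Pi.sub_apply] at e1
  rw [← sub_pos, ← e1]
  -- Jensen's inequality is strict at every starting point; convexity of `ψ ∘ exp` carries it from
  -- the logarithm to `ψ`, and `ψ' > 0` keeps it strict.
  have hlt : ∀ y, 0 < (ψ (expMean m (fun y u => θ y u + χ y u) y) - ψ (expMean m θ y)) -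
      ψ' (expMean m θ y) * ∫ u, Real.exp (θ y u) * χ y u ∂m := fun y => by
    have h1 := (h.tilt_le_log hm h' y).2 (hne y)
    have h0 := h.expMean_pos hm y
    have h2 := hψ.convex _ _ h0 ((h.add h').expMean_pos hm y)
    have h3 := mul_lt_mul_of_pos_left h1 (hψ.deriv_pos _ h0)
    linarith
  rw [integral_pos_iff_support_of_nonneg (fun y => (hlt y).le) (hi2.sub hi1)]
  have : (Function.support fun y => (ψ (expMean m (fun y u => θ y u + χ y u) y) -
      ψ (expMean m θ y)) - ψ' (expMean m θ y) * ∫ u, Real.exp (θ y u) * χ y u ∂m) = Set.univ :=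
    Set.eq_univ_of_forall fun y => (hlt y).ne'
  rw [this]; simp

/-- A positive direction has positive tilted mean. -/
lemma tiltMean_pos (hψ : IsRateTransform ψ ψ') (hm : IsDisplacementLaw m)
    (h : IsLocal θ) (h' : IsLocal χ) (hχ : ∀ y u, 0 ≤ χ y u)
    (hpos : ∀ y, 0 < m {u | 0 < χ y u}) : 0 < tiltMean ψ' m θ χ := by
  have := hm.isProbabilityMeasure
  have hlt : ∀ y, 0 < ψ' (expMean m θ y) * ∫ u, Real.exp (θ y u) * χ y u ∂m := fun y => by
    refine mul_pos (hψ.deriv_pos _ (h.expMean_pos hm y)) ?_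
    rw [integral_pos_iff_support_of_nonneg
      (fun u => mul_nonneg (Real.exp_pos _).le (hχ y u)) ((h.exp_mul h').integrable_right y)]
    refine (hpos y).trans_le (measure_mono fun u hu => ?_)
    exact (mul_pos (Real.exp_pos _) hu).ne'
  unfold tiltMean
  rw [integral_pos_iff_support_of_nonneg (fun y => (hlt y).le) (h.integrable_tilt hψ hm h')]
  have : (Function.support fun y => ψ' (expMean m θ y) * ∫ u, Real.exp (θ y u) * χ y u ∂m)
      = Set.univ := Set.eq_univ_of_forall fun y => (hlt y).ne'
  rw [this]; simp

/-- The pressure is locally Lipschitz in the exponent. -/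
lemma abs_pressure_sub_le (hψ : IsRateTransform ψ ψ') (hm : IsDisplacementLaw m)
    (h : IsLocal θ) (h' : IsLocal χ) {A : ℝ} (hb : ∀ y u, |θ y u| ≤ A) (hb' : ∀ y u, |χ y u| ≤ A) :
    |pressure ψ m θ - pressure ψ m χ| ≤ (1 + (Real.exp (-A))⁻¹) * Real.exp A *
      ∫ y, ∫ u, |θ y u - χ y u| ∂m := by
  have := hm.isProbabilityMeasure
  unfold pressure
  have hi := (h.sub h').abs.integrable_integral hm
  rw [← integral_sub (h.integrable_transform hψ hm) (h'.integrable_transform hψ hm),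
    ← integral_const_mul]
  refine abs_integral_le_integral_abs.trans (integral_mono
    ((h.integrable_transform hψ hm).sub (h'.integrable_transform hψ hm)).abs
    (hi.const_mul _) fun y => ?_)
  refine (hψ.abs_sub_le (Real.exp_pos (-A)) (h.exp_neg_le_expMean hm hb y)
    (h'.exp_neg_le_expMean hm hb' y)).trans ?_
  rw [mul_assoc]
  refine mul_le_mul_of_nonneg_left ?_ (by positivity)
  unfold expMean
  rw [← integral_sub (h.integrable_exp y) (h'.integrable_exp y), ← integral_const_mul]
  refine abs_integral_le_integral_abs.trans (integral_mono
    ((h.integrable_exp y).sub (h'.integrable_exp y)).abs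
    (((h.sub h').abs.integrable_right y).const_mul _) fun u => ?_)
  exact abs_exp_sub_exp_le (hb y u) (hb' y u)

end SingleFile

namespace SingleFile

variable {m : Measure (ℝ × ℝ)} {ψ ψ' : ℝ → ℝ} {θ χ : ℝ → ℝ × ℝ → ℝ}

/-! ### Level crossings -/

/-- `π` is one of the two coordinates. -/
def IsCoord (π : ℝ × ℝ → ℝ) : Prop := π = Prod.fst ∨ π = Prod.snd

/-- The signed contribution of a particle started at `y`, with displacements `u`, to the number
of particles having crossed from the negative half line to `(x, ∞)`. -/
noncomputable def crossing (π : ℝ × ℝ → ℝ) (x y : ℝ) (u : ℝ × ℝ) : ℝ :=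
  (if x < y + π u then 1 else 0) - (if 0 < y then 1 else 0)

/-- The exponent with weights `B` on the crossings of the levels `ξ` at the two times. -/
noncomputable def crossings (B ξ : ℝ × ℝ) (y : ℝ) (u : ℝ × ℝ) : ℝ :=
  B.1 * crossing Prod.fst ξ.1 y u + B.2 * crossing Prod.snd ξ.2 y u

lemma isCoord_fst : IsCoord Prod.fst := Or.inl rfl

lemma isCoord_snd : IsCoord Prod.snd := Or.inr rfl

namespace IsCoord

variable {π : ℝ × ℝ → ℝ}

lemma continuous (hπ : IsCoord π) : Continuous π := by
  rcases hπ with rfl | rfl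
  · exact continuous_fst
  · exact continuous_snd

lemma abs_le (hπ : IsCoord π) (u : ℝ × ℝ) : |π u| ≤ ‖u‖ := by
  rcases hπ with rfl | rfl
  · exact norm_fst_le u
  · exact norm_snd_le u

lemma exists_eq (hπ : IsCoord π) (a : ℝ) : ∃ u, π u = a := by
  rcases hπ with rfl | rfl
  · exact ⟨(a, 0), rfl⟩
  · exact ⟨(0, a), rfl⟩

lemma integrable (hπ : IsCoord π) (hm : IsDisplacementLaw m) : Integrable π m :=
  hm.integrable_norm.mono' hπ.continuous.aestronglyMeasurable (ae_of_all _ hπ.abs_le)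

lemma abs_crossing_le_near (hπ : IsCoord π) (x y : ℝ) (u : ℝ × ℝ) :
    |crossing π x y u| ≤ near |x| y u := by
  have h1 := hπ.abs_le u
  have h2 := neg_abs_le (π u)
  have h3 := le_abs_self (π u)
  have h4 := neg_abs_le x
  have h5 := le_abs_self x
  unfold crossing near
  by_cases hy : 0 < y
  · rw [abs_of_pos hy]
    split_ifs <;> norm_num
    all_goals linarith
  · rw [abs_of_nonpos (not_lt.1 hy)]
    split_ifs <;> norm_num
    all_goals linarith

lemma isLocal_crossing (hπ : IsCoord π) (x : ℝ) : IsLocal (crossing π x) := by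
  refine ⟨?_, 1, |x|, zero_le_one, abs_nonneg x, fun y u => ?_⟩
  · unfold crossing Function.uncurry
    have hc := hπ.continuous.measurable
    refine (Measurable.ite (measurableSet_lt (by fun_prop) (by fun_prop)) measurable_const
      measurable_const).sub (Measurable.ite (measurableSet_lt (by fun_prop) (by fun_prop))
      measurable_const measurable_const)
  · rw [one_mul]; exact hπ.abs_crossing_le_near x y u

lemma abs_crossing_le_one (hπ : IsCoord π) (x y : ℝ) (u : ℝ × ℝ) : |crossing π x y u| ≤ 1 :=
  (hπ.abs_crossing_le_near x y u).trans (near_le_one _ _ _)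

end IsCoord

lemma isLocal_crossings (B ξ : ℝ × ℝ) : IsLocal (crossings B ξ) :=
  ((isCoord_fst.isLocal_crossing ξ.1).const_mul B.1).add
    ((isCoord_snd.isLocal_crossing ξ.2).const_mul B.2)

lemma abs_crossings_le (B ξ : ℝ × ℝ) (y : ℝ) (u : ℝ × ℝ) :
    |crossings B ξ y u| ≤ |B.1| + |B.2| := by
  unfold crossings
  refine (abs_add_le _ _).trans ?_
  rw [abs_mul, abs_mul]
  exact add_le_add
    (mul_le_of_le_one_right (abs_nonneg _) (isCoord_fst.abs_crossing_le_one _ _ _))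
    (mul_le_of_le_one_right (abs_nonneg _) (isCoord_snd.abs_crossing_le_one _ _ _))

/-- Integrating over the starting point first turns integrals of crossings into lengths of
intervals. -/
lemma IsLocal.integral_swap (hm : IsDisplacementLaw m) (h : IsLocal θ) :
    ∫ y, ∫ u, θ y u ∂m = ∫ u, (∫ y, θ y u) ∂m := by
  have := hm.isProbabilityMeasure
  refine integral_integral_swap ?_
  refine (integrable_prod_iff h.measurable.aestronglyMeasurable).2
    ⟨ae_of_all _ fun y => h.integrable_right y, ?_⟩
  exact h.abs.integrable_integral hm

lemma IsLocal.integral_integral_add (hm : IsDisplacementLaw m) (h : IsLocal θ) (h' : IsLocal χ) :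
    ∫ y, ∫ u, (θ y u + χ y u) ∂m = (∫ y, ∫ u, θ y u ∂m) + ∫ y, ∫ u, χ y u ∂m := by
  have := hm.isProbabilityMeasure
  rw [← integral_add (h.integrable_integral hm) (h'.integrable_integral hm)]
  congr 1; ext y
  exact integral_add (h.integrable_right y) (h'.integrable_right y)

lemma integral_ite_sub_ite_of_le {a b : ℝ} (h : a ≤ b) :
    ∫ y : ℝ, ((if a < y then 1 else 0) - (if b < y then 1 else 0) : ℝ) = b - a := by
  have : (fun y : ℝ => ((if a < y then 1 else 0) - (if b < y then 1 else 0) : ℝ))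
      = Set.indicator (Set.Ioc a b) 1 := by
    ext y
    simp only [Set.indicator, Set.mem_Ioc, Pi.one_apply]
    split_ifs <;> grind
  rw [this, integral_indicator_one measurableSet_Ioc]
  simp [h]

lemma integral_ite_sub_ite (a b : ℝ) :
    ∫ y : ℝ, ((if a < y then 1 else 0) - (if b < y then 1 else 0) : ℝ) = b - a := by
  rcases le_total a b with h | h
  · exact integral_ite_sub_ite_of_le h
  · have := integral_ite_sub_ite_of_le h
    rw [← neg_inj, ← integral_neg]
    simp only [neg_sub, this]

lemma integral_abs_ite_sub_ite (a b : ℝ) :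
    ∫ y : ℝ, |((if a < y then 1 else 0) - (if b < y then 1 else 0) : ℝ)| = |b - a| := by
  rcases le_total a b with h | h
  · rw [abs_of_nonneg (by linarith), ← integral_ite_sub_ite_of_le h]
    congr 1; ext y
    rw [abs_of_nonneg]
    split_ifs <;> grind
  · rw [abs_sub_comm, abs_of_nonneg (by linarith), ← integral_ite_sub_ite_of_le h]
    congr 1; ext y
    rw [abs_sub_comm, abs_of_nonneg]
    split_ifs <;> grind

/-! ### Mean crossings over all starting points -/

section Integrals

variable {π : ℝ × ℝ → ℝ}

lemma crossing_eq (π : ℝ × ℝ → ℝ) (x y : ℝ) (u : ℝ × ℝ) :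
    crossing π x y u = (if x - π u < y then 1 else 0) - (if 0 < y then 1 else 0) := by
  unfold crossing; simp only [sub_lt_iff_lt_add]

/-- For a fixed displacement the two crossings differ exactly for starting points in an interval of
length `|a - b|`. -/
lemma integral_abs_crossing_sub (hm : IsDisplacementLaw m) (hπ : IsCoord π) (a b : ℝ) :
    ∫ y, ∫ u, |crossing π a y u - crossing π b y u| ∂m = |a - b| := by
  have := hm.isProbabilityMeasure
  rw [((hπ.isLocal_crossing a).sub (hπ.isLocal_crossing b)).abs.integral_swap hm]
  simp only [crossing_eq, sub_sub_sub_cancel_right, integral_abs_ite_sub_ite, integral_const,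
    probReal_univ, one_smul]
  rw [abs_sub_comm]

lemma integral_crossing (hm : IsDisplacementLaw m) (hπ : IsCoord π) (x : ℝ) :
    ∫ y, ∫ u, crossing π x y u ∂m = (∫ u, π u ∂m) - x := by
  have := hm.isProbabilityMeasure
  rw [(hπ.isLocal_crossing x).integral_swap hm]
  simp only [crossing_eq, integral_ite_sub_ite, zero_sub, neg_sub]
  rw [integral_sub (hπ.integrable hm) (integrable_const x)]
  simp

lemma integral_abs_crossing_le (hm : IsDisplacementLaw m) (hπ : IsCoord π) (x : ℝ) :
    ∫ y, ∫ u, |crossing π x y u| ∂m ≤ (∫ u, ‖u‖ ∂m) + |x| := by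
  have := hm.isProbabilityMeasure
  rw [(hπ.isLocal_crossing x).abs.integral_swap hm]
  simp only [crossing_eq, integral_abs_ite_sub_ite]
  have h : ∫ u, |0 - (x - π u)| ∂m ≤ ∫ u, (‖u‖ + |x|) ∂m := by
    refine integral_mono ((integrable_const (0 : ℝ)).sub ((integrable_const x).sub
      (hπ.integrable hm))).abs (hm.integrable_norm.add (integrable_const _)) fun u => ?_
    have h1 := hπ.abs_le u
    simp only [zero_sub, neg_sub]
    exact (abs_sub _ _).trans (by linarith)
  rwa [integral_add hm.integrable_norm (integrable_const _), integral_const, probReal_univ,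
    one_smul] at h

/-- Exponential decay of the probability that the tracer is far from the origin. -/
lemma exists_pressure_crossing_le (hψ : IsRateTransform ψ ψ') (hm : IsDisplacementLaw m)
    (hπ : IsCoord π) : ∃ K, ∀ x s, |s| = 1 / 2 →
      pressure ψ m (fun y u => s * crossing π x y u) ≤ K + |x| / 4 - s * x := by
  have := hm.isProbabilityMeasure
  refine ⟨|∫ u, π u ∂m| + ∫ u, ‖u‖ ∂m, fun x s hs => ?_⟩
  have hl := (hπ.isLocal_crossing x).const_mul s
  have hs2 : s ^ 2 = 1 / 4 := by rw [← sq_abs, hs]; norm_num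
  have hl2 := (((hπ.isLocal_crossing x).const_mul s).add
    ((hπ.isLocal_crossing x).abs.const_mul (1 / 4)))
  have h1 : pressure ψ m (fun y u => s * crossing π x y u) ≤
      ∫ y, ∫ u, (s * crossing π x y u + 1 / 4 * |crossing π x y u|) ∂m := by
    refine integral_mono (hl.integrable_transform hψ hm) (hl2.integrable_integral hm) fun y => ?_
    refine (hψ.le_sub_one _ (hl.expMean_pos hm y)).trans ?_
    rw [hl.expMean_eq hm, add_sub_cancel_left]
    refine integral_mono (hl.exp_sub_one.integrable_right y) (hl2.integrable_right y) fun u => ?_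
    have hc := hπ.abs_crossing_le_one x y u
    -- As `|s| = 1 / 2` and crossings are at most one in modulus, the quadratic remainder of `exp`
    -- is at most a quarter of the crossing. This produces `|x| / 4`, only half of the gain `s * x`
    -- when `s` has the sign of `x`.
    have habs : |s * crossing π x y u| ≤ 1 := by
      rw [abs_mul, hs]; linarith
    have h2 := Real.abs_exp_sub_one_sub_id_le habs
    have h3 := le_abs_self (Real.exp (s * crossing π x y u) - 1 - s * crossing π x y u)
    have h4 : (s * crossing π x y u) ^ 2 ≤ 1 / 4 * |crossing π x y u| := by
      rw [mul_pow, hs2, ← sq_abs]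
      nlinarith [abs_nonneg (crossing π x y u)]
    simp only
    linarith
  have h2 : ∫ y, ∫ u, (s * crossing π x y u + 1 / 4 * |crossing π x y u|) ∂m
      = s * (∫ y, ∫ u, crossing π x y u ∂m) + 1 / 4 * ∫ y, ∫ u, |crossing π x y u| ∂m := by
    rw [hl.integral_integral_add hm ((hπ.isLocal_crossing x).abs.const_mul (1 / 4))]
    simp only [integral_const_mul]
  rw [h2, integral_crossing hm hπ] at h1
  have h3 := integral_abs_crossing_le hm hπ x
  have h4 : s * ∫ u, π u ∂m ≤ |∫ u, π u ∂m| := by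
    refine (le_abs_self _).trans ?_
    rw [abs_mul, hs]
    linarith [abs_nonneg (∫ u, π u ∂m)]
  have h5 : 0 ≤ ∫ u, ‖u‖ ∂m := integral_nonneg fun u => norm_nonneg u
  linarith

/-- The difference of the crossings indicates a landing between `a` and `b`, which has positive
probability from every starting point. In the lower bound this separates the level `ξ` from its
neighbours. -/
lemma tiltMean_crossing_lt (hψ : IsRateTransform ψ ψ') (hm : IsDisplacementLaw m)
    (hπ : IsCoord π) (h : IsLocal θ) {a b : ℝ} (hab : a < b) :
    tiltMean ψ' m θ (crossing π b) < tiltMean ψ' m θ (crossing π a) := by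
  have hl := (hπ.isLocal_crossing a).sub (hπ.isLocal_crossing b)
  have h1 : 0 < tiltMean ψ' m θ (fun y u => crossing π a y u - crossing π b y u) := by
    refine tiltMean_pos hψ hm h hl (fun y u => ?_) fun y => ?_
    · unfold crossing
      split_ifs <;> norm_num <;> linarith
    · refine (hm.open_pos {u | a < y + π u ∧ y + π u < b} ?_ ?_).trans_le
        (measure_mono fun u hu => ?_)
      · exact (isOpen_lt continuous_const (continuous_const.add hπ.continuous)).inter
          (isOpen_lt (continuous_const.add hπ.continuous) continuous_const)
      · obtain ⟨u, hu⟩ := hπ.exists_eq ((a + b) / 2 - y)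
        exact ⟨u, by simp only [Set.mem_ofPred_eq, hu]; constructor <;> linarith⟩
      · obtain ⟨h1, h2⟩ := hu
        simp only [Set.mem_ofPred_eq, crossing, h1, if_true, not_lt.2 h2.le, if_false]
        norm_num
  have h2 := tiltMean_add hψ hm h hl (hπ.isLocal_crossing b)
  simp only [sub_add_cancel] at h2
  change tiltMean ψ' m θ (crossing π a) = _ + tiltMean ψ' m θ (crossing π b) at h2
  linarith

end Integrals

/-- Crossings jump as the level moves, but after integration over starting points they are Lipschitz
in the level, so the pressure is locally Lipschitz in levels and weights together. -/
lemma abs_pressure_crossings_sub_le (hψ : IsRateTransform ψ ψ') (hm : IsDisplacementLaw m)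
    (B B' ξ ξ' : ℝ × ℝ) {A : ℝ} (hA : |B.1| + |B.2| ≤ A) (hA' : |B'.1| + |B'.2| ≤ A) :
    |pressure ψ m (crossings B ξ) - pressure ψ m (crossings B' ξ')| ≤
      (1 + (Real.exp (-A))⁻¹) * Real.exp A *
      (|B.1| * |ξ.1 - ξ'.1| + |B.1 - B'.1| * ((∫ u, ‖u‖ ∂m) + |ξ'.1|) +
        (|B.2| * |ξ.2 - ξ'.2| + |B.2 - B'.2| * ((∫ u, ‖u‖ ∂m) + |ξ'.2|))) := by
  have := hm.isProbabilityMeasure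
  refine (abs_pressure_sub_le hψ hm (isLocal_crossings B ξ) (isLocal_crossings B' ξ')
    (fun y u => (abs_crossings_le B ξ y u).trans hA)
    (fun y u => (abs_crossings_le B' ξ' y u).trans hA')).trans ?_
  refine mul_le_mul_of_nonneg_left ?_ (by positivity)
  have l1 := fun x => isCoord_fst.isLocal_crossing x
  have l2 := fun x => isCoord_snd.isLocal_crossing x
  have j1 := ((l1 ξ.1).sub (l1 ξ'.1)).abs.const_mul |B.1|
  have j2 := (l1 ξ'.1).abs.const_mul |B.1 - B'.1|
  have j3 := ((l2 ξ.2).sub (l2 ξ'.2)).abs.const_mul |B.2|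
  have j4 := (l2 ξ'.2).abs.const_mul |B.2 - B'.2|
  calc ∫ y, ∫ u, |crossings B ξ y u - crossings B' ξ' y u| ∂m
      ≤ ∫ y, ∫ u, ((|B.1| * |crossing Prod.fst ξ.1 y u - crossing Prod.fst ξ'.1 y u| +
          |B.1 - B'.1| * |crossing Prod.fst ξ'.1 y u|) +
          (|B.2| * |crossing Prod.snd ξ.2 y u - crossing Prod.snd ξ'.2 y u| +
          |B.2 - B'.2| * |crossing Prod.snd ξ'.2 y u|)) ∂m := by
        refine integral_mono
          (((isLocal_crossings B ξ).sub (isLocal_crossings B' ξ')).abs.integrable_integral hm)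
          (((j1.add j2).add (j3.add j4)).integrable_integral hm) fun y => ?_
        refine integral_mono
          (((isLocal_crossings B ξ).sub (isLocal_crossings B' ξ')).abs.integrable_right y)
          (((j1.add j2).add (j3.add j4)).integrable_right y) fun u => ?_
        simp only [← abs_mul]
        refine le_trans (le_of_eq ?_) ((abs_add_le _ _).trans
          (add_le_add (abs_add_le _ _) (abs_add_le _ _)))
        congr 1
        unfold crossings; ring
    _ = _ := by
        rw [(j1.add j2).integral_integral_add hm (j3.add j4), j1.integral_integral_add hm j2,
          j3.integral_integral_add hm j4]
    _ ≤ _ := by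
        simp only [integral_const_mul, integral_abs_crossing_sub hm isCoord_fst,
          integral_abs_crossing_sub hm isCoord_snd]
        gcongr
        · exact integral_abs_crossing_le hm isCoord_fst _
        · exact integral_abs_crossing_le hm isCoord_snd _

/-- Continuity of the pressure in the weights and the levels. -/
lemma continuous_pressure_crossings (hψ : IsRateTransform ψ ψ') (hm : IsDisplacementLaw m) :
    Continuous (fun p : (ℝ × ℝ) × (ℝ × ℝ) => pressure ψ m (crossings p.1 p.2)) := by
  rw [continuous_iff_continuousAt]
  rintro ⟨B', ξ'⟩
  rw [ContinuousAt, tendsto_iff_norm_sub_tendsto_zero]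
  set A := |B'.1| + |B'.2| + 1 with hA
  have hev : ∀ᶠ p : (ℝ × ℝ) × (ℝ × ℝ) in 𝓝 (B', ξ'), |p.1.1| + |p.1.2| ≤ A := by
    have hc : Continuous fun p : (ℝ × ℝ) × (ℝ × ℝ) => |p.1.1| + |p.1.2| := by fun_prop
    exact (hc.continuousAt.eventually (Iio_mem_nhds (by simp [hA] : _ < A))).mono fun p hp => hp.le
  have hlim : Tendsto (fun p : (ℝ × ℝ) × (ℝ × ℝ) => (1 + (Real.exp (-A))⁻¹) * Real.exp A *
      (|p.1.1| * |p.2.1 - ξ'.1| + |p.1.1 - B'.1| * ((∫ u, ‖u‖ ∂m) + |ξ'.1|) +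
        (|p.1.2| * |p.2.2 - ξ'.2| + |p.1.2 - B'.2| * ((∫ u, ‖u‖ ∂m) + |ξ'.2|))))
      (𝓝 (B', ξ')) (𝓝 0) := by
    have hc : Continuous (fun p : (ℝ × ℝ) × (ℝ × ℝ) => (1 + (Real.exp (-A))⁻¹) * Real.exp A *
      (|p.1.1| * |p.2.1 - ξ'.1| + |p.1.1 - B'.1| * ((∫ u, ‖u‖ ∂m) + |ξ'.1|) +
        (|p.1.2| * |p.2.2 - ξ'.2| + |p.1.2 - B'.2| * ((∫ u, ‖u‖ ∂m) + |ξ'.2|)))) := by fun_prop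
    convert hc.tendsto (B', ξ') using 2
    simp
  refine squeeze_zero' (Eventually.of_forall fun p => norm_nonneg _) ?_ hlim
  filter_upwards [hev] with p hp
  exact abs_pressure_crossings_sub_le hψ hm p.1 B' p.2 ξ' hp (by simp [hA])

end SingleFile

namespace SingleFile

variable {m : Measure (ℝ × ℝ)} {ψ ψ' : ℝ → ℝ} {θ χ : ℝ → ℝ × ℝ → ℝ}

/-! ### Existence and uniqueness of the stationary point -/

lemma crossings_add (B v ξ : ℝ × ℝ) :
    crossings (B + v) ξ = fun y u => crossings B ξ y u + crossings v ξ y u := by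
  ext y u; simp only [crossings, Prod.fst_add, Prod.snd_add]; ring

/-- Displacements exceeding neither level, the first only, or the second only form open sets of
positive mass. Comparing the three values forces both weights to vanish. -/
lemma crossings_not_const (hm : IsDisplacementLaw m) {v : ℝ × ℝ} (hv : v ≠ 0) (ξ : ℝ × ℝ) (y : ℝ) :
    ¬ ∃ k, ∀ᵐ u ∂m, crossings v ξ y u = k := by
  rintro ⟨k, hk⟩
  have key : ∀ U : Set (ℝ × ℝ), IsOpen U → U.Nonempty → ∃ u ∈ U, crossings v ξ y u = k := by
    intro U hU hne
    by_contra hcon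
    push Not at hcon
    refine (hm.open_pos U hU hne).ne' (measure_mono_null (fun u hu => ?_) (ae_iff.1 hk))
    exact hcon u hu
  have o1 : IsOpen {u : ℝ × ℝ | y + u.1 < ξ.1} := isOpen_lt (by fun_prop) (by fun_prop)
  have o1' : IsOpen {u : ℝ × ℝ | ξ.1 < y + u.1} := isOpen_lt (by fun_prop) (by fun_prop)
  have o2 : IsOpen {u : ℝ × ℝ | y + u.2 < ξ.2} := isOpen_lt (by fun_prop) (by fun_prop)
  have o2' : IsOpen {u : ℝ × ℝ | ξ.2 < y + u.2} := isOpen_lt (by fun_prop) (by fun_prop)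
  obtain ⟨a, ⟨ha1, ha2⟩, ha⟩ := key _ (o1.inter o2) ⟨(ξ.1 - y - 1, ξ.2 - y - 1), by
    constructor <;> simp only [Set.mem_ofPred_eq] <;> linarith⟩
  obtain ⟨b, ⟨hb1, hb2⟩, hb⟩ := key _ (o1'.inter o2) ⟨(ξ.1 - y + 1, ξ.2 - y - 1), by
    constructor <;> simp only [Set.mem_ofPred_eq] <;> linarith⟩
  obtain ⟨c, ⟨hc1, hc2⟩, hc⟩ := key _ (o1.inter o2') ⟨(ξ.1 - y - 1, ξ.2 - y + 1), by
    constructor <;> simp only [Set.mem_ofPred_eq] <;> linarith⟩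
  simp only [Set.mem_ofPred_eq] at ha1 ha2 hb1 hb2 hc1 hc2
  simp only [crossings, crossing, not_lt.2 ha1.le, not_lt.2 ha2.le, if_false] at ha
  simp only [crossings, crossing, hb1, not_lt.2 hb2.le, if_false, if_true] at hb
  simp only [crossings, crossing, not_lt.2 hc1.le, hc2, if_false, if_true] at hc
  exact hv (Prod.ext (by simp only [Prod.fst_zero]; linarith)
    (by simp only [Prod.snd_zero]; linarith))

lemma tiltMean_crossings (hψ : IsRateTransform ψ ψ') (hm : IsDisplacementLaw m) (h : IsLocal θ)
    (v ξ : ℝ × ℝ) : tiltMean ψ' m θ (crossings v ξ) =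
      v.1 * tiltMean ψ' m θ (crossing Prod.fst ξ.1) +
      v.2 * tiltMean ψ' m θ (crossing Prod.snd ξ.2) := by
  have := tiltMean_add hψ hm h ((isCoord_fst.isLocal_crossing ξ.1).const_mul v.1)
    ((isCoord_snd.isLocal_crossing ξ.2).const_mul v.2)
  rw [tiltMean_const_mul, tiltMean_const_mul] at this
  exact this

/-- `B` is a critical point of the pressure. -/
def IsCritical (ψ' : ℝ → ℝ) (m : Measure (ℝ × ℝ)) (ξ B : ℝ × ℝ) : Prop :=
  tiltMean ψ' m (crossings B ξ) (crossing Prod.fst ξ.1) = 0 ∧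
    tiltMean ψ' m (crossings B ξ) (crossing Prod.snd ξ.2) = 0

/-- At a critical point the tangent is horizontal, and the pressure lies strictly above it. -/
lemma IsCritical.pressure_lt (hψ : IsRateTransform ψ ψ') (hm : IsDisplacementLaw m)
    {ξ B B' : ℝ × ℝ} (hB : IsCritical ψ' m ξ B) (hne : B' ≠ B) :
    pressure ψ m (crossings B ξ) < pressure ψ m (crossings B' ξ) := by
  have h := tiltMean_lt_pressure_sub hψ hm (isLocal_crossings B ξ) (isLocal_crossings (B' - B) ξ)
    (crossings_not_const hm (sub_ne_zero.2 hne) ξ)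
  rw [tiltMean_crossings hψ hm (isLocal_crossings B ξ), hB.1, hB.2, ← crossings_add] at h
  simp only [mul_zero, add_zero, add_sub_cancel] at h
  linarith

lemma IsCritical.pressure_le (hψ : IsRateTransform ψ ψ') (hm : IsDisplacementLaw m)
    {ξ B : ℝ × ℝ} (hB : IsCritical ψ' m ξ B) (B' : ℝ × ℝ) :
    pressure ψ m (crossings B ξ) ≤ pressure ψ m (crossings B' ξ) := by
  rcases eq_or_ne B' B with rfl | h
  · exact le_rfl
  · exact (hB.pressure_lt hψ hm h).le

/-- Keep only the contribution of the event `S` to the expectation. -/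
lemma IsLocal.log_measure_add_le (hm : IsDisplacementLaw m) (h : IsLocal θ) (y v : ℝ)
    {S : Set (ℝ × ℝ)} (hS : MeasurableSet S) (h0 : 0 < m.real S) (hv : ∀ u ∈ S, v ≤ θ y u) :
    Real.log (m.real S) + v ≤ Real.log (expMean m θ y) := by
  have := hm.isProbabilityMeasure
  nth_rewrite 1 [← Real.log_exp v]
  rw [← Real.log_mul h0.ne' (Real.exp_pos _).ne']
  refine Real.log_le_log (mul_pos h0 (Real.exp_pos _)) ?_
  calc m.real S * Real.exp v = ∫ u in S, Real.exp v ∂m := by simp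
    _ ≤ ∫ u in S, Real.exp (θ y u) ∂m :=
        setIntegral_mono_on (integrable_const _).integrableOn (h.integrable_exp y).integrableOn hS
          fun u hu => Real.exp_le_exp.2 (hv u hu)
    _ ≤ _ := setIntegral_le_integral (h.integrable_exp y) (ae_of_all _ fun u => (Real.exp_pos _).le)

/-- Uniform lower bounds on the one-particle generating functions. -/
lemma exists_log_expMean_crossings_ge (hm : IsDisplacementLaw m) (ξ : ℝ × ℝ) :
    ∃ K c : ℝ, 0 ≤ K ∧ 0 ≤ c ∧ ∀ B : ℝ × ℝ, ∀ y,
      -(K * (1 + y ^ 2)⁻¹) ≤ Real.log (expMean m (crossings B ξ) y) ∧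
      (y ∈ Set.Ioo (-1) 0 → max B.1 0 + max B.2 0 - c ≤ Real.log (expMean m (crossings B ξ) y)) ∧
      (y ∈ Set.Ioo 0 1 →
        max (-B.1) 0 + max (-B.2) 0 - c ≤ Real.log (expMean m (crossings B ξ) y)) := by
  have := hm.isProbabilityMeasure
  set M := max |ξ.1| |ξ.2| with hM
  have hM0 : 0 ≤ M := (abs_nonneg _).trans (le_max_left _ _)
  have b1 := abs_le.1 (le_max_left |ξ.1| |ξ.2|)
  have b2 := abs_le.1 (le_max_right |ξ.1| |ξ.2|)
  rw [← hM] at b1 b2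
  -- displacements pointing far in prescribed directions
  set V : Bool → Bool → Set (ℝ × ℝ) := fun a b =>
    (if a then Set.Ioi (M + 1) else Set.Iio (-M - 1)) ×ˢ
      (if b then Set.Ioi (M + 1) else Set.Iio (-M - 1)) with hV
  have hVo : ∀ a b, IsOpen (V a b) := by
    intro a b
    refine IsOpen.prod ?_ ?_ <;> split_ifs <;> first | exact isOpen_Ioi | exact isOpen_Iio
  have hVn : ∀ a b, (V a b).Nonempty := by
    intro a b
    refine Set.Nonempty.prod ?_ ?_ <;> split_ifs <;>
      first | exact Set.nonempty_Ioi | exact Set.nonempty_Iio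
  have hVp : ∀ a b, 0 < m.real (V a b) := fun a b =>
    ENNReal.toReal_pos (hm.open_pos _ (hVo a b) (hVn a b)).ne' (measure_ne_top _ _)
  -- A lower bound for all four quadrants at once, so that the constants do not depend on the signs
  -- of `B`.
  set κ := min (min (m.real (V true true)) (m.real (V true false)))
    (min (m.real (V false true)) (m.real (V false false))) with hκ
  have hκ0 : 0 < κ := lt_min (lt_min (hVp _ _) (hVp _ _)) (lt_min (hVp _ _) (hVp _ _))
  have hκV : ∀ a b, κ ≤ m.real (V a b) := by
    intro a b
    cases a <;> cases b <;> simp [hκ]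
  have hκ1 : κ ≤ 1 := (hκV true true).trans measureReal_le_one
  obtain ⟨K, hK, hn⟩ := hm.integral_near_le M
  refine ⟨κ⁻¹ * K, -Real.log κ, by positivity, by linarith [Real.log_nonpos hκ0.le hκ1],
    fun B y => ⟨?_, fun hy => ?_, fun hy => ?_⟩⟩
  · -- the event that nothing happens
    set S : Set (ℝ × ℝ) :=
      {u | crossing Prod.fst ξ.1 y u = 0} ∩ {u | crossing Prod.snd ξ.2 y u = 0} with hS
    have hSm : MeasurableSet S :=
      ((isCoord_fst.isLocal_crossing ξ.1).measurable_right y (measurableSet_singleton 0)).inter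
        ((isCoord_snd.isLocal_crossing ξ.2).measurable_right y (measurableSet_singleton 0))
    have hSκ : κ ≤ m.real S := by
      by_cases hy : 0 < y
      · refine (hκV true true).trans (measureReal_mono fun u hu => ?_)
        simp only [hV, if_true, Set.mem_prod, Set.mem_Ioi] at hu
        constructor <;> simp only [Set.mem_ofPred_eq, crossing, hy, if_true] <;>
          rw [if_pos (by linarith)] <;> simp
      · refine (hκV false false).trans (measureReal_mono fun u hu => ?_)
        simp only [hV, Bool.false_eq_true, if_false, Set.mem_prod, Set.mem_Iio] at hu
        constructor <;> simp only [Set.mem_ofPred_eq, crossing, hy, if_false] <;>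
          rw [if_neg (by linarith)] <;> simp
    have hSc : 1 - K * (1 + y ^ 2)⁻¹ ≤ m.real S := by
      have h1 : m.real Sᶜ ≤ ∫ u, near M y u ∂m := by
        rw [← integral_indicator_one hSm.compl]
        refine integral_mono ((integrable_const (1 : ℝ)).indicator hSm.compl)
          (integrable_near M y) fun u => ?_
        by_cases hu : u ∈ Sᶜ
        · rw [Set.indicator_of_mem hu]
          by_contra hlt
          have hz : near M y u = 0 := by
            have : near M y u = 0 ∨ near M y u = 1 := by unfold near; split_ifs <;> simp
            rcases this with h | h
            · exact h
            · exact absurd (by rw [h]; rfl) hlt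
          refine hu ⟨?_, ?_⟩
          · have h2 := (isCoord_fst.abs_crossing_le_near ξ.1 y u).trans
              (near_mono (le_max_left |ξ.1| |ξ.2|) y u)
            rw [← hM, hz] at h2
            exact abs_nonpos_iff.1 h2
          · have h2 := (isCoord_snd.abs_crossing_le_near ξ.2 y u).trans
              (near_mono (le_max_right |ξ.1| |ξ.2|) y u)
            rw [← hM, hz] at h2
            exact abs_nonpos_iff.1 h2
        · rw [Set.indicator_of_notMem hu]; exact near_nonneg _ _ _
      have h2 := probReal_compl_eq_one_sub hSm (μ := m)
      have h3 := hn y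
      linarith
    have hS0 : 0 < m.real S := hκ0.trans_le hSκ
    have h1 := (isLocal_crossings B ξ).log_measure_add_le hm y 0 hSm hS0 fun u hu => by
      have h1 : crossing Prod.fst ξ.1 y u = 0 := hu.1
      have h2 : crossing Prod.snd ξ.2 y u = 0 := hu.2
      simp only [crossings, h1, h2]
      simp
    have h2 := Real.one_sub_inv_le_log_of_pos hS0
    have h3 : (m.real S)⁻¹ ≤ κ⁻¹ := by gcongr
    have h4 : 1 - (m.real S)⁻¹ = -((m.real S)⁻¹ * (1 - m.real S)) := by field_simp; ring
    have h5 : (m.real S)⁻¹ * (1 - m.real S) ≤ κ⁻¹ * (K * (1 + y ^ 2)⁻¹) := by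
      have : m.real S ≤ 1 := measureReal_le_one
      gcongr
      linarith
    rw [mul_assoc]
    linarith
  -- From the left a crossing is zero or one. In the quadrant chosen by the signs of `B` exactly the
  -- levels with nonnegative weight are exceeded; the margin `M + 1` beats a starting point within
  -- distance one of the origin.
  · have h1 := (isLocal_crossings B ξ).log_measure_add_le hm y (max B.1 0 + max B.2 0)
      (hVo (decide (0 ≤ B.1)) (decide (0 ≤ B.2))).measurableSet (hVp _ _) fun u hu => ?_
    · have := Real.log_le_log hκ0 (hκV (decide (0 ≤ B.1)) (decide (0 ≤ B.2)))
      linarith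
    · obtain ⟨hu1, hu2⟩ := hu
      obtain ⟨hy1, hy2⟩ := hy
      simp only [decide_eq_true_eq] at hu1 hu2
      unfold crossings crossing
      rw [if_neg (not_lt.2 hy2.le)]
      refine add_le_add ?_ ?_
      · split_ifs at hu1 with hb
        · simp only [Set.mem_Ioi] at hu1
          rw [max_eq_left hb, if_pos (by linarith)]; simp
        · simp only [Set.mem_Iio] at hu1
          rw [max_eq_right (by linarith), if_neg (by linarith)]; simp
      · split_ifs at hu2 with hb
        · simp only [Set.mem_Ioi] at hu2
          rw [max_eq_left hb, if_pos (by linarith)]; simp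
        · simp only [Set.mem_Iio] at hu2
          rw [max_eq_right (by linarith), if_neg (by linarith)]; simp
  -- From the right a crossing is zero or minus one, so the same quadrant now collects the negative
  -- parts of the weights.
  · have h1 := (isLocal_crossings B ξ).log_measure_add_le hm y (max (-B.1) 0 + max (-B.2) 0)
      (hVo (decide (0 ≤ B.1)) (decide (0 ≤ B.2))).measurableSet (hVp _ _) fun u hu => ?_
    · have := Real.log_le_log hκ0 (hκV (decide (0 ≤ B.1)) (decide (0 ≤ B.2)))
      linarith
    · obtain ⟨hu1, hu2⟩ := hu
      obtain ⟨hy1, hy2⟩ := hy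
      simp only [decide_eq_true_eq] at hu1 hu2
      unfold crossings crossing
      rw [if_pos hy1]
      refine add_le_add ?_ ?_
      · split_ifs at hu1 with hb
        · simp only [Set.mem_Ioi] at hu1
          rw [max_eq_right (by linarith), if_pos (by linarith)]; simp
        · simp only [Set.mem_Iio] at hu1
          rw [max_eq_left (by linarith), if_neg (by linarith)]; simp
      · split_ifs at hu2 with hb
        · simp only [Set.mem_Ioi] at hu2
          rw [max_eq_right (by linarith), if_pos (by linarith)]; simp
        · simp only [Set.mem_Iio] at hu2
          rw [max_eq_left (by linarith), if_neg (by linarith)]; simp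

/-- Coercivity. The unit intervals left and right of the origin contribute the positive and the
negative parts of `B`, which add up to `|B.1| + |B.2|`; all starting points together lose at most `K
* π`, the integral of `K * (1 + y ^ 2)⁻¹`. -/
lemma exists_le_pressure_crossings (hψ : IsRateTransform ψ ψ') (hm : IsDisplacementLaw m)
    (ξ : ℝ × ℝ) : ∃ C, ∀ B : ℝ × ℝ, |B.1| + |B.2| - C ≤ pressure ψ m (crossings B ξ) := by
  obtain ⟨K, c, hK, hc, hb⟩ := exists_log_expMean_crossings_ge hm ξ
  refine ⟨K * Real.pi + 2 * c, fun B => ?_⟩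
  set p := max B.1 0 + max B.2 0 with hp
  set q := max (-B.1) 0 + max (-B.2) 0 with hq
  have hpq : p + q = |B.1| + |B.2| := by
    have e : ∀ x : ℝ, max x 0 + max (-x) 0 = |x| := fun x => by
      rcases le_total 0 x with h | h
      · rw [max_eq_left h, max_eq_right (by linarith), abs_of_nonneg h, add_zero]
      · rw [max_eq_right h, max_eq_left (by linarith), abs_of_nonpos h, zero_add]
    rw [hp, hq, ← e B.1, ← e B.2]; ring
  have hi1 : Integrable (fun y : ℝ => -(K * (1 + y ^ 2)⁻¹)) :=
    (integrable_inv_one_add_sq.const_mul K).neg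
  have hi2 : Integrable ((Set.Ioo (-1 : ℝ) 0).indicator fun _ => p - c) :=
    (integrable_indicator_iff measurableSet_Ioo).2 (by simp)
  have hi3 : Integrable ((Set.Ioo (0 : ℝ) 1).indicator fun _ => q - c) :=
    (integrable_indicator_iff measurableSet_Ioo).2 (by simp)
  calc |B.1| + |B.2| - (K * Real.pi + 2 * c)
      = ∫ y, (-(K * (1 + y ^ 2)⁻¹) + ((Set.Ioo (-1 : ℝ) 0).indicator (fun _ => p - c) y +
          (Set.Ioo (0 : ℝ) 1).indicator (fun _ => q - c) y)) := by
        have hi23 := hi2.add hi3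
        have e1 := integral_add hi1 hi23
        have e2 := integral_add hi2 hi3
        simp only [Pi.add_apply] at e1
        rw [e1, e2, integral_neg, integral_const_mul, integral_univ_inv_one_add_sq,
          integral_indicator measurableSet_Ioo, integral_indicator measurableSet_Ioo]
        simp
        linarith
    _ ≤ _ := by
        refine integral_mono (hi1.add (hi2.add hi3))
          ((isLocal_crossings B ξ).integrable_transform hψ hm) fun y => ?_
        refine le_trans ?_ (hψ.log_le _ ((isLocal_crossings B ξ).expMean_pos hm y))
        obtain ⟨h1, h2, h3⟩ := hb B y
        have hpos : 0 ≤ K * (1 + y ^ 2)⁻¹ := by positivity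
        simp only
        by_cases hy1 : y ∈ Set.Ioo (-1 : ℝ) 0
        · have hy2 : y ∉ Set.Ioo (0 : ℝ) 1 := fun h => by linarith [hy1.2, h.1]
          rw [Set.indicator_of_mem hy1, Set.indicator_of_notMem hy2]
          linarith [h2 hy1]
        · rw [Set.indicator_of_notMem hy1]
          by_cases hy2 : y ∈ Set.Ioo (0 : ℝ) 1
          · rw [Set.indicator_of_mem hy2]; linarith [h3 hy2]
          · rw [Set.indicator_of_notMem hy2]; linarith

lemma hasDerivAt_pressure_crossings_fst (hψ : IsRateTransform ψ ψ') (hm : IsDisplacementLaw m)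
    (B ξ : ℝ × ℝ) : HasDerivAt (fun b => pressure ψ m (crossings (b, B.2) ξ))
      (tiltMean ψ' m (crossings B ξ) (crossing Prod.fst ξ.1)) B.1 := by
  have h := hasDerivAt_pressure hψ hm (isLocal_crossings B ξ) (isCoord_fst.isLocal_crossing ξ.1)
  have h2 := HasDerivAt.comp_sub_const B.1 B.1 (by simpa using h)
  have e : (fun b => pressure ψ m (crossings (b, B.2) ξ)) = fun b => pressure ψ m fun y u =>
      crossings B ξ y u + (b - B.1) * crossing Prod.fst ξ.1 y u := by
    funext b
    refine congrArg (pressure ψ m) (funext₂ fun y u => ?_)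
    simp only [crossings]; ring
  rw [e]; exact h2

lemma hasDerivAt_pressure_crossings_snd (hψ : IsRateTransform ψ ψ') (hm : IsDisplacementLaw m)
    (B ξ : ℝ × ℝ) : HasDerivAt (fun b => pressure ψ m (crossings (B.1, b) ξ))
      (tiltMean ψ' m (crossings B ξ) (crossing Prod.snd ξ.2)) B.2 := by
  have h := hasDerivAt_pressure hψ hm (isLocal_crossings B ξ) (isCoord_snd.isLocal_crossing ξ.2)
  have h2 := HasDerivAt.comp_sub_const B.2 B.2 (by simpa using h)
  have e : (fun b => pressure ψ m (crossings (B.1, b) ξ)) = fun b => pressure ψ m fun y u =>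
      crossings B ξ y u + (b - B.2) * crossing Prod.snd ξ.2 y u := by
    funext b
    refine congrArg (pressure ψ m) (funext₂ fun y u => ?_)
    simp only [crossings]; ring
  rw [e]; exact h2

/-- A continuous coercive function attains its minimum, where both partial derivatives vanish; a
second critical point would lie strictly below the minimum. -/
lemma existsUnique_isCritical (hψ : IsRateTransform ψ ψ') (hm : IsDisplacementLaw m)
    (ξ : ℝ × ℝ) : ∃! B, IsCritical ψ' m ξ B := by
  have hc : Continuous fun B : ℝ × ℝ => pressure ψ m (crossings B ξ) :=
    (continuous_pressure_crossings hψ hm).comp (Continuous.prodMk continuous_id continuous_const)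
  obtain ⟨C, hC⟩ := exists_le_pressure_crossings hψ hm ξ
  have hlim : Tendsto (fun B : ℝ × ℝ => pressure ψ m (crossings B ξ))
      (cocompact (ℝ × ℝ)) atTop := by
    refine tendsto_atTop_mono (fun B => ?_)
      (tendsto_atTop_add_const_right _ (-C) tendsto_norm_cocompact_atTop)
    refine le_trans ?_ (hC B)
    rw [← sub_eq_add_neg]
    refine sub_le_sub_right ?_ _
    rw [Prod.norm_def]
    exact max_le (by simp) (by simp)
  obtain ⟨B, hB⟩ := hc.exists_forall_le hlim
  refine ⟨B, ⟨?_, ?_⟩, fun B' hB' => ?_⟩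
  · refine IsLocalMin.hasDerivAt_eq_zero (Eventually.of_forall fun b => ?_)
      (hasDerivAt_pressure_crossings_fst hψ hm B ξ)
    exact hB (b, B.2)
  · refine IsLocalMin.hasDerivAt_eq_zero (Eventually.of_forall fun b => ?_)
      (hasDerivAt_pressure_crossings_snd hψ hm B ξ)
    exact hB (B.1, b)
  · by_contra hne
    exact absurd (hB B') (not_le.2 (hB'.pressure_lt hψ hm (Ne.symm hne)))

end SingleFile

namespace SingleFile

/-! ### The Gaussian displacement law -/

/-- The law of `(x, x + y)` for independent centred Gaussian `x`, `y` of variances `v`, `w`. -/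
noncomputable def gaussianPair (v w : ℝ≥0) : Measure (ℝ × ℝ) :=
  ((gaussianReal 0 v).prod (gaussianReal 0 w)).map (fun p => (p.1, p.1 + p.2))

section GaussianPair

variable {v w : ℝ≥0}

lemma measurable_shear : Measurable (fun p : ℝ × ℝ => (p.1, p.1 + p.2)) := by fun_prop

instance : IsProbabilityMeasure (gaussianPair v w) :=
  Measure.isProbabilityMeasure_map measurable_shear.aemeasurable

lemma gaussianPair_map_fst : (gaussianPair v w).map Prod.fst = gaussianReal 0 v := by
  rw [gaussianPair, Measure.map_map measurable_fst measurable_shear]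
  change ((gaussianReal 0 v).prod (gaussianReal 0 w)).map Prod.fst = _
  rw [Measure.map_fst_prod]; simp

lemma gaussianPair_map_snd : (gaussianPair v w).map Prod.snd = gaussianReal 0 (v + w) := by
  rw [gaussianPair, Measure.map_map measurable_snd measurable_shear]
  have := gaussianReal_conv_gaussianReal (m₁ := 0) (m₂ := 0) (v₁ := v) (v₂ := w)
  rw [add_zero] at this
  exact this

lemma isDisplacementLaw_gaussianPair (hv : v ≠ 0) (hw : w ≠ 0) :
    IsDisplacementLaw (gaussianPair v w) where
  isProbabilityMeasure := inferInstance
  integrable_sq := by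
    rw [gaussianPair, integrable_map_measure (by fun_prop) measurable_shear.aemeasurable]
    have h1 : Integrable (fun x : ℝ => x ^ 2) (gaussianReal 0 v) :=
      (memLp_id_gaussianReal 2).integrable_sq
    have h2 : Integrable (fun x : ℝ => x ^ 2) (gaussianReal 0 w) :=
      (memLp_id_gaussianReal 2).integrable_sq
    refine (((h1.comp_fst (gaussianReal 0 w)).const_mul 2).add
      ((h2.comp_snd (gaussianReal 0 v)).const_mul 2)).mono' (by fun_prop) (ae_of_all _ fun p => ?_)
    simp only [Function.comp_apply, norm_pow, norm_norm, Pi.add_apply]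
    rw [Prod.norm_def]
    rcases max_choice ‖p.1‖ ‖p.1 + p.2‖ with h | h <;> rw [h, Real.norm_eq_abs, sq_abs] <;>
      nlinarith [sq_nonneg (p.1 - p.2), sq_nonneg p.1, sq_nonneg p.2]
  fst_ne a := by
    have := nullSingletonClass_gaussianReal (μ := 0) hv
    have h : ∀ᵐ x ∂(gaussianPair v w).map Prod.fst, x ≠ a := by
      rw [gaussianPair_map_fst]; exact Measure.ae_ne _ a
    exact ae_of_ae_map measurable_fst.aemeasurable h
  snd_ne a := by
    have := nullSingletonClass_gaussianReal (μ := 0) (v := v + w) (by positivity)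
    have h : ∀ᵐ x ∂(gaussianPair v w).map Prod.snd, x ≠ a := by
      rw [gaussianPair_map_snd]; exact Measure.ae_ne _ a
    exact ae_of_ae_map measurable_snd.aemeasurable h
  open_pos U hU hne := by
    have := (gaussianReal_absolutelyContinuous' 0 hv).isOpenPosMeasure
    have := (gaussianReal_absolutelyContinuous' 0 hw).isOpenPosMeasure
    rw [gaussianPair, Measure.map_apply measurable_shear hU.measurableSet]
    refine (hU.preimage (by fun_prop)).measure_pos _ ?_
    obtain ⟨⟨a, b⟩, hab⟩ := hne
    exact ⟨(a, b - a), by simpa using hab⟩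

/-- This symmetry maps particles started on the right to particles started on the left. -/
lemma measurePreserving_neg_gaussianPair :
    MeasurePreserving (fun u => -u) (gaussianPair v w) (gaussianPair v w) := by
  refine ⟨measurable_neg, ?_⟩
  have h1 : MeasurePreserving (fun x : ℝ => -x) (gaussianReal 0 v) (gaussianReal 0 v) :=
    ⟨measurable_neg, by rw [gaussianReal_map_neg, neg_zero]⟩
  have h2 : MeasurePreserving (fun x : ℝ => -x) (gaussianReal 0 w) (gaussianReal 0 w) :=
    ⟨measurable_neg, by rw [gaussianReal_map_neg, neg_zero]⟩
  have h := (h1.prod h2).map_eq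
  unfold gaussianPair
  nth_rewrite 2 [← h]
  rw [Measure.map_map measurable_neg measurable_shear,
    Measure.map_map measurable_shear (h1.prod h2).measurable]
  congr 1
  ext p <;> simp [add_comm]

lemma gaussianReal_real_Ioi (hv : v ≠ 0) (a : ℝ) :
    (gaussianReal 0 v).real (Set.Ioi a) = 1 / 2 * erfc (a / √(2 * v)) := by
  have hv0 : (0 : ℝ) < v := by positivity
  have hs : 0 < √(2 * (v : ℝ)) := by positivity
  rw [measureReal_def, gaussianReal_apply_eq_integral _ hv, ENNReal.toReal_ofReal
    (integral_nonneg fun x => gaussianPDFReal_nonneg _ _ _)]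
  have h := integral_comp_mul_left_Ioi (fun x => gaussianPDFReal 0 v x) (a / √(2 * v)) hs
  rw [mul_div_cancel₀ _ hs.ne'] at h
  have h2 : ∫ x in Set.Ioi a, gaussianPDFReal 0 v x =
      √(2 * v) * ∫ x in Set.Ioi (a / √(2 * v)), gaussianPDFReal 0 v (√(2 * v) * x) := by
    rw [h, smul_eq_mul, mul_inv_cancel_left₀ hs.ne']
  rw [h2, erfc, ← integral_const_mul, ← integral_const_mul, ← integral_const_mul]
  congr 1; ext x
  have e1 : -(√(2 * (v : ℝ)) * x - 0) ^ 2 / (2 * v) = -x ^ 2 := by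
    rw [sub_zero, mul_pow, Real.sq_sqrt (by positivity)]; field_simp
  have e2 : √(2 * Real.pi * (v : ℝ)) = √(2 * v) * √Real.pi := by
    rw [← Real.sqrt_mul (by positivity)]; ring_nf
  rw [gaussianPDFReal, e1, e2]
  field_simp

/-- The joint density in the coordinates of the two positions: the start `-η` shifts the first
displacement, whereas the increment `u₂ - u₁` does not see it. -/
lemma gaussianPair_real_inter (hv : v ≠ 0) (hw : w ≠ 0) (a b η : ℝ) :
    (gaussianPair v w).real ({u | a < u.1 - η} ∩ {u | b < u.2 - η}) =
      ∫ u₁ in Set.Ioi a, ∫ u₂ in Set.Ioi b,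
        gaussianPDFReal 0 v (u₁ + η) * gaussianPDFReal 0 w (u₂ - u₁) := by
  set S : Set (ℝ × ℝ) := {u | a < u.1 - η} ∩ {u | b < u.2 - η} with hS
  have hSm : MeasurableSet S := (measurableSet_lt (by fun_prop) (by fun_prop)).inter
    (measurableSet_lt (by fun_prop) (by fun_prop))
  set T : Set (ℝ × ℝ) := (fun p : ℝ × ℝ => (p.1, p.1 + p.2)) ⁻¹' S with hT
  have hTm : MeasurableSet T := measurable_shear hSm
  rw [gaussianPair, map_measureReal_apply measurable_shear hSm, ← hT,
    ← integral_indicator_one hTm,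
    integral_prod (T.indicator 1) ((integrable_const (1 : ℝ)).indicator hTm),
    integral_gaussianReal_eq_integral_smul hv, ← integral_add_right_eq_self _ η,
    ← integral_indicator measurableSet_Ioi]
  congr 1; ext x
  have hmem : ∀ y, (x + η, y - x) ∈ T ↔ x ∈ Set.Ioi a ∧ y ∈ Set.Ioi b := fun y => by
    simp only [hT, hS, Set.mem_preimage, Set.mem_inter_iff, Set.mem_ofPred_eq, Set.mem_Ioi]
    rw [add_sub_cancel_right, show x + η + (y - x) - η = y by ring]
  rw [integral_gaussianReal_eq_integral_smul hw, ← integral_sub_right_eq_self _ x]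
  by_cases hx : x ∈ Set.Ioi a
  · rw [Set.indicator_of_mem hx, ← integral_indicator measurableSet_Ioi, smul_eq_mul,
      ← integral_const_mul]
    congr 1; ext y
    by_cases hy : y ∈ Set.Ioi b
    · rw [Set.indicator_of_mem hy, Set.indicator_of_mem ((hmem y).2 ⟨hx, hy⟩)]; simp
    · rw [Set.indicator_of_notMem hy, Set.indicator_of_notMem fun h => hy ((hmem y).1 h).2]; simp
  · rw [Set.indicator_of_notMem hx]
    have : ∀ y, T.indicator (1 : ℝ × ℝ → ℝ) (x + η, y - x) = 0 := fun y =>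
      Set.indicator_of_notMem (fun h => hx ((hmem y).1 h).1) _
    simp [this]

end GaussianPair

/-- The joint law of the displacements of a free particle at times `τ₁ < τ₂`. -/
noncomputable def displacementLaw (σ : ℝ) (τ₁ τ₂ : ℝ≥0) : Measure (ℝ × ℝ) :=
  gaussianPair (Real.toNNReal (σ ^ 2 / 2) * τ₁) (Real.toNNReal (σ ^ 2 / 2) * (τ₂ - τ₁))

/-! ### The explicit function as a one-particle generating function -/

section Identification

variable {σ : ℝ} {τ₁ τ₂ : ℝ≥0}

lemma isDisplacementLaw_displacementLaw (hσ : 0 < σ) (hτ₁ : 0 < τ₁) (hτ : τ₁ < τ₂) :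
    IsDisplacementLaw (displacementLaw σ τ₁ τ₂) := by
  have h : 0 < Real.toNNReal (σ ^ 2 / 2) := Real.toNNReal_pos.2 (by positivity)
  exact isDisplacementLaw_gaussianPair (mul_pos h hτ₁).ne' (mul_pos h (tsub_pos_of_lt hτ)).ne'

/-- The single-particle function is the generating function of the indicators that a particle
started at `-η` exceeds the levels `ξ`. -/
lemma singleParticle_eq_integral (hσ : 0 < σ) (hτ₁ : 0 < τ₁) (hτ : τ₁ < τ₂) (η : ℝ)
    (B ξ : ℝ × ℝ) : singleParticle σ τ₁ τ₂ η B ξ = ∫ u, Real.exp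
      (B.1 * (if ξ.1 < u.1 - η then 1 else 0) + B.2 * (if ξ.2 < u.2 - η then 1 else 0))
        ∂(displacementLaw σ τ₁ τ₂) := by
  have hs : 0 < Real.toNNReal (σ ^ 2 / 2) := Real.toNNReal_pos.2 (by positivity)
  have hsr : ((Real.toNNReal (σ ^ 2 / 2) : ℝ≥0) : ℝ) = σ ^ 2 / 2 :=
    Real.coe_toNNReal _ (by positivity)
  have hv : Real.toNNReal (σ ^ 2 / 2) * τ₁ ≠ 0 := (mul_pos hs hτ₁).ne'
  have hw : Real.toNNReal (σ ^ 2 / 2) * (τ₂ - τ₁) ≠ 0 := (mul_pos hs (tsub_pos_of_lt hτ)).ne'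
  have hvr : ((Real.toNNReal (σ ^ 2 / 2) * τ₁ : ℝ≥0) : ℝ) = σ ^ 2 / 2 * τ₁ := by
    rw [NNReal.coe_mul, hsr]
  have hwr : ((Real.toNNReal (σ ^ 2 / 2) * (τ₂ - τ₁) : ℝ≥0) : ℝ) = σ ^ 2 / 2 * (τ₂ - τ₁) := by
    rw [NNReal.coe_mul, hsr, NNReal.coe_sub hτ.le]
  have hvw : Real.toNNReal (σ ^ 2 / 2) * τ₁ + Real.toNNReal (σ ^ 2 / 2) * (τ₂ - τ₁) =
      Real.toNNReal (σ ^ 2 / 2) * τ₂ := by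
    rw [← mul_add, add_tsub_cancel_of_le hτ.le]
  have hτ₁r : (0 : ℝ) < τ₁ := hτ₁
  have hτr : (0 : ℝ) < τ₂ - τ₁ := sub_pos.2 hτ
  have hτ₂r : (0 : ℝ) < τ₂ := by linarith
  have m1 : MeasurableSet {u : ℝ × ℝ | ξ.1 < u.1 - η} :=
    measurableSet_lt (by fun_prop) (by fun_prop)
  have m2 : MeasurableSet {u : ℝ × ℝ | ξ.2 < u.2 - η} :=
    measurableSet_lt (by fun_prop) (by fun_prop)
  set m := displacementLaw σ τ₁ τ₂ with hm
  have : IsProbabilityMeasure m :=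
    (isDisplacementLaw_displacementLaw hσ hτ₁ hτ).isProbabilityMeasure
  have p1 : m.real {u | ξ.1 < u.1 - η} = 1 / 2 * erfc ((ξ.1 + η) / (σ * √τ₁)) := by
    have h := gaussianReal_real_Ioi hv (ξ.1 + η)
    rw [← gaussianPair_map_fst (w := Real.toNNReal (σ ^ 2 / 2) * (τ₂ - τ₁)),
      map_measureReal_apply measurable_fst measurableSet_Ioi] at h
    rw [hvr, show 2 * (σ ^ 2 / 2 * (τ₁ : ℝ)) = σ ^ 2 * τ₁ by ring,
      Real.sqrt_mul (by positivity), Real.sqrt_sq hσ.le] at h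
    rw [← h]
    congr 1
    ext u; simp [lt_sub_iff_add_lt]
  have p2 : m.real {u | ξ.2 < u.2 - η} = 1 / 2 * erfc ((ξ.2 + η) / (σ * √τ₂)) := by
    have h := gaussianReal_real_Ioi (v := Real.toNNReal (σ ^ 2 / 2) * τ₂)
      (mul_pos hs (hτ₁.trans hτ)).ne' (ξ.2 + η)
    rw [← hvw, ← gaussianPair_map_snd, map_measureReal_apply measurable_snd measurableSet_Ioi, hvw,
      NNReal.coe_mul, hsr, show 2 * (σ ^ 2 / 2 * (τ₂ : ℝ)) = σ ^ 2 * τ₂ by ring,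
      Real.sqrt_mul (by positivity), Real.sqrt_sq hσ.le] at h
    rw [← h]
    congr 1
    ext u; simp [lt_sub_iff_add_lt]
  have p12 : m.real ({u | ξ.1 < u.1 - η} ∩ {u | ξ.2 < u.2 - η}) = (1 / Real.pi) *
      ∫ u₁ in Set.Ioi ξ.1, ∫ u₂ in Set.Ioi ξ.2,
        Real.exp (-(u₂ - u₁) ^ 2 / (σ ^ 2 * (τ₂ - τ₁)) - (u₁ + η) ^ 2 / (σ ^ 2 * τ₁))
          / (σ ^ 2 * √(τ₁ * (τ₂ - τ₁))) := by
    rw [hm, displacementLaw, gaussianPair_real_inter hv hw]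
    simp only [← integral_const_mul]
    congr 1; ext u₁
    congr 1; ext u₂
    simp only [gaussianPDFReal, hvr, hwr, sub_zero]
    rw [show -(u₂ - u₁) ^ 2 / (σ ^ 2 * ((τ₂ : ℝ) - τ₁)) - (u₁ + η) ^ 2 / (σ ^ 2 * τ₁)
      = -(u₁ + η) ^ 2 / (2 * (σ ^ 2 / 2 * τ₁)) +
        -(u₂ - u₁) ^ 2 / (2 * (σ ^ 2 / 2 * (τ₂ - τ₁))) by field_simp; ring, Real.exp_add]
    have e1 : √(2 * Real.pi * (σ ^ 2 / 2 * (τ₁ : ℝ))) = σ * √Real.pi * √τ₁ := by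
      rw [show 2 * Real.pi * (σ ^ 2 / 2 * (τ₁ : ℝ)) = σ ^ 2 * Real.pi * τ₁ by ring,
        Real.sqrt_mul (by positivity), Real.sqrt_mul (by positivity), Real.sqrt_sq hσ.le]
    have e2 : √(2 * Real.pi * (σ ^ 2 / 2 * ((τ₂ : ℝ) - τ₁))) = σ * √Real.pi * √(τ₂ - τ₁) := by
      rw [show 2 * Real.pi * (σ ^ 2 / 2 * ((τ₂ : ℝ) - τ₁)) = σ ^ 2 * Real.pi * (τ₂ - τ₁) by ring,
        Real.sqrt_mul (by positivity), Real.sqrt_mul (by positivity), Real.sqrt_sq hσ.le]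
    have e3 : √((τ₁ : ℝ) * (τ₂ - τ₁)) = √τ₁ * √(τ₂ - τ₁) := Real.sqrt_mul (by positivity) _
    have e4 : (Real.pi)⁻¹ = (√Real.pi)⁻¹ * (√Real.pi)⁻¹ := by
      rw [← mul_inv, Real.mul_self_sqrt Real.pi_pos.le]
    rw [e1, e2, e3, one_div, e4]
    field_simp
  -- For an indicator `a`, `exp (b * a) = 1 + (exp b - 1) * a`. The product of two such factors has
  -- the three nontrivial terms of the explicit formula.
  have hexp : ∀ u : ℝ × ℝ, Real.exp
      (B.1 * (if ξ.1 < u.1 - η then 1 else 0) + B.2 * (if ξ.2 < u.2 - η then 1 else 0)) =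
      1 + (Real.exp B.1 - 1) * ({u : ℝ × ℝ | ξ.1 < u.1 - η}.indicator 1 u) +
      (Real.exp B.2 - 1) * ({u : ℝ × ℝ | ξ.2 < u.2 - η}.indicator 1 u) +
      (Real.exp B.1 - 1) * (Real.exp B.2 - 1) *
        (({u : ℝ × ℝ | ξ.1 < u.1 - η} ∩ {u | ξ.2 < u.2 - η}).indicator 1 u) := by
    intro u
    rw [Set.inter_indicator_one]
    simp only [Set.indicator, Set.mem_ofPred_eq, Pi.mul_apply, Pi.one_apply]
    split_ifs <;> simp [Real.exp_add] <;> ring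
  have i1 : ∀ c : ℝ, Integrable (fun u => c * ({u : ℝ × ℝ | ξ.1 < u.1 - η}.indicator 1 u)) m :=
    fun c => ((integrable_const (1 : ℝ)).indicator m1).const_mul c
  have i2 : ∀ c : ℝ, Integrable (fun u => c * ({u : ℝ × ℝ | ξ.2 < u.2 - η}.indicator 1 u)) m :=
    fun c => ((integrable_const (1 : ℝ)).indicator m2).const_mul c
  have i3 : ∀ c : ℝ, Integrable (fun u => c *
      (({u : ℝ × ℝ | ξ.1 < u.1 - η} ∩ {u | ξ.2 < u.2 - η}).indicator 1 u)) m :=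
    fun c => ((integrable_const (1 : ℝ)).indicator (m1.inter m2)).const_mul c
  simp only [hexp]
  have i0 : Integrable (fun _ : ℝ × ℝ => (1 : ℝ)) m := integrable_const _
  have i01 := i0.add (i1 (Real.exp B.1 - 1))
  have i012 := i01.add (i2 (Real.exp B.2 - 1))
  have e1 := integral_add i0 (i1 (Real.exp B.1 - 1))
  have e2 := integral_add i01 (i2 (Real.exp B.2 - 1))
  have e3 := integral_add i012 (i3 ((Real.exp B.1 - 1) * (Real.exp B.2 - 1)))
  simp only [Pi.add_apply] at e1 e2 e3
  rw [e3, e2, e1, integral_const_mul, integral_const_mul,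
    integral_const_mul, integral_indicator_one m1, integral_indicator_one m2,
    integral_indicator_one (m1.inter m2), p1, p2, p12, singleParticle]
  simp only [integral_const, probReal_univ, smul_eq_mul]
  ring

lemma singleParticle_pos (hσ : 0 < σ) (hτ₁ : 0 < τ₁) (hτ : τ₁ < τ₂) (η : ℝ) (B ξ : ℝ × ℝ) :
    0 < singleParticle σ τ₁ τ₂ η B ξ := by
  have := (isDisplacementLaw_displacementLaw hσ hτ₁ hτ).isProbabilityMeasure
  rw [singleParticle_eq_integral hσ hτ₁ hτ]
  refine integral_exp_pos ?_
  refine (integrable_const (Real.exp (|B.1| + |B.2|))).mono' ?_ (ae_of_all _ fun u => ?_)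
  · refine (Real.measurable_exp.comp ((Measurable.const_mul (Measurable.ite
      (measurableSet_lt (by fun_prop) (by fun_prop)) measurable_const measurable_const) _).add
      (Measurable.const_mul (Measurable.ite (measurableSet_lt (by fun_prop) (by fun_prop))
      measurable_const measurable_const) _))).aestronglyMeasurable
  · rw [Real.norm_eq_abs, Real.abs_exp, Real.exp_le_exp]
    have h1 := le_abs_self B.1
    have h2 := le_abs_self B.2
    have h3 := abs_nonneg B.1
    have h4 := abs_nonneg B.2
    split_ifs <;> linarith

lemma expMean_crossings_of_nonpos (hσ : 0 < σ) (hτ₁ : 0 < τ₁) (hτ : τ₁ < τ₂) {y : ℝ} (hy : y ≤ 0)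
    (B ξ : ℝ × ℝ) : expMean (displacementLaw σ τ₁ τ₂) (crossings B ξ) y =
      singleParticle σ τ₁ τ₂ (-y) B ξ := by
  rw [singleParticle_eq_integral hσ hτ₁ hτ, expMean]
  congr 1; ext u
  simp only [crossings, crossing, not_lt.2 hy, if_false, sub_zero, sub_neg_eq_add, add_comm y]

/-- From the right a crossing is minus the indicator of not exceeding the level. Reflecting the
displacement turns this into exceeding `-ξ` with weight `-B`; equality with a level, where strict
and weak inequalities differ, is a null event. -/
lemma expMean_crossings_of_pos (hσ : 0 < σ) (hτ₁ : 0 < τ₁) (hτ : τ₁ < τ₂) {y : ℝ} (hy : 0 < y)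
    (B ξ : ℝ × ℝ) : expMean (displacementLaw σ τ₁ τ₂) (crossings B ξ) y =
      singleParticle σ τ₁ τ₂ y (-B) (-ξ) := by
  have hm := isDisplacementLaw_displacementLaw hσ hτ₁ hτ
  rw [singleParticle_eq_integral hσ hτ₁ hτ, expMean, displacementLaw,
    ← measurePreserving_neg_gaussianPair.integral_comp (MeasurableEquiv.neg _).measurableEmbedding,
    ← displacementLaw]
  refine integral_congr_ae ?_
  filter_upwards [hm.fst_ne (y - ξ.1), hm.snd_ne (y - ξ.2)] with u h1 h2
  have key : ∀ x a : ℝ, a ≠ y - x →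
      (if x < y + -a then (1 : ℝ) else 0) - 1 = -(if -x < a - y then (1 : ℝ) else 0) := by
    intro x a ha
    rcases lt_or_gt_of_ne ha with h | h
    · rw [if_pos (by linarith), if_neg (by linarith)]; norm_num
    · rw [if_neg (by linarith), if_pos (by linarith)]; norm_num
  simp only [crossings, crossing, hy, if_true, Prod.fst_neg, Prod.snd_neg]
  rw [key _ _ h1, key _ _ h2]
  ring_nf

lemma integrableOn_singleParticle {ψ ψ' : ℝ → ℝ} (hψ : IsRateTransform ψ ψ') (hσ : 0 < σ)
    (hτ₁ : 0 < τ₁) (hτ : τ₁ < τ₂) (B ξ : ℝ × ℝ) :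
    IntegrableOn (fun η => ψ (singleParticle σ τ₁ τ₂ η B ξ)) (Set.Ioi 0) := by
  have hm := isDisplacementLaw_displacementLaw hσ hτ₁ hτ
  have h := ((isLocal_crossings (-B) (-ξ)).integrable_transform hψ hm).integrableOn (s := Set.Ioi 0)
  refine h.congr_fun (fun y hy => ?_) measurableSet_Ioi
  simp only
  rw [expMean_crossings_of_pos hσ hτ₁ hτ hy, neg_neg, neg_neg]

lemma pressure_crossings_eq {ψ ψ' : ℝ → ℝ} (hψ : IsRateTransform ψ ψ') (hσ : 0 < σ)
    (hτ₁ : 0 < τ₁) (hτ : τ₁ < τ₂) (B ξ : ℝ × ℝ) :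
    pressure ψ (displacementLaw σ τ₁ τ₂) (crossings B ξ) =
      (∫ η in Set.Ioi (0 : ℝ), ψ (singleParticle σ τ₁ τ₂ η B ξ)) +
      ∫ η in Set.Ioi (0 : ℝ), ψ (singleParticle σ τ₁ τ₂ η (-B) (-ξ)) := by
  have hm := isDisplacementLaw_displacementLaw hσ hτ₁ hτ
  have h := (isLocal_crossings B ξ).integrable_transform hψ hm
  unfold pressure
  rw [← integral_add_compl (s := Set.Iic 0) measurableSet_Iic h, Set.compl_Iic]
  congr 1
  · rw [← neg_zero, ← integral_comp_neg_Ioi, neg_zero]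
    refine setIntegral_congr_fun measurableSet_Ioi fun y hy => ?_
    rw [expMean_crossings_of_nonpos hσ hτ₁ hτ (neg_nonpos.2 (le_of_lt hy)), neg_neg]
  · refine setIntegral_congr_fun measurableSet_Ioi fun y hy => ?_
    rw [expMean_crossings_of_pos hσ hτ₁ hτ hy]

end Identification

end SingleFile

namespace SingleFile

/-! ### Configurations with a macroscopically uniform density -/

/-- Uniform macroscopic density, in a form invariant under reflection of the line. -/
structure IsUniform (ρ : ℝ) (y : ℤ → ℝ) : Prop where
  tracer : y 0 = 0
  ordered : Monotone y
  card_le : ∀ a b, a < b → ∀ r, ρ * (b - a) < r → ∀ᶠ L : ℝ in atTop, ∀ S : Finset ℤ,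
    (∀ k ∈ S, a * L < y k ∧ y k < b * L) → (S.card : ℝ) ≤ r * L
  le_card : ∀ a b, a < b → ∀ r, r < ρ * (b - a) → ∀ᶠ L : ℝ in atTop, ∀ S : Finset ℤ,
    (∀ k, a * L < y k → y k < b * L → k ∈ S) → r * L ≤ S.card

lemma IsQuenchedInitial.isUniform {ρ : ℝ} (hρ : 0 < ρ) {y : ℤ → ℝ} (h : IsQuenchedInitial ρ y) :
    IsUniform ρ y where
  tracer := h.tracer
  ordered := h.ordered
  card_le a b hab r hr := by
    have hpos : 0 < ρ * (b - a) := mul_pos hρ (sub_pos.2 hab)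
    filter_upwards [(h.density a b hab).eventually (Iio_mem_nhds hr),
      (h.density a b hab).eventually (Ioi_mem_nhds hpos), eventually_gt_atTop 0]
       with L h1 h2 hL S hS
    -- `ncard` of an infinite set is zero, which the positive limiting density excludes.
    have hfin : {k : ℤ | a * L < y k ∧ y k ≤ b * L}.Finite := by
      by_contra hinf
      rw [Set.Infinite.ncard hinf] at h2
      simp at h2
    rw [div_lt_iff₀ hL] at h1
    refine le_trans ?_ h1.le
    rw [← Set.ncard_coe_finset]
    exact Nat.cast_le.2 (Set.ncard_le_ncard (fun k hk => ⟨(hS k hk).1, (hS k hk).2.le⟩) hfin)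
  le_card a b hab r hr := by
    -- The density is given on half-open intervals and wanted on open ones; a slightly smaller right
    -- end still has density mass above `r`.
    obtain ⟨b', hb'1, hb'2, hb'3⟩ : ∃ b', a < b' ∧ b' < b ∧ r < ρ * (b' - a) := by
      have h1 : max a (a + r / ρ) < b := by
        refine max_lt hab ?_
        have : r / ρ < b - a := by rw [div_lt_iff₀ hρ]; linarith
        linarith
      obtain ⟨b', h2, h3⟩ := exists_between h1
      refine ⟨b', (le_max_left _ _).trans_lt h2, h3, ?_⟩
      have h4 : r / ρ < b' - a := by linarith [(le_max_right a (a + r / ρ)).trans_lt h2]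
      rw [div_lt_iff₀ hρ] at h4
      linarith
    filter_upwards [(h.density a b' hb'1).eventually (Ioi_mem_nhds hb'3),
      eventually_gt_atTop 0] with L h1 hL S hS
    rw [lt_div_iff₀ hL] at h1
    refine h1.le.trans ?_
    rw [← Set.ncard_coe_finset]
    refine Nat.cast_le.2 (Set.ncard_le_ncard (fun k hk => hS k hk.1 (hk.2.trans_lt ?_))
      (Finset.finite_toSet S))
    exact mul_lt_mul_of_pos_right hb'2 hL

lemma IsUniform.reflect {ρ : ℝ} {y : ℤ → ℝ} (h : IsUniform ρ y) :
    IsUniform ρ (fun k => -y (-k)) where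
  tracer := by simp [h.tracer]
  ordered k l hkl := neg_le_neg (h.ordered (neg_le_neg hkl))
  card_le a b hab r hr := by
    filter_upwards [h.card_le (-b) (-a) (by linarith) r (by linarith)] with L hL S hS
    have := hL (S.map (Equiv.neg ℤ).toEmbedding) fun k hk => by
      simp only [Finset.mem_map_equiv, Equiv.neg_symm, Equiv.neg_apply] at hk
      have := hS _ hk
      rw [neg_neg] at this
      constructor <;> linarith
    rwa [Finset.card_map] at this
  le_card a b hab r hr := by
    filter_upwards [h.le_card (-b) (-a) (by linarith) r (by linarith)] with L hL S hS
    have := hL (S.map (Equiv.neg ℤ).toEmbedding) fun k hk1 hk2 => by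
      simp only [Finset.mem_map_equiv, Equiv.neg_symm, Equiv.neg_apply]
      refine hS _ ?_ ?_ <;> rw [neg_neg] <;> linarith
    rwa [Finset.card_map] at this

/-- The counting function is inverted: if the particle of label about `L * s` were too close, too
many labels would share a short interval; if it were too far, too few would fill a long one. The
fixed shift `i` allows sequences starting at label zero or one. -/
lemma IsUniform.tendsto_floor {ρ : ℝ} (hρ : 0 < ρ) {y : ℤ → ℝ} (h : IsUniform ρ y) (i : ℕ)
    {s : ℝ} (hs : 0 < s) :
    Tendsto (fun L : ℝ => y ((⌊L * s⌋₊ + i : ℕ) : ℤ) / L) atTop (𝓝 (s / ρ)) := by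
  have hnn : ∀ n : ℕ, 0 ≤ y n := fun n => by
    rw [← h.tracer]; exact h.ordered (by positivity)
  rw [tendsto_order]
  constructor
  · intro x₀ hx₀
    set x := max x₀ 0 with hx
    have hxs : ρ * x < s := by
      have : x < s / ρ := max_lt hx₀ (by positivity)
      rw [lt_div_iff₀ hρ] at this; linarith
    -- The left end has to be negative, as the tracer sits exactly at the origin and the interval is
    -- open.
    obtain ⟨δ, hδ, hδs⟩ : ∃ δ, 0 < δ ∧ ρ * (x + δ - -δ) < s := by
      refine ⟨(s - ρ * x) / (4 * ρ), by have := sub_pos.2 hxs; positivity, ?_⟩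
      have : ρ * ((s - ρ * x) / (4 * ρ)) = (s - ρ * x) / 4 := by field_simp
      nlinarith
    have hx0 : 0 ≤ x := le_max_right _ _
    obtain ⟨r, hr1, hr2⟩ := exists_between hδs
    filter_upwards [h.card_le (-δ) (x + δ) (by linarith) r hr1, eventually_gt_atTop 0]
      with L hL hL0
    refine (le_max_left x₀ 0).trans_lt ?_
    rw [← hx, lt_div_iff₀ hL0]
    by_contra hcon
    rw [not_lt] at hcon
    have h1 := hL (Finset.Icc 0 ((⌊L * s⌋₊ + i : ℕ) : ℤ)) fun k hk => by
      rw [Finset.mem_Icc] at hk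
      have hk0 : 0 ≤ y k := by rw [← h.tracer]; exact h.ordered hk.1
      have hk1 := h.ordered hk.2
      have := mul_pos hδ hL0
      constructor <;> nlinarith
    rw [Int.card_Icc, sub_zero] at h1
    have h2 : L * s < ((((⌊L * s⌋₊ + i : ℕ) : ℤ) + 1).toNat : ℝ) := by
      have h3 := Nat.lt_floor_add_one (L * s)
      have h4 : (((⌊L * s⌋₊ + i : ℕ) : ℤ) + 1).toNat = ⌊L * s⌋₊ + i + 1 := by omega
      rw [h4]; push_cast
      have : (0 : ℝ) ≤ i := by positivity
      linarith
    nlinarith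
  · intro x hx
    have hxs : s < ρ * (x - 0) := by
      rw [gt_iff_lt, div_lt_iff₀ hρ] at hx; linarith
    have hx0 : 0 < x := lt_trans (by positivity) hx
    obtain ⟨r, hr1, hr2⟩ := exists_between hxs
    filter_upwards [h.le_card 0 x hx0 r hr2, eventually_gt_atTop 0,
      eventually_gt_atTop (i / (r - s))] with L hL hL0 hLi
    rw [div_lt_iff₀ hL0]
    by_contra hcon
    rw [not_lt] at hcon
    have h1 := hL (Finset.Ioo 0 ((⌊L * s⌋₊ + i : ℕ) : ℤ)) fun k hk1 hk2 => by
      rw [Finset.mem_Ioo]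
      constructor
      · by_contra hk
        have := h.ordered (not_lt.1 hk)
        rw [h.tracer] at this
        linarith
      · by_contra hk
        have := h.ordered (not_lt.1 hk)
        linarith
    rw [Int.card_Ioo] at h1
    have h2 : (((((⌊L * s⌋₊ + i : ℕ) : ℤ) - 0 - 1).toNat : ℕ) : ℝ) ≤ L * s + i := by
      have h3 := Nat.floor_le (mul_nonneg hL0.le hs.le)
      have h4 : (((⌊L * s⌋₊ + i : ℕ) : ℤ) - 0 - 1).toNat ≤ ⌊L * s⌋₊ + i := by omega
      have h5 : (((((⌊L * s⌋₊ + i : ℕ) : ℤ) - 0 - 1).toNat : ℕ) : ℝ) ≤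
          ((⌊L * s⌋₊ + i : ℕ) : ℝ) := by
        exact_mod_cast h4
      refine h5.trans ?_
      push_cast
      linarith
    rw [div_lt_iff₀ (by linarith)] at hLi
    nlinarith

/-! ### Riemann sums -/

/-- Writing a series as the integral of a step function makes dominated convergence available for
Riemann sums. -/
lemma hasSum_of_integrableOn_floor {g : ℕ → ℝ}
    (h : IntegrableOn (fun s : ℝ => g ⌊s⌋₊) (Set.Ioi 0)) :
    HasSum g (∫ s in Set.Ioi (0 : ℝ), g ⌊s⌋₊) := by
  have hU : (⋃ n : ℕ, Set.Ico (n : ℝ) (n + 1)) = Set.Ici 0 := by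
    ext x
    simp only [Set.mem_iUnion, Set.mem_Ico, Set.mem_Ici]
    constructor
    · rintro ⟨n, h1, h2⟩; exact (Nat.cast_nonneg n).trans h1
    · intro hx; exact ⟨⌊x⌋₊, Nat.floor_le hx, Nat.lt_floor_add_one x⟩
  rw [← integral_Ici_eq_integral_Ioi, ← hU]
  rw [← integrableOn_Ici_iff_integrableOn_Ioi, ← hU] at h
  have hd : Pairwise (Function.onFun Disjoint fun n : ℕ => Set.Ico (n : ℝ) (n + 1)) := by
    intro a b hab
    refine Set.disjoint_left.2 fun x hx hx' => hab ?_
    have e1 := (Nat.floor_eq_iff (hx.1.trans' (Nat.cast_nonneg a))).2 ⟨hx.1, hx.2⟩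
    have e2 := (Nat.floor_eq_iff (hx.1.trans' (Nat.cast_nonneg a))).2 ⟨hx'.1, hx'.2⟩
    omega
  have key := hasSum_integral_iUnion (fun n : ℕ => measurableSet_Ico) hd h
  have e : (fun n : ℕ => ∫ x in Set.Ico (n : ℝ) (n + 1), g ⌊x⌋₊) = g := by
    funext n
    rw [setIntegral_congr_fun (g := fun _ => g n) measurableSet_Ico fun x hx => ?_]
    · simp
    have : ⌊x⌋₊ = n := (Nat.floor_eq_iff (hx.1.trans' (Nat.cast_nonneg n))).2 ⟨hx.1, hx.2⟩
    simp only [this]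
  rwa [e] at key

/-- Riemann sums over a sequence of positions with density `ρ` on a half line. -/
lemma tendsto_riemann_sum {ρ : ℝ} (hρ : 0 < ρ) {z : ℕ → ℝ} (hz0 : ∀ n, 0 ≤ z n)
    (hz : ∀ s, 0 < s → Tendsto (fun L : ℝ => z ⌊L * s⌋₊ / L) atTop (𝓝 (s / ρ)))
    {F : ℝ → ℝ} (hF : Continuous F) {K : ℝ} (hK : ∀ x, 0 ≤ x → |F x| ≤ K * (1 + x ^ 2)⁻¹) :
    (∀ L : ℝ, 0 < L → Summable fun n => F (z n / L)) ∧
    Tendsto (fun L : ℝ => L⁻¹ * ∑' n, F (z n / L)) atTop (𝓝 (ρ * ∫ x in Set.Ioi 0, F x)) := by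
  have hK0 : 0 ≤ K := by
    have := (abs_nonneg _).trans (hK 0 le_rfl); simpa using this
  -- linear growth
  obtain ⟨c, D, hc, hD, hgrow⟩ : ∃ c D : ℝ, 0 < c ∧ 0 ≤ D ∧ ∀ n : ℕ, c * n - D ≤ z n := by
    have h1 := ((hz 1 one_pos).comp tendsto_natCast_atTop_atTop).eventually
      (Ioi_mem_nhds (show 1 / ρ / 2 < 1 / ρ by have := one_div_pos.2 hρ; linarith))
    obtain ⟨N, hN⟩ := eventually_atTop.1 h1
    have hc : 0 < 1 / ρ / 2 := by positivity
    refine ⟨1 / ρ / 2, 1 / ρ / 2 * (N + 1), hc, by positivity, fun n => ?_⟩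
    rcases le_total (N + 1) n with hn | hn
    · have h2 := hN n (by omega)
      have hn0 : (0 : ℝ) < n := by exact_mod_cast (by omega : 0 < n)
      simp only [Function.comp_apply, mul_one, Nat.floor_natCast] at h2
      rw [lt_div_iff₀ hn0] at h2
      have : 0 ≤ 1 / ρ / 2 * (N + 1 : ℝ) := by positivity
      linarith
    · have : (n : ℝ) ≤ N + 1 := by exact_mod_cast hn
      have := mul_le_mul_of_nonneg_left this hc.le
      linarith [hz0 n]
  -- domination
  have hdom : ∀ L : ℝ, 0 < L → ∀ s : ℝ, 0 < s → |F (z ⌊L * s⌋₊ / L)| ≤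
      K * (2 + 2 * (c * L⁻¹ + D * L⁻¹) ^ 2) * (1 + (c * s) ^ 2)⁻¹ := by
    intro L hL s hs
    have hx0 : 0 ≤ z ⌊L * s⌋₊ / L := div_nonneg (hz0 _) hL.le
    refine (hK _ hx0).trans ?_
    rw [mul_assoc]
    refine mul_le_mul_of_nonneg_left ?_ hK0
    set x := z ⌊L * s⌋₊ / L with hx
    set d := c * L⁻¹ + D * L⁻¹ with hd
    have hd0 : 0 ≤ d := by positivity
    have h1 : c * s ≤ x + d := by
      have h2 := hgrow ⌊L * s⌋₊
      have h3 := Nat.lt_floor_add_one (L * s)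
      have h4 : c * (L * s) - c - D ≤ z ⌊L * s⌋₊ := by
        nlinarith
      have h5 : (c * (L * s) - c - D) / L ≤ x := by
        rw [hx]; gcongr
      have h6 : (c * (L * s) - c - D) / L = c * s - d := by
        rw [hd]; field_simp; ring
      linarith
    have h2 : (c * s) ^ 2 ≤ (x + d) ^ 2 := pow_le_pow_left₀ (by positivity) h1 2
    rw [← div_eq_mul_inv, le_div_iff₀ (by positivity), inv_mul_le_iff₀ (by positivity)]
    nlinarith [sq_nonneg (x - d), sq_nonneg (x * d)]
  have hIbound : Integrable (fun s : ℝ => (1 + (c * s) ^ 2)⁻¹) :=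
    integrable_inv_one_add_sq.comp_mul_left' hc.ne'
  have hmeas : ∀ L : ℝ, Measurable (fun s : ℝ => F (z ⌊L * s⌋₊ / L)) := by
    intro L
    have : Measurable (fun s : ℝ => z ⌊L * s⌋₊) :=
      (measurable_from_top (f := z)).comp (Nat.measurable_floor.comp (measurable_const_mul L))
    exact hF.measurable.comp (this.div_const L)
  have hint : ∀ L : ℝ, 0 < L → IntegrableOn (fun s : ℝ => F (z ⌊L * s⌋₊ / L)) (Set.Ioi 0) := by
    intro L hL
    refine Integrable.mono' ((hIbound.const_mul
      (K * (2 + 2 * (c * L⁻¹ + D * L⁻¹) ^ 2))).integrableOn (s := Set.Ioi 0))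
      (hmeas L).aestronglyMeasurable ?_
    filter_upwards [ae_restrict_mem measurableSet_Ioi] with s hs
    exact hdom L hL s hs
  have hsum : ∀ L : ℝ, 0 < L → HasSum (fun n => F (z n / L))
      (L * ∫ s in Set.Ioi (0 : ℝ), F (z ⌊L * s⌋₊ / L)) := by
    intro L hL
    have h1 : IntegrableOn (fun s : ℝ => F (z ⌊s⌋₊ / L)) (Set.Ioi 0) := by
      have := (integrableOn_Ioi_comp_mul_left_iff (fun s : ℝ => F (z ⌊s⌋₊ / L)) 0 hL).1 (hint L hL)
      simpa using this
    have h2 := hasSum_of_integrableOn_floor (g := fun n => F (z n / L)) h1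
    have h3 := integral_comp_mul_left_Ioi (fun s : ℝ => F (z ⌊s⌋₊ / L)) 0 hL
    rw [h3, mul_zero, smul_eq_mul, mul_inv_cancel_left₀ hL.ne']
    exact h2
  refine ⟨fun L hL => (hsum L hL).summable, ?_⟩
  have hlim : Tendsto (fun L : ℝ => ∫ s in Set.Ioi (0 : ℝ), F (z ⌊L * s⌋₊ / L)) atTop
      (𝓝 (∫ s in Set.Ioi (0 : ℝ), F (s / ρ))) := by
    refine tendsto_integral_filter_of_dominated_convergence
      (fun s => K * (2 + 2 * (c + D) ^ 2) * (1 + (c * s) ^ 2)⁻¹)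
      (Eventually.of_forall fun L => (hmeas L).aestronglyMeasurable) ?_
      (hIbound.const_mul _).integrableOn ?_
    · filter_upwards [eventually_ge_atTop 1] with L hL
      filter_upwards [ae_restrict_mem measurableSet_Ioi] with s hs
      refine (hdom L (by linarith) s hs).trans ?_
      have : L⁻¹ ≤ 1 := inv_le_one_of_one_le₀ hL
      have h0 : 0 < L⁻¹ := by positivity
      gcongr
      · exact mul_le_of_le_one_right hc.le this
      · exact mul_le_of_le_one_right hD this
    · filter_upwards [ae_restrict_mem measurableSet_Ioi] with s hs
      exact (hF.tendsto _).comp (hz s hs)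
  have hval : ∫ s in Set.Ioi (0 : ℝ), F (s / ρ) = ρ * ∫ x in Set.Ioi 0, F x := by
    have h3 := integral_comp_mul_left_Ioi F 0 (inv_pos.2 hρ)
    rw [inv_inv, mul_zero, smul_eq_mul] at h3
    rw [← h3]
    simp only [div_eq_inv_mul]
  rw [← hval]
  refine hlim.congr' ?_
  filter_upwards [eventually_gt_atTop 0] with L hL
  rw [(hsum L hL).tsum_eq, inv_mul_cancel_left₀ hL.ne']

end SingleFile

namespace SingleFile

/-! ### Initial profiles -/

/-- `Gl` for particles starting to the left, `Gr` for particles starting to the right. -/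
noncomputable def sided (Gl Gr : ℝ → ℝ) (k : ℤ) (x : ℝ) : ℝ := if k ≤ 0 then Gl x else Gr x

/-- Exponential moments of the number of particles near the origin. -/
def HasExpMoments {Ω : Type*} [MeasurableSpace Ω] (P : Measure Ω) (Y : ℤ → Ω → ℝ) : Prop :=
  ∀ C L : ℝ, 0 ≤ C → 0 < L → ∃ D : ℝ≥0∞, D ≠ ∞ ∧ ∀ S : Finset ℤ,
    ∫⁻ ω, ENNReal.ofReal (Real.exp (∑ k ∈ S, C * (1 + (Y k ω / L) ^ 2)⁻¹)) ∂P ≤ D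

/-- The properties of the initial configuration that enter the large deviation principle. -/
structure IsInitialProfile {Ω : Type*} [MeasurableSpace Ω] (P : Measure Ω) (ψ : ℝ → ℝ) (ρ : ℝ)
    (Y : ℤ → Ω → ℝ) : Prop where
  ordered : ∀ᵐ ω ∂P, ∀ k, (k ≤ 0 → Y k ω ≤ 0) ∧ (0 ≤ k → 0 ≤ Y k ω)
  exp_moment : HasExpMoments P Y
  limit : ∀ (Gl Gr : ℝ → ℝ) (K : ℝ), Continuous Gl → Continuous Gr →
    (∀ x ≤ 0, |Gl x| ≤ K * (1 + x ^ 2)⁻¹) → (∀ x, 0 ≤ x → |Gr x| ≤ K * (1 + x ^ 2)⁻¹) →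
    Tendsto (fun L : ℝ =>
        L⁻¹ * Real.log (∫ ω, Real.exp (∑' k, sided Gl Gr k (Y k ω / L)) ∂P)) atTop
      (𝓝 (ρ * ((∫ x in Set.Iic 0, ψ (Real.exp (Gl x))) +
        ∫ x in Set.Ioi 0, ψ (Real.exp (Gr x)))))

namespace HasExpMoments

variable {Ω : Type*} [MeasurableSpace Ω] {P : Measure Ω} {Y : ℤ → Ω → ℝ}

lemma measurable_inv_one_add_sq (hm : ∀ k, Measurable (Y k)) (L : ℝ) (k : ℤ) :
    Measurable fun ω => ENNReal.ofReal ((1 + (Y k ω / L) ^ 2)⁻¹) :=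
  ENNReal.measurable_ofReal.comp (((((hm k).div_const L).pow_const 2).const_add 1).inv)

lemma exists_tsum_lintegral_le (h : HasExpMoments P Y) (hm : ∀ k, Measurable (Y k)) {L : ℝ}
    (hL : 0 < L) : ∃ D : ℝ≥0∞, D ≠ ∞ ∧
      ∑' k, ∫⁻ ω, ENNReal.ofReal ((1 + (Y k ω / L) ^ 2)⁻¹) ∂P ≤ D := by
  obtain ⟨D, hD, hS⟩ := h 1 L zero_le_one hL
  refine ⟨D, hD, ENNReal.summable.tsum_le_of_sum_le fun S => ?_⟩
  rw [← lintegral_finsetSum _ fun k _ => measurable_inv_one_add_sq hm L k]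
  refine (lintegral_mono fun ω => ?_).trans (hS S)
  rw [← ENNReal.ofReal_sum_of_nonneg fun k _ => by positivity]
  gcongr
  simp only [one_mul]
  linarith [Real.add_one_le_exp (∑ k ∈ S, (1 + (Y k ω / L) ^ 2)⁻¹)]

lemma ae_summable (h : HasExpMoments P Y) (hm : ∀ k, Measurable (Y k)) {L : ℝ} (hL : 0 < L) :
    ∀ᵐ ω ∂P, Summable fun k => (1 + (Y k ω / L) ^ 2)⁻¹ := by
  obtain ⟨D, hD, hle⟩ := h.exists_tsum_lintegral_le hm hL
  have hmeas := measurable_inv_one_add_sq hm L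
  rw [← lintegral_tsum fun k => (hmeas k).aemeasurable] at hle
  filter_upwards [ae_lt_top (Measurable.tsum hmeas) (hle.trans_lt hD.lt_top).ne] with ω hω
  have := ENNReal.summable_toReal hω.ne
  refine this.congr fun k => ?_
  rw [ENNReal.toReal_ofReal (by positivity)]

/-- Fatou's lemma along finite sets of labels carries the uniform bound to the full sum. -/
lemma integrable_exp_tsum (h : HasExpMoments P Y) (hm : ∀ k, Measurable (Y k)) {C L : ℝ}
    (hC : 0 ≤ C) (hL : 0 < L) :
    Integrable (fun ω => Real.exp (C * ∑' k, (1 + (Y k ω / L) ^ 2)⁻¹)) P := by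
  obtain ⟨D, hD, hS⟩ := h C L hC hL
  have hmeas : ∀ S : Finset ℤ, Measurable fun ω =>
      Real.exp (∑ k ∈ S, C * (1 + (Y k ω / L) ^ 2)⁻¹) := fun S =>
    Real.measurable_exp.comp (Finset.measurable_fun_sum _ fun k _ =>
      (((((hm k).div_const L).pow_const 2).const_add 1).inv).const_mul C)
  have hlim : ∀ᵐ ω ∂P, Tendsto (fun S : Finset ℤ =>
      Real.exp (∑ k ∈ S, C * (1 + (Y k ω / L) ^ 2)⁻¹)) atTop
      (𝓝 (Real.exp (C * ∑' k, (1 + (Y k ω / L) ^ 2)⁻¹))) := by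
    filter_upwards [h.ae_summable hm hL] with ω hω
    exact (Real.continuous_exp.tendsto _).comp (hω.hasSum.mul_left C)
  refine ⟨aestronglyMeasurable_of_tendsto_ae atTop (fun S => (hmeas S).aestronglyMeasurable)
    hlim, ?_⟩
  rw [hasFiniteIntegral_iff_ofReal (ae_of_all _ fun ω => (Real.exp_pos _).le)]
  calc ∫⁻ ω, ENNReal.ofReal (Real.exp (C * ∑' k, (1 + (Y k ω / L) ^ 2)⁻¹)) ∂P
      = ∫⁻ ω, liminf (fun S : Finset ℤ => ENNReal.ofReal
          (Real.exp (∑ k ∈ S, C * (1 + (Y k ω / L) ^ 2)⁻¹))) atTop ∂P := by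
        refine lintegral_congr_ae (hlim.mono fun ω hω => ?_)
        exact (ENNReal.tendsto_ofReal hω).liminf_eq.symm
    _ ≤ liminf (fun S : Finset ℤ => ∫⁻ ω, ENNReal.ofReal
          (Real.exp (∑ k ∈ S, C * (1 + (Y k ω / L) ^ 2)⁻¹)) ∂P) atTop :=
        lintegral_liminf_le fun S => ENNReal.measurable_ofReal.comp (hmeas S)
    _ ≤ liminf (fun _ : Finset ℤ => D) atTop := liminf_le_liminf (Eventually.of_forall hS)
    _ < ∞ := by rw [liminf_const]; exact hD.lt_top

end HasExpMoments

lemma IsUniform.hasSum_sided {ρ : ℝ} (hρ : 0 < ρ) {y : ℤ → ℝ} (h : IsUniform ρ y)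
    {Gl Gr : ℝ → ℝ} {K : ℝ} (hL : Continuous Gl) (hR : Continuous Gr)
    (hLK : ∀ x ≤ 0, |Gl x| ≤ K * (1 + x ^ 2)⁻¹) (hRK : ∀ x, 0 ≤ x → |Gr x| ≤ K * (1 + x ^ 2)⁻¹) :
    (∀ L : ℝ, 0 < L → Summable fun k => sided Gl Gr k (y k / L)) ∧
    Tendsto (fun L : ℝ => L⁻¹ * ∑' k, sided Gl Gr k (y k / L)) atTop
      (𝓝 (ρ * ((∫ x in Set.Iic 0, Gl x) + ∫ x in Set.Ioi 0, Gr x))) := by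
  have h' := h.reflect
  have hr := tendsto_riemann_sum hρ (z := fun n : ℕ => y ((n + 1 : ℕ) : ℤ))
    (fun n => by rw [← h.tracer]; exact h.ordered (by positivity))
    (fun s hs => h.tendsto_floor hρ 1 hs) hR hRK
  have hl := tendsto_riemann_sum hρ (z := fun n : ℕ => -y (-(n : ℤ)))
    (fun n => by rw [← neg_zero, ← h.tracer]; exact neg_le_neg (h.ordered (by simp)))
    (fun s hs => by simpa using h'.tendsto_floor hρ 0 hs) (F := fun x => Gl (-x))
    (hL.comp continuous_neg) (K := K) (fun x hx => by simpa using hLK (-x) (by linarith))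
  have hs : ∀ L : ℝ, 0 < L → HasSum (fun k => sided Gl Gr k (y k / L))
      ((∑' n : ℕ, Gl (-(-y (-(n : ℤ)) / L))) + ∑' n : ℕ, Gr (y ((n + 1 : ℕ) : ℤ) / L)) := by
    intro L hL0
    -- After negation the left labels are the natural numbers. The tracer counts as a left particle,
    -- so the right sequence begins at `n + 1`.
    rw [← (Equiv.neg ℤ).hasSum_iff]
    refine HasSum.of_nat_of_neg_add_one ?_ ?_
    · convert (hl.1 L hL0).hasSum using 2 with n
      simp [sided, neg_div]
    · convert (hr.1 L hL0).hasSum using 2 with n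
      have : ¬ ((n : ℤ) + 1 ≤ 0) := by omega
      simp [sided, this]
  refine ⟨fun L hL0 => (hs L hL0).summable, ?_⟩
  have hlim := hl.2.add hr.2
  rw [integral_comp_neg_Ioi, neg_zero, ← mul_add] at hlim
  refine hlim.congr' ?_
  filter_upwards [eventually_gt_atTop 0] with L hL0
  rw [(hs L hL0).tsum_eq, mul_add]

/-- For deterministic positions the expectation is trivial and the logarithm cancels the
exponential, leaving a Riemann sum. This is why the quenched transform is `log`. -/
lemma IsQuenchedInitial.isInitialProfile {Ω : Type*} [MeasurableSpace Ω] {P : Measure Ω}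
    [IsProbabilityMeasure P] {ρ : ℝ} (hρ : 0 < ρ) {y : ℤ → ℝ} (hy : IsQuenchedInitial ρ y) :
    IsInitialProfile P Real.log ρ (fun k (_ : Ω) => y k) where
  ordered := ae_of_all _ fun ω k => by
    rw [← hy.tracer]
    exact ⟨fun h => hy.ordered h, fun h => hy.ordered h⟩
  exp_moment C L hC hL := by
    have hc : Continuous fun x : ℝ => C * (1 + x ^ 2)⁻¹ :=
      continuous_const.mul (Continuous.inv₀ (by fun_prop) fun x => by positivity)
    have hb : ∀ x : ℝ, |C * (1 + x ^ 2)⁻¹| ≤ C * (1 + x ^ 2)⁻¹ := fun x => by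
      rw [abs_of_nonneg (by positivity)]
    have hs := ((hy.isUniform hρ).hasSum_sided hρ hc hc (fun x _ => hb x) fun x _ => hb x).1 L hL
    simp only [sided, ite_self] at hs
    refine ⟨ENNReal.ofReal (Real.exp (∑' k, C * (1 + (y k / L) ^ 2)⁻¹)), ENNReal.ofReal_ne_top,
      fun S => ?_⟩
    rw [lintegral_const, measure_univ, mul_one]
    gcongr
    exact hs.sum_le_tsum S fun k _ => by positivity
  limit Gl Gr K hL hR hLK hRK := by
    simpa using ((hy.isUniform hρ).hasSum_sided hρ hL hR hLK hRK).2

end SingleFile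

namespace SingleFile

/-! ### The Laplace functional of the Poisson initial condition -/

lemma integral_exp_poissonMeasure (r : ℝ≥0) (c : ℝ) :
    ∫ n, Real.exp (c * (n : ℝ)) ∂(poissonMeasure r) = Real.exp (r * (Real.exp c - 1)) := by
  rw [integral_poissonMeasure]
  have h := (NormedSpace.expSeries_div_hasSum_exp ((r : ℝ) * Real.exp c)).mul_left (Real.exp (-r))
  rw [← Real.exp_eq_exp_ℝ] at h
  rw [show (r : ℝ) * (Real.exp c - 1) = -r + r * Real.exp c by ring, Real.exp_add, ← h.tsum_eq]
  congr 1; ext n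
  rw [smul_eq_mul, mul_comm c, Real.exp_nat_mul, mul_pow]; ring

/-- `G` for all particles but the tracer. -/
noncomputable def offTracer (G : ℝ → ℝ) (k : ℤ) (x : ℝ) : ℝ := if k = 0 then 0 else G x

/-- The number of particles in `A`, the tracer excluded. -/
noncomputable def countIn {Ω : Type*} (Y : ℤ → Ω → ℝ) (A : Set ℝ) (ω : Ω) : ℕ∞ :=
  {k : ℤ | k ≠ 0 ∧ Y k ω ∈ A}.encard

/-! ### Laplace transforms of Poisson counts -/

section Laplace

variable {Ω : Type*} [MeasurableSpace Ω] {P : Measure Ω} {ρ : ℝ} {Y : ℤ → Ω → ℝ}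

lemma IsAnnealedInitial.integral_exp_countIn (hY : IsAnnealedInitial P ρ Y) (hρ : 0 < ρ)
    {A : Set ℝ} (hA : MeasurableSet A) (hA' : volume A ≠ ∞) (c : ℝ) :
    ∫ ω, Real.exp (c * ((countIn Y A ω).toNat : ℝ)) ∂P =
      Real.exp (ρ * (volume.real A * (Real.exp c - 1))) := by
  have h := (hY.count_law A hA hA').integral_comp
    (f := fun n : ℕ∞ => Real.exp (c * (n.toNat : ℝ))) AEStronglyMeasurable.of_discrete
  rw [integral_map .of_discrete .of_discrete] at h
  simp only [ENat.toNat_natCast] at h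
  rw [integral_exp_poissonMeasure, Real.coe_toNNReal _ (by positivity), mul_assoc] at h
  exact h

lemma IsAnnealedInitial.ae_countIn_ne_top (hY : IsAnnealedInitial P ρ Y)
    {A : Set ℝ} (hA : MeasurableSet A) (hA' : volume A ≠ ∞) : ∀ᵐ ω ∂P, countIn Y A ω ≠ ⊤ := by
  have h := (hY.count_law A hA hA').ae_iff (p := fun n : ℕ∞ => n ≠ ⊤) (Measurable.of_discrete)
  rw [ae_map_iff .of_discrete (MeasurableSet.of_discrete)] at h
  exact h.2 (ae_of_all _ fun n => ENat.natCast_ne_top n)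

lemma hasSum_offTracer_indicator {Ω' : Type*} {Y : ℤ → Ω' → ℝ} {ω : Ω'} {A : Set ℝ}
    (h : countIn Y A ω ≠ ⊤) (c : ℝ) :
    HasSum (fun k => offTracer (A.indicator fun _ => c) k (Y k ω))
      (c * ((countIn Y A ω).toNat : ℝ)) := by
  have hfin : {k : ℤ | k ≠ 0 ∧ Y k ω ∈ A}.Finite := Set.encard_ne_top_iff.1 h
  have h1 : (fun k => offTracer (A.indicator fun _ => c) k (Y k ω)) =
      fun k => if k ∈ hfin.toFinset then c else 0 := by
    ext k
    simp only [offTracer, Set.Finite.mem_toFinset, Set.mem_ofPred_eq, Set.indicator]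
    split_ifs <;> simp_all
  rw [h1]
  have h2 := hasSum_sum_of_ne_finset_zero (L := SummationFilter.unconditional ℤ)
    (f := fun k : ℤ => if k ∈ hfin.toFinset then c else 0)
    (s := hfin.toFinset) fun k hk => if_neg hk
  convert h2 using 1
  rw [Finset.sum_ite_mem, Finset.inter_self, Finset.sum_const, nsmul_eq_mul, mul_comm]
  congr 2
  change Set.ncard {k : ℤ | k ≠ 0 ∧ Y k ω ∈ A} = _
  rw [Set.ncard_eq_toFinset_card _ hfin]

/-- The sets are the fibres over nonzero values, of finite volume by integrability. One
decomposition serves every `φ` vanishing at zero; it is used for the identity and for `exp x - 1`.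
-/
lemma SimpleFunc.exists_eq_sum_indicator (g : SimpleFunc ℝ ℝ) (hg : Integrable g) :
    ∃ (n : ℕ) (A : Fin n → Set ℝ) (c : Fin n → ℝ), (∀ i, MeasurableSet (A i)) ∧
      (∀ i, volume (A i) ≠ ∞) ∧ Pairwise (fun i j => Disjoint (A i) (A j)) ∧
      ∀ φ : ℝ → ℝ, φ 0 = 0 → ∀ y, φ (g y) = ∑ i, (A i).indicator (fun _ => φ (c i)) y := by
  set s := g.range.filter (· ≠ 0) with hs
  set e := s.equivFin with he
  refine ⟨s.card, fun i => g ⁻¹' {((e.symm i : s) : ℝ)}, fun i => ((e.symm i : s) : ℝ),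
    fun i => g.measurableSet_fiber _, fun i => ?_, fun i j hij => ?_, fun φ hφ y => ?_⟩
  · have : ((e.symm i : s) : ℝ) ≠ 0 := (Finset.mem_filter.1 (e.symm i).2).2
    exact (SimpleFunc.measure_preimage_lt_top_of_integrable g hg this).ne
  · refine Disjoint.preimage _ (Set.disjoint_singleton.2 fun h => hij ?_)
    exact e.symm.injective (Subtype.ext h)
  · by_cases hy : g y = 0
    · rw [hy, hφ, Finset.sum_eq_zero fun i _ => ?_]
      refine Set.indicator_of_notMem ?_ _
      have : ((e.symm i : s) : ℝ) ≠ 0 := (Finset.mem_filter.1 (e.symm i).2).2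
      rw [Set.mem_preimage, hy, Set.mem_singleton_iff]
      exact this.symm
    · have hmem : g y ∈ s := Finset.mem_filter.2 ⟨SimpleFunc.mem_range_self g y, hy⟩
      rw [Finset.sum_eq_single (e ⟨g y, hmem⟩)]
      · simp
      · intro i _ hi
        refine Set.indicator_of_notMem (fun h => hi ?_) _
        rw [Set.mem_preimage, Set.mem_singleton_iff] at h
        rw [← e.symm_apply_eq.1 (Subtype.ext h.symm)]
      · simp

/-- The sum over particles is a combination of independent Poisson counts on disjoint sets, so its
exponential moment factorises. -/
lemma IsAnnealedInitial.laplace_simpleFunc [IsProbabilityMeasure P] (hY : IsAnnealedInitial P ρ Y)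
    (hρ : 0 < ρ) (g : SimpleFunc ℝ ℝ) (hg : Integrable g) :
    (∀ᵐ ω ∂P, Summable fun k => offTracer g k (Y k ω)) ∧
    ∫ ω, Real.exp (∑' k, offTracer g k (Y k ω)) ∂P =
      Real.exp (ρ * ∫ y, (Real.exp (g y) - 1)) := by
  obtain ⟨n, A, c, hA, hA', hd, hφ⟩ := SimpleFunc.exists_eq_sum_indicator g hg
  have hsum : ∀ᵐ ω ∂P, HasSum (fun k => offTracer g k (Y k ω))
      (∑ i, c i * ((countIn Y (A i) ω).toNat : ℝ)) := by
    have : ∀ᵐ ω ∂P, ∀ i, countIn Y (A i) ω ≠ ⊤ :=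
      ae_all_iff.2 fun i => hY.ae_countIn_ne_top (hA i) (hA' i)
    filter_upwards [this] with ω hω
    have h := hasSum_sum (s := Finset.univ) fun i _ => hasSum_offTracer_indicator (hω i) (c i)
    convert h using 1
    ext k
    have := hφ id rfl (Y k ω)
    simp only [id] at this
    simp only [offTracer]
    split_ifs
    · simp
    · exact this
  refine ⟨hsum.mono fun ω h => h.summable, ?_⟩
  calc ∫ ω, Real.exp (∑' k, offTracer g k (Y k ω)) ∂P
      = ∫ ω, ∏ i, Real.exp (c i * ((countIn Y (A i) ω).toNat : ℝ)) ∂P := by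
        refine integral_congr_ae (hsum.mono fun ω h => ?_)
        simp only
        rw [h.tsum_eq, Real.exp_sum]
    _ = ∏ i, ∫ ω, Real.exp (c i * ((countIn Y (A i) ω).toNat : ℝ)) ∂P :=
        (hY.count_indep n A hA hd).integral_fun_prod_comp
          (f := fun i (x : ℕ∞) => Real.exp (c i * (x.toNat : ℝ)))
          (fun i => (hY.count_law (A i) (hA i) (hA' i)).aemeasurable)
          fun i => AEStronglyMeasurable.of_discrete
    _ = ∏ i, Real.exp (ρ * (volume.real (A i) * (Real.exp (c i) - 1))) :=
        Finset.prod_congr rfl fun i _ => hY.integral_exp_countIn hρ (hA i) (hA' i) (c i)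
    _ = _ := by
        rw [← Real.exp_sum, ← Finset.mul_sum]
        congr 2
        simp only [hφ (fun x => Real.exp x - 1) (by simp)]
        rw [integral_finsetSum]
        · refine Finset.sum_congr rfl fun i _ => ?_
          rw [integral_indicator (hA i)]
          simp
        · intro i _
          exact (integrable_indicator_iff (hA i)).2 (integrableOn_const (hA' i))

/-- The closed set `s` serves to keep approximations of a nonnegative function nonnegative. The
factor two comes from the bound of `approxOn` by twice the function. -/
lemma exists_simpleFunc_approx {G : ℝ → ℝ} (hG : Measurable G) {K : ℝ}
    (hK : ∀ y, |G y| ≤ K * (1 + y ^ 2)⁻¹) {s : Set ℝ} (hs : IsClosed s) (h0 : 0 ∈ s)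
    (hGs : ∀ y, G y ∈ s) : ∃ g : ℕ → SimpleFunc ℝ ℝ, (∀ n, Integrable (g n)) ∧
      (∀ n y, g n y ∈ s) ∧ (∀ n y, |g n y| ≤ 2 * K * (1 + y ^ 2)⁻¹) ∧
      ∀ y, Tendsto (fun n => g n y) atTop (𝓝 (G y)) := by
  refine ⟨fun n => SimpleFunc.approxOn G hG s 0 h0 n, fun n => ?_, fun n y => ?_, fun n y => ?_,
    fun y => ?_⟩
  · exact SimpleFunc.integrable_approxOn hG (integrable_of_le_inv_one_add_sq hG hK) h0 (by simp) n
  · exact SimpleFunc.approxOn_mem hG h0 n y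
  · have h1 := SimpleFunc.norm_approxOn_zero_le hG h0 y n
    simp only [Real.norm_eq_abs] at h1
    linarith [hK y]
  · exact SimpleFunc.tendsto_approxOn hG h0 (by rw [hs.closure_eq]; exact hGs y)

lemma tendsto_integral_exp_sub_one {G : ℝ → ℝ} {g : ℕ → SimpleFunc ℝ ℝ} {K : ℝ} (hK0 : 0 ≤ K)
    (hb : ∀ n y, |g n y| ≤ K * (1 + y ^ 2)⁻¹)
    (hlim : ∀ y, Tendsto (fun n => g n y) atTop (𝓝 (G y))) :
    Tendsto (fun n => ∫ y, (Real.exp (g n y) - 1)) atTop (𝓝 (∫ y, (Real.exp (G y) - 1))) := by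
  refine tendsto_integral_of_dominated_convergence (fun y => K * (1 + y ^ 2)⁻¹ * Real.exp K)
    (fun n => ((Real.measurable_exp.comp (g n).measurable).sub_const 1).aestronglyMeasurable)
    ((integrable_inv_one_add_sq.const_mul K).mul_const _) (fun n => ae_of_all _ fun y => ?_)
    (ae_of_all _ fun y => ((Real.continuous_exp.tendsto _).comp (hlim y)).sub_const 1)
  refine (abs_exp_sub_one_le_mul_exp _).trans ?_
  have h1 : (1 + y ^ 2)⁻¹ ≤ 1 := inv_le_one_of_one_le₀ (by nlinarith [sq_nonneg y])
  have h2 : K * (1 + y ^ 2)⁻¹ ≤ K := mul_le_of_le_one_right hK0 h1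
  gcongr
  · exact hb n y
  · exact (hb n y).trans h2

lemma ofReal_integral_exp_eq_lintegral {f : Ω → ℝ} {a : ℝ}
    (h : ∫ ω, Real.exp (f ω) ∂P = Real.exp a) :
    Integrable (fun ω => Real.exp (f ω)) P ∧
      ∫⁻ ω, ENNReal.ofReal (Real.exp (f ω)) ∂P = ENNReal.ofReal (Real.exp a) := by
  have hi : Integrable (fun ω => Real.exp (f ω)) P := by
    -- The integral of a nonintegrable function is zero by convention, but here its value is
    -- positive.
    by_contra hcon
    rw [integral_undef hcon] at h
    exact (Real.exp_pos a).ne h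
  exact ⟨hi, by rw [← ofReal_integral_eq_lintegral_ofReal hi
    (ae_of_all _ fun ω => (Real.exp_pos _).le), h]⟩

lemma measurable_offTracer (hm : ∀ k, Measurable (Y k)) {G : ℝ → ℝ} (hG : Measurable G) (k : ℤ) :
    Measurable fun ω => offTracer G k (Y k ω) := by
  unfold offTracer
  split_ifs
  · exact measurable_const
  · exact hG.comp (hm k)

/-- A uniform exponential moment bound. -/
lemma IsAnnealedInitial.lintegral_exp_sum_le [IsProbabilityMeasure P]
    (hY : IsAnnealedInitial P ρ Y) (hρ : 0 < ρ) (hm : ∀ k, Measurable (Y k)) {H : ℝ → ℝ}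
    (hH : Measurable H) (hH0 : ∀ y, 0 ≤ H y) {K : ℝ} (hK : ∀ y, |H y| ≤ K * (1 + y ^ 2)⁻¹)
    (S : Finset ℤ) :
    ∫⁻ ω, ENNReal.ofReal (Real.exp (∑ k ∈ S, offTracer H k (Y k ω))) ∂P ≤
      ENNReal.ofReal (Real.exp (ρ * ∫ y, (Real.exp (H y) - 1))) := by
  have hK0 : 0 ≤ 2 * K := by
    have := (abs_nonneg _).trans (hK 0); simp at this; linarith
  obtain ⟨g, hgi, hg0, hgb, hglim⟩ := exists_simpleFunc_approx hH hK (s := Set.Ici 0)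
    isClosed_Ici (by simp) hH0
  have hle : ∀ n, ∫⁻ ω, ENNReal.ofReal (Real.exp (∑ k ∈ S, offTracer (g n) k (Y k ω))) ∂P ≤
      ENNReal.ofReal (Real.exp (ρ * ∫ y, (Real.exp (g n y) - 1))) := by
    intro n
    obtain ⟨h1, h2⟩ := hY.laplace_simpleFunc hρ (g n) (hgi n)
    rw [← (ofReal_integral_exp_eq_lintegral h2).2]
    refine lintegral_mono_ae (h1.mono fun ω hω => ?_)
    gcongr
    refine hω.sum_le_tsum S fun k _ => ?_
    unfold offTracer
    split_ifs
    · exact le_rfl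
    · exact hg0 n _
  have hlim : Tendsto (fun n => ENNReal.ofReal (Real.exp (ρ * ∫ y, (Real.exp (g n y) - 1)))) atTop
      (𝓝 (ENNReal.ofReal (Real.exp (ρ * ∫ y, (Real.exp (H y) - 1))))) :=
    ENNReal.tendsto_ofReal ((Real.continuous_exp.tendsto _).comp
      ((tendsto_integral_exp_sub_one hK0 hgb hglim).const_mul ρ))
  have hpt : ∀ ω, ENNReal.ofReal (Real.exp (∑ k ∈ S, offTracer H k (Y k ω))) =
      liminf (fun n => ENNReal.ofReal (Real.exp (∑ k ∈ S, offTracer (g n) k (Y k ω)))) atTop := by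
    intro ω
    refine (Tendsto.liminf_eq ?_).symm
    refine ENNReal.tendsto_ofReal ((Real.continuous_exp.tendsto _).comp
      (tendsto_finsetSum _ fun k _ => ?_))
    unfold offTracer
    split_ifs
    · exact tendsto_const_nhds
    · exact hglim _
  simp only [hpt]
  -- Fatou's lemma is used because an integrable envelope is not yet at hand: it will be derived
  -- from this bound.
  refine (lintegral_liminf_le fun n => ?_).trans ?_
  · exact ENNReal.measurable_ofReal.comp (Real.measurable_exp.comp
      (Finset.measurable_sum _ fun k _ => measurable_offTracer hm (g n).measurable k))
  · rw [← hlim.liminf_eq]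
    exact liminf_le_liminf (Eventually.of_forall hle)

end Laplace

end SingleFile

namespace SingleFile

/-! ### The Poisson configuration as an initial profile -/

section Annealed

variable {Ω : Type*} [MeasurableSpace Ω] {P : Measure Ω} {ρ : ℝ} {Y : ℤ → Ω → ℝ}

lemma inv_one_add_div_sq_le {L : ℝ} (hL : 0 < L) (y : ℝ) :
    (1 + (y / L) ^ 2)⁻¹ ≤ (1 + L ^ 2) * (1 + y ^ 2)⁻¹ := by
  rw [← div_eq_mul_inv, le_div_iff₀ (by positivity), inv_mul_le_iff₀ (by positivity)]
  have : (y / L) ^ 2 * L ^ 2 = y ^ 2 := by rw [div_pow]; field_simp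
  nlinarith [sq_nonneg (y / L), sq_nonneg L]

lemma IsAnnealedInitial.hasExpMoments [IsProbabilityMeasure P]
    (hY : IsAnnealedInitial P ρ Y) (hρ : 0 < ρ) (hm : ∀ k, Measurable (Y k)) :
    HasExpMoments P Y := by
  intro C L hC hL
  set H : ℝ → ℝ := fun y => C * (1 + (y / L) ^ 2)⁻¹ with hH
  have hHm : Measurable H :=
    ((((measurable_id.div_const L).pow_const 2).const_add 1).inv).const_mul C
  have hH0 : ∀ y, 0 ≤ H y := fun y => by positivity
  have hK : ∀ y, |H y| ≤ C * (1 + L ^ 2) * (1 + y ^ 2)⁻¹ := fun y => by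
    rw [abs_of_nonneg (hH0 y), mul_assoc]
    exact mul_le_mul_of_nonneg_left (inv_one_add_div_sq_le hL y) hC
  refine ⟨ENNReal.ofReal (Real.exp C) * ENNReal.ofReal (Real.exp (ρ * ∫ y, (Real.exp (H y) - 1))),
    ENNReal.mul_ne_top ENNReal.ofReal_ne_top ENNReal.ofReal_ne_top, fun S => ?_⟩
  refine le_trans (le_trans (lintegral_mono fun ω => ?_) (lintegral_const_mul' _
    (fun ω => ENNReal.ofReal (Real.exp (∑ k ∈ S, offTracer H k (Y k ω))))
    (ENNReal.ofReal_ne_top (r := Real.exp C))).le)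
    (mul_le_mul_right (hY.lintegral_exp_sum_le hρ hm hHm hH0 hK S) _)
  rw [← ENNReal.ofReal_mul (Real.exp_pos _).le, ← Real.exp_add]
  gcongr
  -- The tracer is not a point of the Poisson process; it contributes at most `C`.
  have h1 : ∀ k, C * (1 + (Y k ω / L) ^ 2)⁻¹ ≤
      (if k = 0 then C else 0) + offTracer H k (Y k ω) := fun k => by
    unfold offTracer
    split_ifs
    · rw [add_zero]
      exact mul_le_of_le_one_right hC (inv_le_one_of_one_le₀ (by nlinarith [sq_nonneg (Y k ω / L)]))
    · rw [zero_add]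
  refine (Finset.sum_le_sum fun k _ => h1 k).trans ?_
  rw [Finset.sum_add_distrib]
  gcongr
  rw [Finset.sum_ite_eq']
  split_ifs <;> linarith

lemma summable_offTracer {y : ℤ → ℝ} (hs : Summable fun k => (1 + (y k) ^ 2)⁻¹) {G : ℝ → ℝ}
    {K : ℝ} (hK : ∀ y, |G y| ≤ K * (1 + y ^ 2)⁻¹) : Summable fun k => offTracer G k (y k) := by
  have hK0 : 0 ≤ K := by
    have := (abs_nonneg _).trans (hK 0); simpa using this
  refine Summable.of_norm_bounded (hs.mul_left K) fun k => ?_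
  unfold offTracer
  split_ifs
  · simp; positivity
  · exact hK _

/-- Passage from simple functions by dominated convergence; the exponential moments supply the
envelope. -/
lemma IsAnnealedInitial.laplace [IsProbabilityMeasure P]
    (hY : IsAnnealedInitial P ρ Y) (hρ : 0 < ρ) (hm : ∀ k, Measurable (Y k)) {G : ℝ → ℝ}
    (hG : Measurable G) {K : ℝ} (hK : ∀ y, |G y| ≤ K * (1 + y ^ 2)⁻¹) :
    ∫ ω, Real.exp (∑' k, offTracer G k (Y k ω)) ∂P =
      Real.exp (ρ * ∫ y, (Real.exp (G y) - 1)) := by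
  have hK0 : 0 ≤ K := by
    have := (abs_nonneg _).trans (hK 0); simpa using this
  obtain ⟨g, hgi, -, hgb, hglim⟩ := exists_simpleFunc_approx hG hK isClosed_univ
    (Set.mem_univ 0) fun y => Set.mem_univ _
  have hE := hY.hasExpMoments hρ hm
  have hsum := hE.ae_summable hm one_pos
  have hbd := hE.integrable_exp_tsum hm (C := 2 * K) (L := 1) (by positivity) one_pos
  simp only [div_one] at hsum hbd
  have hl1 : Tendsto (fun n => ∫ ω, Real.exp (∑' k, offTracer (g n) k (Y k ω)) ∂P) atTop
      (𝓝 (∫ ω, Real.exp (∑' k, offTracer G k (Y k ω)) ∂P)) := by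
    have hoff : ∀ ω n k, |offTracer (g n) k (Y k ω)| ≤ 2 * K * (1 + (Y k ω) ^ 2)⁻¹ := by
      intro ω n k
      unfold offTracer
      split_ifs
      · simp; positivity
      · exact hgb n _
    refine tendsto_integral_of_dominated_convergence _
      (fun n => (ofReal_integral_exp_eq_lintegral
        (hY.laplace_simpleFunc hρ (g n) (hgi n)).2).1.aestronglyMeasurable) hbd
      (fun n => hsum.mono fun ω hω => ?_) (hsum.mono fun ω hω => ?_)
    · rw [Real.norm_eq_abs, Real.abs_exp, ← tsum_mul_left]
      exact Real.exp_le_exp.2 ((summable_offTracer hω (hgb n)).tsum_le_tsum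
        (fun k => (le_abs_self _).trans (hoff ω n k)) (hω.mul_left _))
    · refine (Real.continuous_exp.tendsto _).comp (tendsto_tsum_of_dominated_convergence
        (hω.mul_left (2 * K)) (fun k => ?_) (Eventually.of_forall fun n k => hoff ω n k))
      unfold offTracer
      split_ifs
      · exact tendsto_const_nhds
      · exact hglim _
  have hl2 : Tendsto (fun n => ∫ ω, Real.exp (∑' k, offTracer (g n) k (Y k ω)) ∂P) atTop
      (𝓝 (Real.exp (ρ * ∫ y, (Real.exp (G y) - 1)))) := by
    simp only [fun n => (hY.laplace_simpleFunc hρ (g n) (hgi n)).2]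
    exact (Real.continuous_exp.tendsto _).comp
      ((tendsto_integral_exp_sub_one (by positivity) hgb hglim).const_mul ρ)
  exact tendsto_nhds_unique hl1 hl2

/-- The count at the origin is Poisson of mean zero. Needed since `sided` tells left from right by
label, while the Laplace functional does so by position. -/
lemma IsAnnealedInitial.ae_ne_zero [IsProbabilityMeasure P] (hY : IsAnnealedInitial P ρ Y)
    (hρ : 0 < ρ) : ∀ᵐ ω ∂P, ∀ k ≠ 0, Y k ω ≠ 0 := by
  have hv : volume ({0} : Set ℝ) ≠ ∞ := by simp
  have h := hY.integral_exp_countIn hρ (measurableSet_singleton 0) hv 1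
  simp only [measureReal_def, Real.volume_singleton, ENNReal.toReal_zero, zero_mul, mul_zero,
    one_mul] at h
  have hi := (ofReal_integral_exp_eq_lintegral h).1
  rw [Real.exp_zero] at h
  have h0 : ∫ ω, (Real.exp ((countIn Y {0} ω).toNat : ℝ) - 1) ∂P = 0 := by
    rw [integral_sub hi (integrable_const _), h]; simp
  rw [integral_eq_zero_iff_of_nonneg
    (f := fun ω => Real.exp ((countIn Y {0} ω).toNat : ℝ) - 1) (fun ω => by simp)
    (hi.sub (integrable_const _))] at h0
  filter_upwards [h0, hY.ae_countIn_ne_top (measurableSet_singleton 0) hv] with ω h1 h2 k hk hk0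
  have h3 : ((countIn Y {0} ω).toNat : ℝ) = 0 := by
    have : Real.exp ((countIn Y {0} ω).toNat : ℝ) = 1 := by
      simpa [sub_eq_zero] using h1
    simpa using this
  have h4 : countIn Y {0} ω = 0 := by
    have h5 : (countIn Y {0} ω).toNat = 0 := by exact_mod_cast h3
    exact (ENat.toNat_eq_zero.1 h5).resolve_right h2
  unfold countIn at h4
  rw [Set.encard_eq_zero] at h4
  exact (Set.eq_empty_iff_forall_notMem.1 h4 k) ⟨hk, hk0⟩

/-- By scaling, the Laplace functional is explicit at every `L > 0`; the only correction is the
tracer's term `Gl 0`, which vanishes after division by `L`. -/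
lemma IsAnnealedInitial.isInitialProfile [IsProbabilityMeasure P]
    (hY : IsAnnealedInitial P ρ Y) (hρ : 0 < ρ) (hm : ∀ k, Measurable (Y k)) :
    IsInitialProfile P (fun x => x - 1) ρ Y where
  ordered := by
    filter_upwards [hY.tracer, hY.ordered] with ω h0 hmono k
    rw [← h0]
    exact ⟨fun h => hmono h, fun h => hmono h⟩
  exp_moment := hY.hasExpMoments hρ hm
  limit Gl Gr K hL hR hLK hRK := by
    have hK0 : 0 ≤ K := by
      have := (abs_nonneg _).trans (hLK 0 le_rfl); simpa using this
    set G : ℝ → ℝ := fun x => if x ≤ 0 then Gl x else Gr x with hG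
    have hGm : Measurable G := Measurable.ite measurableSet_Iic hL.measurable hR.measurable
    have hGK : ∀ x, |G x| ≤ K * (1 + x ^ 2)⁻¹ := fun x => by
      simp only [hG]
      split_ifs with hx
      · exact hLK x hx
      · exact hRK x (not_le.1 hx).le
    have hGi : Integrable fun x => Real.exp (G x) - 1 := by
      refine integrable_of_le_inv_one_add_sq ((Real.measurable_exp.comp hGm).sub_const 1)
        (K := K * Real.exp K) fun x => (abs_exp_sub_one_le_mul_exp _).trans ?_
      have h1 : (1 + x ^ 2)⁻¹ ≤ 1 := inv_le_one_of_one_le₀ (by nlinarith [sq_nonneg x])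
      have h2 : K * (1 + x ^ 2)⁻¹ ≤ K := mul_le_of_le_one_right hK0 h1
      rw [mul_right_comm]
      gcongr
      · exact hGK x
      · exact (hGK x).trans h2
    have hval : (∫ x in Set.Iic 0, (Real.exp (Gl x) - 1)) + ∫ x in Set.Ioi 0, (Real.exp (Gr x) - 1)
        = ∫ x, (Real.exp (G x) - 1) := by
      rw [← integral_add_compl (s := Set.Iic 0) measurableSet_Iic hGi, Set.compl_Iic]
      congr 1
      · refine setIntegral_congr_fun measurableSet_Iic fun x hx => ?_
        simp only [hG, if_pos (Set.mem_Iic.1 hx)]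
      · refine setIntegral_congr_fun measurableSet_Ioi fun x hx => ?_
        simp only [hG, if_neg (not_le.2 (Set.mem_Ioi.1 hx))]
    rw [hval]
    have hlim : Tendsto (fun L : ℝ => L⁻¹ * Gl 0 + ρ * ∫ x, (Real.exp (G x) - 1)) atTop
        (𝓝 (ρ * ∫ x, (Real.exp (G x) - 1))) := by
      simpa using (tendsto_inv_atTop_zero.mul_const (Gl 0)).add_const
        (ρ * ∫ x, (Real.exp (G x) - 1))
    refine hlim.congr' ?_
    filter_upwards [eventually_gt_atTop 0] with L hL0
    have hGLK : ∀ y, |G (y / L)| ≤ K * (1 + L ^ 2) * (1 + y ^ 2)⁻¹ := fun y => by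
      rw [mul_assoc]
      exact (hGK _).trans (mul_le_mul_of_nonneg_left (inv_one_add_div_sq_le hL0 y) hK0)
    have hsummable := (hY.hasExpMoments hρ hm).ae_summable hm one_pos
    simp only [div_one] at hsummable
    have hae : ∀ᵐ ω ∂P, ∑' k, sided Gl Gr k (Y k ω / L) =
        Gl 0 + ∑' k, offTracer (fun y => G (y / L)) k (Y k ω) := by
      filter_upwards [hY.tracer, hY.ordered, hY.ae_ne_zero hρ, hsummable] with ω h0 hmono hne hs
      have e : ∀ k, sided Gl Gr k (Y k ω / L) = (if k = 0 then Gl 0 else 0) +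
          offTracer (fun y => G (y / L)) k (Y k ω) := by
        intro k
        rcases lt_trichotomy k 0 with hk | rfl | hk
        · have : Y k ω / L ≤ 0 :=
            div_nonpos_of_nonpos_of_nonneg (h0 ▸ hmono hk.le) hL0.le
          simp [sided, offTracer, hG, hk.le, hk.ne, this]
        · simp [sided, offTracer, h0]
        · have h1 : 0 < Y k ω := lt_of_le_of_ne (h0 ▸ hmono hk.le) (hne k hk.ne').symm
          have h2 : ¬ Y k ω / L ≤ 0 := not_le.2 (div_pos h1 hL0)
          simp [sided, offTracer, hG, not_le.2 hk, hk.ne', h2]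
      have h1 : HasSum (fun k : ℤ => if k = 0 then Gl 0 else 0) (Gl 0) := hasSum_ite_eq 0 (Gl 0)
      have h2 := (summable_offTracer hs hGLK).hasSum
      rw [funext e]
      exact (h1.add h2).tsum_eq
    have hint : ∫ ω, Real.exp (∑' k, sided Gl Gr k (Y k ω / L)) ∂P =
        Real.exp (Gl 0 + L * (ρ * ∫ x, (Real.exp (G x) - 1))) := by
      rw [integral_congr_ae (hae.mono fun ω h => congrArg Real.exp h)]
      simp only [Real.exp_add]
      rw [integral_const_mul, hY.laplace hρ hm (G := fun y => G (y / L))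
        (hGm.comp (measurable_id.div_const L)) hGLK]
      have := Measure.integral_comp_div (fun x => Real.exp (G x) - 1) L
      rw [this, abs_of_pos hL0, smul_eq_mul]
      ring_nf
    rw [hint, Real.log_exp]
    field_simp

end Annealed

end SingleFile

namespace SingleFile

/-! ### Maximal displacement of a Brownian path -/

/-- The `j`-th dyadic point of generation `n` in `[0, T]`. -/
noncomputable def dyadicPoint (T : ℝ≥0) (n j : ℕ) : ℝ≥0 := T * (j / 2 ^ n)

/-- The sum of the fourth powers of the dyadic increments of generation `n`. -/
noncomputable def dyadicVariation (T : ℝ≥0) (n : ℕ) (w : ℝ≥0 → ℝ) : ℝ :=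
  ∑ j ∈ Finset.range (2 ^ n), (w (dyadicPoint T n (j + 1)) - w (dyadicPoint T n j)) ^ 4

/-- A weighted sum of the dyadic variations, which controls the maximum of the path. -/
noncomputable def roughness (T : ℝ≥0) (w : ℝ≥0 → ℝ) : ℝ≥0∞ :=
  ∑' n : ℕ, ENNReal.ofReal ((1000 / 729) ^ n * dyadicVariation T n w)

lemma dyadicPoint_two_mul (T : ℝ≥0) (n j : ℕ) :
    dyadicPoint T (n + 1) (2 * j) = dyadicPoint T n j := by
  unfold dyadicPoint
  congr 1
  push_cast
  rw [pow_succ']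
  exact mul_div_mul_left _ _ two_ne_zero

lemma dyadicVariation_nonneg (T : ℝ≥0) (n : ℕ) (w : ℝ≥0 → ℝ) : 0 ≤ dyadicVariation T n w :=
  Finset.sum_nonneg fun j _ => by positivity

lemma abs_le_add_pow_four_div {x c : ℝ} (hc : 0 < c) : |x| ≤ c + x ^ 4 / c ^ 3 := by
  rcases le_or_gt |x| c with h | h
  · have : 0 ≤ x ^ 4 / c ^ 3 := by positivity
    linarith
  · have h1 : |x| ≤ x ^ 4 / c ^ 3 := by
      rw [le_div_iff₀ (by positivity), ← (by decide : Even 4).pow_abs x, pow_succ' |x| 3]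
      gcongr
    linarith

/-- Chaining: an odd point of generation `n + 1` is one increment away from a point of generation
`n`. Increments are compared with the threshold `a * (9 / 10) ^ n`, and what exceeds it is paid for
by the fourth power over the cube of the threshold; hence the weight `1000 / 729 = (9 / 10)⁻³` in
`roughness`. -/
lemma abs_dyadicPoint_le {w : ℝ≥0 → ℝ} (h0 : w 0 = 0) (T : ℝ≥0) {a : ℝ} (ha : 0 < a) (n : ℕ) :
    ∀ j ≤ 2 ^ n, |w (dyadicPoint T n j)| ≤ ∑ i ∈ Finset.range (n + 1),
      (a * (9 / 10) ^ i + (1000 / 729) ^ i * dyadicVariation T i w / a ^ 3) := by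
  have key : ∀ n, ∀ j < 2 ^ n, |w (dyadicPoint T n (j + 1)) - w (dyadicPoint T n j)| ≤
      a * (9 / 10) ^ n + (1000 / 729) ^ n * dyadicVariation T n w / a ^ 3 := by
    intro n j hj
    refine (abs_le_add_pow_four_div (c := a * (9 / 10) ^ n) (by positivity)).trans ?_
    have h1 : (w (dyadicPoint T n (j + 1)) - w (dyadicPoint T n j)) ^ 4 ≤ dyadicVariation T n w :=
      Finset.single_le_sum
        (f := fun j => (w (dyadicPoint T n (j + 1)) - w (dyadicPoint T n j)) ^ 4)
        (fun j _ => by positivity) (Finset.mem_range.2 hj)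
    have h2 : (1000 / 729 : ℝ) ^ n * dyadicVariation T n w / a ^ 3 =
        dyadicVariation T n w / (a * (9 / 10) ^ n) ^ 3 := by
      rw [mul_pow, ← pow_mul, mul_comm n 3, pow_mul,
        show ((1000 : ℝ) / 729) = ((9 / 10) ^ 3)⁻¹ by norm_num, inv_pow]
      field_simp
    rw [h2]
    gcongr
  have hterm : ∀ i, 0 ≤ a * (9 / 10) ^ i + (1000 / 729) ^ i * dyadicVariation T i w / a ^ 3 :=
    fun i => by have := dyadicVariation_nonneg T i w; positivity
  have hpt0 : ∀ n, w (dyadicPoint T n 0) = 0 := fun n => by simp [dyadicPoint, h0]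
  induction n with
  | zero =>
    intro j hj
    rw [zero_add, Finset.sum_range_one]
    have hj' : j = 0 ∨ j = 1 := by simp at hj; omega
    rcases hj' with rfl | rfl
    · rw [hpt0, abs_zero]; exact hterm 0
    · have := key 0 0 (by simp)
      rwa [hpt0, sub_zero] at this
  | succ n ih =>
    intro j hj
    rw [Finset.sum_range_succ]
    rcases Nat.even_or_odd' j with ⟨i, rfl | rfl⟩
    · rw [dyadicPoint_two_mul]
      exact (ih i (by rw [pow_succ'] at hj; omega)).trans (le_add_of_nonneg_right (hterm _))
    · have h1 := key (n + 1) (2 * i) (by omega)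
      rw [dyadicPoint_two_mul] at h1
      have h2 := ih i (by rw [pow_succ'] at hj; omega)
      have h3 := abs_add_le (w (dyadicPoint T (n + 1) (2 * i + 1)) - w (dyadicPoint T n i))
        (w (dyadicPoint T n i))
      rw [sub_add_cancel] at h3
      linarith

/-- The thresholds sum to `10 * a`, and continuity extends the bound from dyadic to all times. The
parameter `a` stays free; it will be taken proportional to the distance of the particle from the
origin. -/
lemma abs_le_of_roughness {w : ℝ≥0 → ℝ} (hw : Continuous w) (h0 : w 0 = 0) {T : ℝ≥0}
    (hR : roughness T w ≠ ∞) {a : ℝ} (ha : 0 < a) {t : ℝ≥0} (ht : t ≤ T) :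
    |w t| ≤ 10 * a + (roughness T w).toReal / a ^ 3 := by
  have hnn : ∀ n, 0 ≤ (1000 / 729 : ℝ) ^ n * dyadicVariation T n w := fun n =>
    mul_nonneg (by positivity) (dyadicVariation_nonneg T n w)
  have hsum : HasSum (fun n => (1000 / 729 : ℝ) ^ n * dyadicVariation T n w)
      (roughness T w).toReal := by
    have h1 := (ENNReal.summable_toReal hR)
    have h2 := h1.hasSum
    rw [← ENNReal.tsum_toReal_eq fun n => ENNReal.ofReal_ne_top] at h2
    simp only [ENNReal.toReal_ofReal (hnn _)] at h2
    exact h2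
  have hgeo : HasSum (fun n : ℕ => a * (9 / 10 : ℝ) ^ n) (10 * a) := by
    have := (hasSum_geometric_of_lt_one (r := (9 / 10 : ℝ)) (by norm_num) (by norm_num)).mul_left a
    have e : a * (1 - 9 / 10 : ℝ)⁻¹ = 10 * a := by ring
    rwa [e] at this
  have hbd : ∀ n, ∀ j ≤ 2 ^ n, |w (dyadicPoint T n j)| ≤
      10 * a + (roughness T w).toReal / a ^ 3 := fun n j hj =>
    (abs_dyadicPoint_le h0 T ha n j hj).trans
      (sum_le_hasSum _ (fun i _ => by have := hnn i; positivity)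
        (hgeo.add (hsum.div_const (a ^ 3))))
  rcases eq_or_ne T 0 with rfl | hT
  · rw [nonpos_iff_eq_zero.1 ht, h0, abs_zero]
    positivity
  have hT0 : (0 : ℝ) < T := by exact_mod_cast pos_iff_ne_zero.2 hT
  set j : ℕ → ℕ := fun n => ⌊(t / T : ℝ) * 2 ^ n⌋₊ with hj
  have hlim : Tendsto (fun n => dyadicPoint T n (j n)) atTop (𝓝 t) := by
    rw [← NNReal.tendsto_coe]
    have h1 : Tendsto (fun n : ℕ => (⌊(t / T : ℝ) * 2 ^ n⌋₊ : ℝ) / 2 ^ n) atTop (𝓝 (t / T)) :=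
      (tendsto_nat_floor_mul_div_atTop (R := ℝ) (a := t / T) (by positivity)).comp
        (tendsto_pow_atTop_atTop_of_one_lt (r := (2 : ℝ)) (by norm_num))
    have h2 := h1.const_mul (T : ℝ)
    rw [mul_div_cancel₀ _ hT0.ne'] at h2
    refine h2.congr fun n => ?_
    simp [dyadicPoint, hj]
  refine le_of_tendsto ((hw.tendsto t).comp hlim).abs (Eventually.of_forall fun n => hbd n _ ?_)
  refine Nat.floor_le_of_le ?_
  push_cast
  exact mul_le_of_le_one_left (by positivity) ((div_le_one hT0).2 (by exact_mod_cast ht))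

lemma measurable_dyadicVariation (T : ℝ≥0) (n : ℕ) : Measurable (dyadicVariation T n) := by
  have h : ∀ j, Measurable fun w : ℝ≥0 → ℝ =>
      (w (dyadicPoint T n (j + 1)) - w (dyadicPoint T n j)) ^ 4 := fun j => by
    have h1 : Measurable fun w : ℝ≥0 → ℝ => w (dyadicPoint T n (j + 1)) := measurable_pi_apply _
    have h2 : Measurable fun w : ℝ≥0 → ℝ => w (dyadicPoint T n j) := measurable_pi_apply _
    exact (h1.sub h2).pow_const 4
  exact Finset.measurable_fun_sum _ fun j _ => h j

lemma measurable_roughness_term (T : ℝ≥0) (n : ℕ) : Measurable fun w : ℝ≥0 → ℝ =>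
    ENNReal.ofReal ((1000 / 729) ^ n * dyadicVariation T n w) :=
  ENNReal.measurable_ofReal.comp ((measurable_dyadicVariation T n).const_mul _)

lemma measurable_roughness (T : ℝ≥0) : Measurable (roughness T) :=
  Measurable.tsum (measurable_roughness_term T)

lemma exists_lintegral_pow_four_gaussianReal :
    ∃ c : ℝ≥0∞, c ≠ ∞ ∧ ∀ v : ℝ≥0,
      ∫⁻ x, ENNReal.ofReal (x ^ 4) ∂(gaussianReal 0 v) = (v : ℝ≥0∞) ^ 2 * c := by
  refine ⟨∫⁻ x, ENNReal.ofReal (x ^ 4) ∂(gaussianReal 0 1), ?_, fun v => ?_⟩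
  · have h := memLp_id_gaussianReal (μ := 0) (v := 1) (4 : ℝ≥0)
    have h2 : Integrable (fun x : ℝ => x ^ 4) (gaussianReal 0 1) := by
      have := h.integrable_norm_rpow (by simp) (by simp)
      refine this.congr (Eventually.of_forall fun x => ?_)
      simp only [id, Real.norm_eq_abs]
      norm_num
      exact (by decide : Even 4).pow_abs x
    exact (h2.lintegral_lt_top).ne
  · have h1 : gaussianReal 0 v = (gaussianReal 0 1).map (fun x => √(v : ℝ) * x) := by
      rw [gaussianReal_map_const_mul]
      congr 1
      · simp
      · ext; simp
    rw [h1, lintegral_map (by fun_prop) (by fun_prop), ← lintegral_const_mul _ (by fun_prop)]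
    refine lintegral_congr fun x => ?_
    rw [mul_pow, ENNReal.ofReal_mul (by positivity)]
    congr 1
    rw [show (√(v : ℝ)) ^ 4 = (v : ℝ) ^ 2 by
      rw [show 4 = 2 * 2 from rfl, pow_mul, Real.sq_sqrt v.coe_nonneg]]
    rw [ENNReal.ofReal_pow v.coe_nonneg, ENNReal.ofReal_coe_nnreal]

/-- Generation `n` has `2 ^ n` increments, each with fourth moment of order `4⁻ⁿ`. With the weights
the ratio is `1000 / 729 / 2 = 500 / 729 < 1`. -/
lemma exists_lintegral_roughness_le (T : ℝ≥0) : ∃ C : ℝ≥0∞, C ≠ ∞ ∧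
    ∀ {Ω : Type*} [MeasurableSpace Ω] {P : Measure Ω} {B : ℝ≥0 → Ω → ℝ},
      IsPreBrownianReal B P → (∀ t, Measurable (B t)) →
      ∫⁻ ω, roughness T (fun t => B t ω) ∂P ≤ C := by
  obtain ⟨c, hc, hcv⟩ := exists_lintegral_pow_four_gaussianReal
  refine ⟨∑' n : ℕ, (T : ℝ≥0∞) ^ 2 * c * ENNReal.ofReal (500 / 729) ^ n, ?_, ?_⟩
  · rw [ENNReal.tsum_mul_left]
    refine ENNReal.mul_ne_top (ENNReal.mul_ne_top (by simp) hc) ?_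
    rw [ENNReal.tsum_geometric]
    refine ENNReal.inv_ne_top.2 ?_
    rw [Ne, tsub_eq_zero_iff_le, not_le]
    exact ENNReal.ofReal_lt_one.2 (by norm_num)
  intro Ω _ P B hB hm
  have hmB : Measurable fun ω => (fun t => B t ω) := measurable_pi_lambda _ hm
  have hmn : ∀ n, Measurable fun ω =>
      ENNReal.ofReal ((1000 / 729) ^ n * dyadicVariation T n fun t => B t ω) := fun n =>
    (measurable_roughness_term T n).comp hmB
  unfold roughness
  rw [lintegral_tsum fun n => (hmn n).aemeasurable]
  refine ENNReal.tsum_le_tsum fun n => ?_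
  have hmi : ∀ j, Measurable fun ω => ENNReal.ofReal
      ((B (dyadicPoint T n (j + 1)) ω - B (dyadicPoint T n j) ω) ^ 4) := fun j =>
    ENNReal.measurable_ofReal.comp (((hm _).sub (hm _)).pow_const 4)
  have hinc : ∀ j, ∫⁻ ω, ENNReal.ofReal
      ((B (dyadicPoint T n (j + 1)) ω - B (dyadicPoint T n j) ω) ^ 4) ∂P =
      ((T / 2 ^ n : ℝ≥0) : ℝ≥0∞) ^ 2 * c := by
    intro j
    have h := (hB.hasLaw_sub (dyadicPoint T n (j + 1)) (dyadicPoint T n j)).lintegral_comp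
      (f := fun x => ENNReal.ofReal (x ^ 4)) (by fun_prop)
    simp only [Pi.sub_apply] at h
    rw [h, hcv]
    congr 3
    ext
    have e : (dyadicPoint T n (j + 1) : ℝ) - dyadicPoint T n j = T / 2 ^ n := by
      simp [dyadicPoint]; ring
    change |(dyadicPoint T n (j + 1) : ℝ) - dyadicPoint T n j| = _
    rw [e, abs_of_nonneg (by positivity)]
    simp
  simp only [dyadicVariation]
  simp only [ENNReal.ofReal_mul (show (0 : ℝ) ≤ (1000 / 729) ^ n by positivity),
    fun ω => ENNReal.ofReal_sum_of_nonneg (s := Finset.range (2 ^ n))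
    (f := fun j => (B (dyadicPoint T n (j + 1)) ω - B (dyadicPoint T n j) ω) ^ 4)
    (fun j _ => by positivity)]
  rw [lintegral_const_mul' _ _ ENNReal.ofReal_ne_top, lintegral_finsetSum _ fun j _ => hmi j]
  simp only [hinc, Finset.sum_const, Finset.card_range, nsmul_eq_mul]
  refine le_of_eq ?_
  have e : ENNReal.ofReal ((1000 / 729) ^ n) * (2 ^ n * ((T / 2 ^ n : ℝ≥0) : ℝ≥0∞) ^ 2) =
      (T : ℝ≥0∞) ^ 2 * ENNReal.ofReal (500 / 729) ^ n := by
    have h0 : (0 : ℝ) ≤ T / 2 ^ n := by positivity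
    have e1 : (((T / 2 ^ n : ℝ≥0) : ℝ≥0∞)) = ENNReal.ofReal (T / 2 ^ n : ℝ) := by
      rw [← ENNReal.ofReal_coe_nnreal]; simp
    have e2 : (2 : ℝ≥0∞) ^ n = ENNReal.ofReal (2 ^ n) := by
      rw [ENNReal.ofReal_pow (by norm_num), ENNReal.ofReal_ofNat]
    rw [e1, e2, ← ENNReal.ofReal_coe_nnreal (p := T), ← ENNReal.ofReal_pow h0,
      ← ENNReal.ofReal_pow T.coe_nonneg,
      ← ENNReal.ofReal_pow (show (0 : ℝ) ≤ 500 / 729 by norm_num),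
      ← ENNReal.ofReal_mul (by positivity), ← ENNReal.ofReal_mul (by positivity),
      ← ENNReal.ofReal_mul (by positivity),
      show (1000 / 729 : ℝ) = 500 / 729 * 2 by norm_num, mul_pow]
    congr 1
    field_simp
  rw [Nat.cast_pow, Nat.cast_ofNat, ← mul_assoc (2 ^ n : ℝ≥0∞), ← mul_assoc, e]
  ring

end SingleFile

namespace SingleFile

/-! ### Counting particles beyond a level -/

/-- The number of particles beyond `ζ`, relative to the number of positive labels. -/
noncomputable def excess (z : ℤ → ℝ) (ζ : ℝ) : ℝ :=
  ∑' k, ((if ζ < z k then 1 else 0) - (if 0 < k then 1 else 0))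

lemma excess_eq_sum {z : ℤ → ℝ} {ζ : ℝ} {K : ℤ} (hp : ∀ k, K < k → ζ < z k)
    (hn : ∀ k, k < -K → z k ≤ ζ) (hK : 0 ≤ K) :
    excess z ζ = ∑ k ∈ Finset.Icc (-K) K,
      ((if ζ < z k then 1 else 0) - (if 0 < k then 1 else 0)) := by
  refine tsum_eq_sum fun k hk => ?_
  rw [Finset.mem_Icc, not_and_or, not_le, not_le] at hk
  rcases hk with h | h
  · rw [if_neg (not_lt.2 (hn k h)), if_neg (by omega), sub_zero]
  · rw [if_pos (hp k h), if_pos (by omega), sub_self]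

/-- A family of paths whose labels are eventually sorted, uniformly on `[0, T]`. -/
def IsSortedAtInfinity (T : ℝ≥0) (z : ℤ → ℝ≥0 → ℝ) : Prop :=
  ∀ M : ℝ, ∃ K : ℤ, 0 ≤ K ∧ ∀ t ≤ T, ∀ k, (K < k → M < z k t) ∧ (k < -K → z k t < -M)

/-- At any time at most `2 * K + 1` free particles lie in the window `|M| + A`, where `A` bounds the
tracer. If an ordered particle of larger label failed to clear `M`, all labels between it and the
tracer would lie in that window. -/
lemma IsSortedAtInfinity.relabel {T : ℝ≥0} {x z : ℤ → ℝ≥0 → ℝ} (hz : IsSortedAtInfinity T z)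
    (hx : ∀ t, Monotone fun k => x k t) (hc : Continuous (x 0))
    (hπ : ∀ t, ∃ π : Equiv.Perm ℤ, ∀ k, x k t = z (π k) t) : IsSortedAtInfinity T x := by
  intro M
  obtain ⟨A, hA⟩ : ∃ A : ℝ, ∀ t ≤ T, |x 0 t| ≤ A := by
    obtain ⟨A, hA⟩ := (isCompact_Icc (a := 0) (b := T)).exists_bound_of_continuousOn
      hc.continuousOn
    exact ⟨A, fun t ht => hA t ⟨zero_le, ht⟩⟩
  obtain ⟨K, hK0, hK⟩ := hz (|M| + A)
  have hcount : ∀ t ≤ T, ∀ S : Finset ℤ, (∀ j ∈ S, |x j t| ≤ |M| + A) →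
      (S.card : ℤ) ≤ 2 * K + 1 := by
    intro t ht S hS
    obtain ⟨π, hπt⟩ := hπ t
    have h1 : S.map π.toEmbedding ⊆ Finset.Icc (-K) K := by
      intro i hi
      obtain ⟨j, hj, rfl⟩ := Finset.mem_map.1 hi
      have h2 := abs_le.1 (hS j hj)
      rw [hπt] at h2
      rw [Finset.mem_Icc]
      constructor
      · by_contra! h
        exact absurd ((hK t ht (π j)).2 h) (not_lt.2 h2.1)
      · by_contra! h
        exact absurd ((hK t ht (π j)).1 h) (not_lt.2 h2.2)
    have h3 := Finset.card_le_card h1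
    rw [Finset.card_map, Int.card_Icc] at h3
    omega
  have hM := le_abs_self M
  have hM' := neg_abs_le M
  refine ⟨2 * K + 1, by omega, fun t ht k => ⟨fun hk => ?_, fun hk => ?_⟩⟩
  · by_contra! h
    have h0 := abs_le.1 (hA t ht)
    have := hcount t ht (Finset.Icc 0 k) fun j hj => by
      rw [Finset.mem_Icc] at hj
      have h1 : x 0 t ≤ x j t := hx t hj.1
      have h2 : x j t ≤ x k t := hx t hj.2
      exact abs_le.2 ⟨by linarith [abs_nonneg M], by linarith⟩
    rw [Int.card_Icc] at this
    omega
  · by_contra! h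
    have h0 := abs_le.1 (hA t ht)
    have := hcount t ht (Finset.Icc k 0) fun j hj => by
      rw [Finset.mem_Icc] at hj
      have h1 : x k t ≤ x j t := hx t hj.1
      have h2 : x j t ≤ x 0 t := hx t hj.2
      exact abs_le.2 ⟨by linarith, by linarith [abs_nonneg M]⟩
    rw [Int.card_Icc] at this
    omega

/-- Relabelling continuous paths preserves continuous particle counts. -/
lemma sum_relabel_eq {T : ℝ≥0} {x z : ℤ → ℝ≥0 → ℝ}
    (h0 : ∀ k, x k 0 = z k 0) (hxc : ∀ k, Continuous (x k)) (hzc : ∀ k, Continuous (z k))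
    (hπ : ∀ t, ∃ π : Equiv.Perm ℤ, ∀ k, x k t = z (π k) t) {φ : ℝ → ℝ} (hφ : Continuous φ)
    {K : ℤ} (hx : ∀ t ≤ T, ∀ k, k ∉ Finset.Icc (-K) K → φ (x k t) = 0 ∨ φ (x k t) = 1)
    (hz : ∀ t ≤ T, ∀ k, k ∉ Finset.Icc (-K) K → φ (z k t) = 0 ∨ φ (z k t) = 1)
    {t : ℝ≥0} (ht : t ≤ T) :
    ∑ k ∈ Finset.Icc (-K) K, φ (x k t) = ∑ k ∈ Finset.Icc (-K) K, φ (z k t) := by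
  set S := Finset.Icc (-K) K with hS
  set d : ℝ≥0 → ℝ := fun t => ∑ k ∈ S, φ (x k t) - ∑ k ∈ S, φ (z k t) with hd
  have hdc : Continuous d :=
    (continuous_finsetSum _ fun k _ => hφ.comp (hxc k)).sub
      (continuous_finsetSum _ fun k _ => hφ.comp (hzc k))
  have hd0 : d 0 = 0 := by simp only [hd, h0, sub_self]
  -- Permuting the labels changes the window only by labels outside it for one of the two families,
  -- and there `φ` is zero or one. So `d` is an integer; being continuous and zero at time zero, it
  -- cannot pass through `1 / 2`.
  have hint : ∀ t ≤ T, ∃ n : ℤ, d t = n := by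
    intro t ht
    obtain ⟨π, hπt⟩ := hπ t
    have hbin : ∀ R : Finset ℤ, (∀ j ∈ R, φ (z j t) = 0 ∨ φ (z j t) = 1) →
        ∃ n : ℤ, ∑ j ∈ R, φ (z j t) = n := by
      intro R hR
      refine ⟨∑ j ∈ R, if φ (z j t) = 0 then 0 else 1, ?_⟩
      push_cast
      refine Finset.sum_congr rfl fun j hj => ?_
      rcases hR j hj with h | h <;> simp [h]
    have e1 : ∑ k ∈ S, φ (x k t) = ∑ j ∈ S.map π.toEmbedding, φ (z j t) := by
      rw [Finset.sum_map]
      exact Finset.sum_congr rfl fun k _ => by rw [hπt]; rfl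
    obtain ⟨n, hn⟩ := hbin (S.map π.toEmbedding \ S) fun j hj =>
      hz t ht j (Finset.mem_sdiff.1 hj).2
    obtain ⟨m, hm⟩ := hbin (S \ S.map π.toEmbedding) fun j hj => by
      have h1 := (Finset.mem_sdiff.1 hj).2
      have h2 : π.symm j ∉ S := fun h => h1 (Finset.mem_map.2 ⟨_, h, by simp⟩)
      have h3 := hx t ht _ h2
      rw [hπt, Equiv.apply_symm_apply] at h3
      exact h3
    refine ⟨n - m, ?_⟩
    have e2 := Finset.sum_sdiff_sub_sum_sdiff (s₁ := S) (s₂ := S.map π.toEmbedding)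
      (f := fun j => φ (z j t))
    simp only [hd]
    push_cast
    rw [e1, ← hn, ← hm]
    linarith
  have hne : ∀ s ≤ T, |d s| ≠ 1 / 2 := by
    intro s hs h
    obtain ⟨n, hn⟩ := hint s hs
    rw [hn] at h
    have h2 : |n| * 2 = 1 := by
      have : ((|n| * 2 : ℤ) : ℝ) = 1 := by push_cast; linarith
      exact_mod_cast this
    omega
  suffices h : d t = 0 by
    simp only [hd] at h
    linarith
  obtain ⟨n, hn⟩ := hint t ht
  by_contra hdt
  have h1 : (1 : ℝ) ≤ |d t| := by
    rw [hn] at hdt ⊢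
    have : n ≠ 0 := fun h => hdt (by simp [h])
    exact_mod_cast Int.one_le_abs this
  obtain ⟨s, hs, hs2⟩ := intermediate_value_Icc (zero_le (a := t)) hdc.abs.continuousOn
    (show (1 / 2 : ℝ) ∈ Set.Icc |d 0| |d t| by
      rw [hd0, abs_zero]; constructor <;> linarith)
  exact hne s (hs.2.trans ht) hs2

/-- The tracer is beyond `ζ` if and only if the free particles have positive excess at `ζ`. -/
lemma excess_free {T : ℝ≥0} {x z : ℤ → ℝ≥0 → ℝ} (hz : IsSortedAtInfinity T z)
    (h0 : ∀ k, x k 0 = z k 0) (hxc : ∀ k, Continuous (x k)) (hzc : ∀ k, Continuous (z k))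
    (hx : ∀ t, Monotone fun k => x k t)
    (hπ : ∀ t, ∃ π : Equiv.Perm ℤ, ∀ k, x k t = z (π k) t) {t : ℝ≥0} (ht : t ≤ T) (ζ : ℝ) :
    (ζ < x 0 t → 1 ≤ excess (fun k => z k t) ζ) ∧
      (x 0 t ≤ ζ → excess (fun k => z k t) ζ ≤ 0) := by
  have hxs := hz.relabel hx (hxc 0) hπ
  obtain ⟨K₁, hK₁, h1⟩ := hz (|ζ| + 1)
  obtain ⟨K₂, hK₂, h2⟩ := hxs (|ζ| + 1)
  set K := max K₁ K₂ with hK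
  have hζ := le_abs_self ζ
  have hζ' := neg_abs_le ζ
  have hK0 : 0 ≤ K := hK₁.trans (le_max_left _ _)
  have hzp : ∀ t ≤ T, ∀ k, K < k → ζ + 1 < z k t := fun t ht k hk => by
    have := (h1 t ht k).1 (by omega); linarith
  have hzn : ∀ t ≤ T, ∀ k, k < -K → z k t < ζ := fun t ht k hk => by
    have := (h1 t ht k).2 (by omega); linarith
  have hxp : ∀ t ≤ T, ∀ k, K < k → ζ + 1 < x k t := fun t ht k hk => by
    have := (h2 t ht k).1 (by omega); linarith
  have hxn : ∀ t ≤ T, ∀ k, k < -K → x k t < ζ := fun t ht k hk => by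
    have := (h2 t ht k).2 (by omega); linarith
  -- Continuous functions approaching the indicator of `(ζ, ∞)`, all constant outside the zone from
  -- `ζ` to `ζ + 1`, which labels beyond `K` avoid.
  set φ : ℕ → ℝ → ℝ := fun n y => max 0 (min 1 ((n + 1) * (y - ζ))) with hφ
  have hφ0 : ∀ n y, y ≤ ζ → φ n y = 0 := fun n y hy => by
    simp only [hφ]
    refine max_eq_left ((min_le_right _ _).trans ?_)
    exact mul_nonpos_of_nonneg_of_nonpos (by positivity) (by linarith)
  have hφ1 : ∀ n y, ζ + 1 ≤ y → φ n y = 1 := fun n y hy => by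
    simp only [hφ]
    rw [min_eq_left, max_eq_right zero_le_one]
    nlinarith [(Nat.cast_nonneg n : (0 : ℝ) ≤ n)]
  have hφlim : ∀ y, Tendsto (fun n => φ n y) atTop (𝓝 (if ζ < y then 1 else 0)) := by
    intro y
    split_ifs with hy
    · refine tendsto_const_nhds.congr' ?_
      have h3 := (tendsto_natCast_atTop_atTop (R := ℝ)).eventually_ge_atTop (y - ζ)⁻¹
      filter_upwards [h3] with n hn
      simp only [hφ]
      have h4 : (0 : ℝ) < y - ζ := sub_pos.2 hy
      have h5 : 1 ≤ (n : ℝ) * (y - ζ) := by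
        rwa [inv_le_iff_one_le_mul₀ h4] at hn
      rw [min_eq_left (by nlinarith), max_eq_right zero_le_one]
    · simp only [hφ0 _ y (not_lt.1 hy)]
      exact tendsto_const_nhds
  have hsum : ∑ k ∈ Finset.Icc (-K) K, (if ζ < x k t then (1 : ℝ) else 0) =
      ∑ k ∈ Finset.Icc (-K) K, (if ζ < z k t then (1 : ℝ) else 0) := by
    refine tendsto_nhds_unique (tendsto_finsetSum (f := fun k n => φ n (x k t)) _
      fun k _ => hφlim (x k t)) ?_
    refine (tendsto_finsetSum (f := fun k n => φ n (z k t)) _ fun k _ => hφlim (z k t)).congr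
      fun n => ?_
    refine (sum_relabel_eq h0 hxc hzc hπ (by fun_prop) (fun t ht k hk => ?_)
      (fun t ht k hk => ?_) ht).symm
    · rw [Finset.mem_Icc, not_and_or, not_le, not_le] at hk
      rcases hk with h | h
      · exact Or.inl (hφ0 n _ (hxn t ht k h).le)
      · exact Or.inr (hφ1 n _ (hxp t ht k h).le)
    · rw [Finset.mem_Icc, not_and_or, not_le, not_le] at hk
      rcases hk with h | h
      · exact Or.inl (hφ0 n _ (hzn t ht k h).le)
      · exact Or.inr (hφ1 n _ (hzp t ht k h).le)
  have hex : excess (fun k => z k t) ζ = ∑ k ∈ Finset.Icc (-K) K,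
      ((if ζ < x k t then 1 else 0) - (if 0 < k then 1 else 0)) := by
    rw [excess_eq_sum (K := K) (fun k hk => by linarith [hzp t ht k hk])
      (fun k hk => (hzn t ht k hk).le) hK0, Finset.sum_sub_distrib, Finset.sum_sub_distrib, hsum]
  rw [hex]
  constructor
  · intro hlt
    -- By order every positive label is beyond `ζ` and cancels its reference term, so the tracer
    -- itself contributes the one.
    have h3 : ∀ k ∈ Finset.Icc (-K) K, (if k = 0 then (1 : ℝ) else 0) ≤
        (if ζ < x k t then 1 else 0) - (if 0 < k then 1 else 0) := by
      intro k _
      rcases lt_trichotomy k 0 with hk | rfl | hk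
      · rw [if_neg hk.ne, if_neg (not_lt.2 hk.le), sub_zero]
        split_ifs <;> norm_num
      · simp [hlt]
      · have : ζ < x k t := hlt.trans_le (hx t hk.le)
        simp [hk.ne', hk, this]
    have h4 := Finset.sum_le_sum h3
    rw [Finset.sum_ite_eq', if_pos (Finset.mem_Icc.2 ⟨by omega, hK0⟩)] at h4
    exact h4
  · intro hle
    refine Finset.sum_nonpos fun k _ => ?_
    rcases le_or_gt k 0 with hk | hk
    · have : ¬ ζ < x k t := not_lt.2 ((hx t hk).trans hle)
      simp [this, not_lt.2 hk]
    · rw [if_pos hk]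
      split_ifs <;> norm_num

end SingleFile

/-! ### Sorted free paths and the tracer criterion -/

namespace SingleFile

/-- For all but finitely many labels the roughness is at most `1 + y ^ 2`. The threshold `a = ε *
√(1 + y ^ 2)`, with `ε` making `|c| * (10 * ε) ≤ 1 / 2`, then bounds the displacement by half of
`|y|` plus a constant, which a distant particle cannot use to reach the window. -/
lemma isSortedAtInfinity_of_roughness {y : ℤ → ℝ} {w : ℤ → ℝ≥0 → ℝ} {T : ℝ≥0}
    (hw : ∀ k, Continuous (w k)) (hw0 : ∀ k, w k 0 = 0)
    (hy : Summable fun k => (1 + (y k) ^ 2)⁻¹)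
    (hord : ∀ k, (k ≤ 0 → y k ≤ 0) ∧ (0 ≤ k → 0 ≤ y k))
    (hR : ∑' k, roughness T (w k) * ENNReal.ofReal ((1 + (y k) ^ 2)⁻¹) ≠ ∞) (c : ℝ) :
    IsSortedAtInfinity T fun k t => y k + c * w k t := by
  intro M
  set ε : ℝ := 1 / (20 * (|c| + 1)) with hε
  have hε0 : 0 < ε := by positivity
  have hcε : |c| * (10 * ε) ≤ 1 / 2 := by
    rw [hε]
    have : |c| * (10 * (1 / (20 * (|c| + 1)))) = |c| / (|c| + 1) / 2 := by
      field_simp; ring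
    rw [this]
    have h2 : |c| / (|c| + 1) ≤ 1 := (div_le_one (by positivity)).2 (by linarith)
    linarith
  set N : ℝ := 2 * (|M| + 1 + |c| / ε ^ 3) with hN
  have hN0 : 0 ≤ N := by positivity
  have h1 : ∀ᶠ k in cofinite, N < |y k| := by
    have := hy.tendsto_cofinite_zero.eventually
      (gt_mem_nhds (show (0 : ℝ) < (1 + N ^ 2)⁻¹ by positivity))
    filter_upwards [this] with k hk
    rw [inv_lt_inv₀ (by positivity) (by positivity), add_lt_add_iff_left, ← sq_abs (y k)] at hk
    exact lt_of_pow_lt_pow_left₀ 2 (abs_nonneg _) hk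
  have h2 : ∀ᶠ k in cofinite, roughness T (w k) * ENNReal.ofReal ((1 + (y k) ^ 2)⁻¹) < 1 :=
    (ENNReal.tendsto_cofinite_zero_of_tsum_ne_top hR).eventually (gt_mem_nhds zero_lt_one)
  have h3 : ∀ᶠ k in cofinite, ∀ t ≤ T, |c * w k t| < |y k| - |M| := by
    filter_upwards [h1, h2] with k hk1 hk2 t ht
    have hpos : (0 : ℝ) < 1 + (y k) ^ 2 := by positivity
    have hne : roughness T (w k) ≠ ∞ := by
      intro h
      rw [h, ENNReal.top_mul (by simpa using hpos)] at hk2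
      exact absurd hk2 (by simp)
    have hle : (roughness T (w k)).toReal ≤ 1 + (y k) ^ 2 := by
      have := (ENNReal.toReal_lt_toReal hk2.ne_top ENNReal.one_ne_top).2 hk2
      rw [ENNReal.toReal_mul, ENNReal.toReal_ofReal (by positivity), ENNReal.toReal_one,
        ← div_eq_mul_inv, div_lt_one hpos] at this
      exact this.le
    set s := √(1 + (y k) ^ 2) with hs
    have hs2 : s ^ 2 = 1 + (y k) ^ 2 := Real.sq_sqrt hpos.le
    have hs1 : 1 ≤ s := Real.one_le_sqrt.2 (by nlinarith [sq_nonneg (y k)])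
    have hsy : s ≤ 1 + |y k| := by
      refine Real.sqrt_le_iff.2 ⟨by positivity, ?_⟩
      nlinarith [sq_abs (y k), abs_nonneg (y k)]
    have h4 := abs_le_of_roughness (hw k) (hw0 k) hne (a := ε * s) (by positivity) ht
    have h5 : (roughness T (w k)).toReal / (ε * s) ^ 3 ≤ 1 / ε ^ 3 := by
      rw [div_le_div_iff₀ (by positivity) (by positivity), one_mul, mul_pow, mul_comm]
      gcongr
      calc _ ≤ s ^ 2 := by rw [hs2]; exact hle
        _ ≤ s ^ 3 := pow_le_pow_right₀ hs1 (by norm_num)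
    have h6 : |w k t| ≤ 10 * ε * (1 + |y k|) + 1 / ε ^ 3 := by
      refine h4.trans (add_le_add ?_ h5)
      rw [mul_assoc]
      gcongr
    rw [abs_mul]
    have h7 : |c| * |w k t| ≤ |c| * (10 * ε) * (1 + |y k|) + |c| / ε ^ 3 := by
      refine (mul_le_mul_of_nonneg_left h6 (abs_nonneg c)).trans (le_of_eq ?_)
      ring
    have h8 : |c| * (10 * ε) * (1 + |y k|) ≤ 1 / 2 * (1 + |y k|) := by gcongr
    rw [hN] at hk1
    linarith
  rw [Int.cofinite_eq, eventually_sup] at h3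
  obtain ⟨a, ha⟩ := eventually_atBot.1 h3.1
  obtain ⟨b, hb⟩ := eventually_atTop.1 h3.2
  have hM1 := le_abs_self M
  refine ⟨max |a| |b|, le_max_of_le_left (abs_nonneg _), fun t ht k => ⟨fun hk => ?_, fun hk => ?_⟩⟩
  · have hk0 : 0 ≤ k ∧ b ≤ k := by
      have := abs_nonneg b; have := le_abs_self b; have := le_max_right |a| |b|; omega
    have h4 := hb k hk0.2 t ht
    rw [abs_of_nonneg ((hord k).2 hk0.1)] at h4
    have := (abs_lt.1 h4).1
    linarith
  · have hk0 : k ≤ 0 ∧ k ≤ a := by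
      have := abs_nonneg a; have := neg_abs_le a; have := le_max_left |a| |b|; omega
    have h4 := ha k hk0.2 t ht
    rw [abs_of_nonpos ((hord k).1 hk0.1)] at h4
    have := (abs_lt.1 h4).2
    linarith

section

variable {Ω : Type*} [MeasurableSpace Ω] {P : Measure Ω} {σ : ℝ} {Y : ℤ → Ω → ℝ}
  {W X : ℤ → ℝ≥0 → Ω → ℝ}

/-- Noise and initial positions are independent, so the expected roughness weighted by `(1 + Y ^
2)⁻¹` factorises label by label and has a finite sum. -/
lemma IsSingleFile.ae_isSortedAtInfinity (hX : IsSingleFile P σ Y W X)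
    (hord : ∀ᵐ ω ∂P, ∀ k, (k ≤ 0 → Y k ω ≤ 0) ∧ (0 ≤ k → 0 ≤ Y k ω)) (hE : HasExpMoments P Y)
    (T : ℝ≥0) (c : ℝ) :
    ∀ᵐ ω ∂P, IsSortedAtInfinity T fun k t => Y k ω + c * W k t ω := by
  have hmW : ∀ k, Measurable fun ω => (fun t => W k t ω) := fun k =>
    measurable_pi_lambda _ (hX.measurable_noise k)
  have hmR : ∀ k, Measurable fun ω => roughness T (fun t => W k t ω) := fun k =>
    (measurable_roughness T).comp (hmW k)
  have hmY := HasExpMoments.measurable_inv_one_add_sq hX.measurable_init 1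
  obtain ⟨C, hC, hCW⟩ := exists_lintegral_roughness_le T
  obtain ⟨D, hD, hDY⟩ := hE.exists_tsum_lintegral_le hX.measurable_init one_pos
  have hmRY : ∀ k, Measurable fun ω => roughness T (fun t => W k t ω) *
      ENNReal.ofReal ((1 + (Y k ω / 1) ^ 2)⁻¹) := fun k => (hmR k).mul (hmY k)
  have hfin : ∫⁻ ω, ∑' k, roughness T (fun t => W k t ω) *
      ENNReal.ofReal ((1 + (Y k ω / 1) ^ 2)⁻¹) ∂P ≤ C * D := by
    rw [lintegral_tsum fun k => (hmRY k).aemeasurable]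
    refine le_trans ?_ (mul_le_mul_right hDY C)
    rw [← ENNReal.tsum_mul_left]
    refine ENNReal.tsum_le_tsum fun k => ?_
    have hind : IndepFun (fun ω => roughness T (fun t => W k t ω))
        (fun ω => ENNReal.ofReal ((1 + (Y k ω / 1) ^ 2)⁻¹)) P :=
      (hX.indep_init.comp (φ := fun y : ℤ → ℝ => ENNReal.ofReal ((1 + (y k / 1) ^ 2)⁻¹))
        (ψ := fun w : ℤ → ℝ≥0 → ℝ => roughness T (w k))
        (HasExpMoments.measurable_inv_one_add_sq
          (Y := fun k (y : ℤ → ℝ) => y k) measurable_pi_apply 1 k)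
        ((measurable_roughness T).comp (measurable_pi_apply k))).symm
    have := lintegral_mul_eq_lintegral_mul_lintegral_of_indepFun (hmR k) (hmY k) hind
    simp only [Pi.mul_apply] at this
    rw [this]
    gcongr
    exact hCW (hX.brownian k).toIsPreBrownianReal (hX.measurable_noise k)
  have hsum := hE.ae_summable hX.measurable_init one_pos
  have hlt := ae_lt_top (Measurable.tsum hmRY)
    (hfin.trans_lt (ENNReal.mul_lt_top hC.lt_top hD.lt_top)).ne
  have hc : ∀ᵐ ω ∂P, ∀ k, Continuous fun t => W k t ω :=
    ae_all_iff.2 fun k => (hX.brownian k).cont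
  have h0 : ∀ᵐ ω ∂P, ∀ k, W k 0 ω = 0 :=
    ae_all_iff.2 fun k => (hX.brownian k).eval_zero_ae_eq_zero
  filter_upwards [hord, hsum, hlt, hc, h0] with ω h1 h2 h3 h4 h5
  simp only [div_one] at h2 h3
  exact isSortedAtInfinity_of_roughness h4 h5 h2 h1 h3.ne c

/-- The tracer is beyond `ζ` at time `t` if and only if the excess of free particles beyond `ζ` is
positive. -/
lemma IsSingleFile.ae_excess_free (hX : IsSingleFile P σ Y W X)
    (hord : ∀ᵐ ω ∂P, ∀ k, (k ≤ 0 → Y k ω ≤ 0) ∧ (0 ≤ k → 0 ≤ Y k ω)) (hE : HasExpMoments P Y)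
    (t : ℝ≥0) :
    ∀ᵐ ω ∂P, IsSortedAtInfinity t (fun k t => Y k ω + σ / √2 * W k t ω) ∧ ∀ ζ,
      (ζ < X 0 t ω → 1 ≤ excess (fun k => Y k ω + σ / √2 * W k t ω) ζ) ∧
      (X 0 t ω ≤ ζ → excess (fun k => Y k ω + σ / √2 * W k t ω) ζ ≤ 0) := by
  have hc : ∀ᵐ ω ∂P, ∀ k, Continuous fun t => W k t ω :=
    ae_all_iff.2 fun k => (hX.brownian k).cont
  have h0 : ∀ᵐ ω ∂P, ∀ k, W k 0 ω = 0 :=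
    ae_all_iff.2 fun k => (hX.brownian k).eval_zero_ae_eq_zero
  filter_upwards [hX.ae_isSortedAtInfinity hord hE t (σ / √2), hX.start, hX.continuous_path,
    hX.ordered, hX.relabel, hc, h0] with ω h1 h2 h3 h4 h5 h6 h7
  refine ⟨h1, fun ζ => ?_⟩
  exact excess_free (x := fun k t => X k t ω) (z := fun k t => Y k ω + σ / √2 * W k t ω) h1
    (fun k => by rw [h2, h7, mul_zero, add_zero]) h3
    (fun k => (((h6 k).const_mul _).const_add _)) h4 h5 le_rfl ζ

end

end SingleFile

namespace SingleFile

/-! ### Independent displacements -/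

section Independent

variable {Ω : Type*} [MeasurableSpace Ω] {P : Measure Ω} {Y : ℤ → Ω → ℝ} {D : ℤ → Ω → ℝ × ℝ}
  {m : Measure (ℝ × ℝ)}

/-- The displacements `D k` are independent of each other, and of `Y`, with common law `m`. -/
structure HasIndepDisplacements (P : Measure Ω) (Y : ℤ → Ω → ℝ) (D : ℤ → Ω → ℝ × ℝ)
    (m : Measure (ℝ × ℝ)) : Prop where
  measurable_init : ∀ k, Measurable (Y k)
  measurable : ∀ k, Measurable (D k)
  law : ∀ k, P.map (D k) = m
  iIndepFun : iIndepFun D P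
  indepFun : IndepFun (fun ω k => Y k ω) (fun ω k => D k ω) P

/-- Condition on the initial positions by Tonelli's theorem, then use independence of the
displacements. -/
lemma HasIndepDisplacements.lintegral_prod_eq [IsProbabilityMeasure P]
    (h : HasIndepDisplacements P Y D m) {g : ℤ → ℝ → ℝ × ℝ → ℝ≥0∞}
    (hg : ∀ k, Measurable (Function.uncurry (g k))) (S : Finset ℤ) :
    ∫⁻ ω, ∏ k ∈ S, g k (Y k ω) (D k ω) ∂P =
      ∫⁻ ω, ∏ k ∈ S, ∫⁻ u, g k (Y k ω) u ∂m ∂P := by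
  have hYm : Measurable fun ω k => Y k ω := measurable_pi_lambda _ h.measurable_init
  have hDm : Measurable fun ω k => D k ω := measurable_pi_lambda _ h.measurable
  have hFm : Measurable fun p : (ℤ → ℝ) × (ℤ → ℝ × ℝ) => ∏ k ∈ S, g k (p.1 k) (p.2 k) := by
    refine Finset.measurable_fun_prod _ fun k _ => ?_
    have h1 : Measurable fun p : (ℤ → ℝ) × (ℤ → ℝ × ℝ) => (p.1 k, p.2 k) :=
      ((measurable_pi_apply k).comp measurable_fst).prodMk
        ((measurable_pi_apply k).comp measurable_snd)
    exact (hg k).comp h1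
  have hgk : ∀ k y, Measurable (g k y) := fun k y => (hg k).comp measurable_prodMk_left
  have hlaw := (indepFun_iff_map_prod_eq_prod_map_map hYm.aemeasurable
    hDm.aemeasurable).1 h.indepFun
  have : IsProbabilityMeasure (P.map fun ω k => D k ω) :=
    Measure.isProbabilityMeasure_map hDm.aemeasurable
  have : IsProbabilityMeasure m := by
    rw [← h.law 0]; exact Measure.isProbabilityMeasure_map (h.measurable 0).aemeasurable
  calc ∫⁻ ω, ∏ k ∈ S, g k (Y k ω) (D k ω) ∂P
      = ∫⁻ p, ∏ k ∈ S, g k (p.1 k) (p.2 k) ∂(P.map fun ω => (fun k => Y k ω, fun k => D k ω)) := by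
        rw [lintegral_map hFm (hYm.prodMk hDm)]
    _ = ∫⁻ y, ∫⁻ d, ∏ k ∈ S, g k (y k) (d k) ∂(P.map fun ω k => D k ω)
          ∂(P.map fun ω k => Y k ω) := by
        rw [hlaw, lintegral_prod _ hFm.aemeasurable]
    _ = ∫⁻ y, ∏ k ∈ S, ∫⁻ u, g k (y k) u ∂m ∂(P.map fun ω k => Y k ω) := by
        refine lintegral_congr fun y => ?_
        have h2 : Measurable fun d : ℤ → ℝ × ℝ => ∏ k ∈ S, g k (y k) (d k) :=
          hFm.comp measurable_prodMk_left
        rw [lintegral_map h2 hDm,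
          lintegral_prod_eq_prod_lintegral_of_indepFun S (fun k ω => g k (y k) (D k ω))
            (h.iIndepFun.comp (fun k => g k (y k)) fun k => hgk k _)
            fun k => (hgk k _).comp (h.measurable k)]
        refine Finset.prod_congr rfl fun k _ => ?_
        rw [← h.law k, lintegral_map (hgk k _) (h.measurable k)]
    _ = ∫⁻ ω, ∏ k ∈ S, ∫⁻ u, g k (Y k ω) u ∂m ∂P := by
        rw [lintegral_map _ hYm]
        refine Finset.measurable_fun_prod _ fun k _ => ?_
        exact (Measurable.lintegral_prod_right' (hg k)).comp (measurable_pi_apply k)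

end Independent

/-! ### Displacements of Brownian particles -/

section Brownian

variable {Ω : Type*} [MeasurableSpace Ω] {P : Measure Ω} {σ : ℝ} {τ₁ τ₂ : ℝ≥0}

lemma map_pair_eq_displacementLaw [IsProbabilityMeasure P] {B : ℝ≥0 → Ω → ℝ}
    (hB : IsPreBrownianReal B P)
    (hm : ∀ t, Measurable (B t)) (hτ : τ₁ ≤ τ₂) :
    P.map (fun ω => (σ / √2 * B τ₁ ω, σ / √2 * B τ₂ ω)) = displacementLaw σ τ₁ τ₂ := by
  set c := σ / √2 with hc
  have hind : IndepFun (B τ₁) (B τ₂ - B τ₁) P :=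
    hB.hasIndepIncrements.indepFun_eval_sub zero_le hτ hB.eval_zero_ae_eq_zero
  have h1 : P.map (fun ω => (B τ₁ ω, (B τ₂ - B τ₁) ω)) =
      (gaussianReal 0 τ₁).prod (gaussianReal 0 (τ₂ - τ₁)) := by
    rw [(indepFun_iff_map_prod_eq_prod_map_map (hm _).aemeasurable
      ((hm _).sub (hm _)).aemeasurable).1 hind, (hB.hasLaw_eval τ₁).map_eq,
      (hB.hasLaw_sub τ₂ τ₁).map_eq]
    congr 2
    ext
    rw [NNReal.coe_sub hτ]
    change |(τ₂ : ℝ) - τ₁| = _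
    exact abs_of_nonneg (sub_nonneg.2 (by exact_mod_cast hτ))
  have hc2 : ∀ v : ℝ≥0, (gaussianReal 0 v).map (c * ·) =
      gaussianReal 0 (Real.toNNReal (σ ^ 2 / 2) * v) := by
    intro v
    rw [gaussianReal_map_const_mul, mul_zero]
    congr 2
    ext
    rw [Real.coe_toNNReal _ (by positivity)]
    change c ^ 2 = _
    rw [hc, div_pow, Real.sq_sqrt (by norm_num)]
  have hcm : Measurable (c * · : ℝ → ℝ) := measurable_const_mul c
  rw [displacementLaw, gaussianPair, ← hc2, ← hc2, Measure.map_prod_map _ _ hcm hcm, ← h1,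
    Measure.map_map measurable_shear (hcm.prodMap hcm), Measure.map_map
      (measurable_shear.comp (hcm.prodMap hcm)) ((hm _).prodMk ((hm _).sub (hm _)))]
  congr 1
  funext ω
  simp only [Function.comp, Prod.map, Pi.sub_apply]
  congr 1
  ring

/-- The rescaled displacements of the free particles at the two times. -/
noncomputable def displacement (σ : ℝ) (τ₁ τ₂ : ℝ≥0) (W : ℤ → ℝ≥0 → Ω → ℝ) (t : ℝ≥0) (k : ℤ)
    (ω : Ω) : ℝ × ℝ :=
  (σ / √2 * W k (τ₁ * t) ω / √(t : ℝ), σ / √2 * W k (τ₂ * t) ω / √(t : ℝ))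

lemma IsSingleFile.hasIndepDisplacements [IsProbabilityMeasure P] {Y : ℤ → Ω → ℝ}
    {W X : ℤ → ℝ≥0 → Ω → ℝ} (hX : IsSingleFile P σ Y W X) (hτ : τ₁ ≤ τ₂) {t : ℝ≥0} (ht : 0 < t) :
    HasIndepDisplacements P (fun k ω => Y k ω / √(t : ℝ)) (displacement σ τ₁ τ₂ W t)
      (displacementLaw σ τ₁ τ₂) := by
  have hg : Measurable fun w : ℝ≥0 → ℝ =>
      (σ / √2 * w (τ₁ * t) / √(t : ℝ), σ / √2 * w (τ₂ * t) / √(t : ℝ)) :=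
    (((measurable_pi_apply _).const_mul _).div_const _).prodMk
      (((measurable_pi_apply _).const_mul _).div_const _)
  refine ⟨fun k => (hX.measurable_init k).div_const _, fun k => ?_, fun k => ?_, ?_, ?_⟩
  · exact hg.comp (measurable_pi_lambda _ (hX.measurable_noise k))
  -- Brownian scaling: the law of the rescaled displacements does not depend on `t`.
  · have hB := (hX.brownian k).toIsPreBrownianReal.smul ht.ne'
    rw [← map_pair_eq_displacementLaw hB (fun s => (hX.measurable_noise k _).const_mul _) hτ]
    congr 1
    funext ω
    simp only [displacement, mul_comm t]
    congr 1 <;> ring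
  · exact hX.indep_noise.comp _ fun _ => hg
  · exact hX.indep_init.comp (φ := fun (y : ℤ → ℝ) k => y k / √(t : ℝ))
      (ψ := fun (w : ℤ → ℝ≥0 → ℝ) k =>
        (σ / √2 * w k (τ₁ * t) / √(t : ℝ), σ / √2 * w k (τ₂ * t) / √(t : ℝ)))
      (measurable_pi_lambda _ fun k => (measurable_pi_apply k).div_const _)
      (measurable_pi_lambda _ fun k => hg.comp (measurable_pi_apply k))

end Brownian

end SingleFile

namespace SingleFile

/-! ### Step observables of the free particles -/

/-- A bounded observable of the positions at the two times which vanishes far to the left, takes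
the value `c` far to the right, and is almost surely continuous under the displacement laws. -/
structure IsStep (Θ : ℝ × ℝ → ℝ) (c : ℝ) : Prop where
  measurable : Measurable Θ
  bound : ∃ A, ∀ v, |Θ v| ≤ A
  tails : ∃ M, 0 ≤ M ∧ ∀ v : ℝ × ℝ,
    (v.1 < -M → v.2 < -M → Θ v = 0) ∧ (M < v.1 → M < v.2 → Θ v = c)
  continuousAt : ∀ m, IsDisplacementLaw m → ∀ y : ℝ, ∀ᵐ u ∂m, ContinuousAt Θ (y + u.1, y + u.2)

/-- The sum of the observable `Θ` over all particles, relative to its value when the particles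
have not moved across the origin. -/
noncomputable def relSum (Θ : ℝ × ℝ → ℝ) (c : ℝ) (v : ℤ → ℝ × ℝ) : ℝ :=
  ∑' k, (Θ (v k) - c * (if 0 < k then 1 else 0))

/-- The exponent of a particle started at `y`. -/
noncomputable def stepExponent (Θ : ℝ × ℝ → ℝ) (c y : ℝ) (u : ℝ × ℝ) : ℝ :=
  Θ (y + u.1, y + u.2) - c * (if 0 < y then 1 else 0)

/-- Logarithmic one-particle generating function. -/
noncomputable def logMean (m : Measure (ℝ × ℝ)) (Θ : ℝ × ℝ → ℝ) (y : ℝ) : ℝ :=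
  Real.log (∫ u, Real.exp (Θ (y + u.1, y + u.2)) ∂m)

lemma isLocal_near {M : ℝ} (hM : 0 ≤ M) : IsLocal (near M) :=
  ⟨measurable_near M, 1, M, zero_le_one, hM, fun y u => by
    rw [one_mul, abs_of_nonneg (near_nonneg M y u)]⟩

lemma isStep_indicator {π : ℝ × ℝ → ℝ} (hπ : IsCoord π) (ζ : ℝ) :
    IsStep (fun v => if ζ < π v then 1 else 0) 1 where
  measurable := Measurable.ite (measurableSet_lt measurable_const hπ.continuous.measurable)
    measurable_const measurable_const
  bound := ⟨1, fun v => by split_ifs <;> norm_num⟩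
  tails := by
    refine ⟨|ζ|, abs_nonneg _, fun v => ?_⟩
    have h1 := le_abs_self ζ
    have h2 := neg_abs_le ζ
    rcases hπ with rfl | rfl
    · exact ⟨fun h _ => if_neg (by linarith), fun h _ => if_pos (by linarith)⟩
    · exact ⟨fun _ h => if_neg (by linarith), fun _ h => if_pos (by linarith)⟩
  continuousAt m hm y := by
    have h : ∀ᵐ u ∂m, π (y + u.1, y + u.2) ≠ ζ := by
      rcases hπ with rfl | rfl
      · filter_upwards [hm.fst_ne (ζ - y)] with u hu h
        exact hu (eq_sub_of_add_eq' h)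
      · filter_upwards [hm.snd_ne (ζ - y)] with u hu h
        exact hu (eq_sub_of_add_eq' h)
    filter_upwards [h] with u hu
    rcases lt_or_gt_of_ne hu with h | h
    · refine ContinuousAt.congr (f := fun _ => (0 : ℝ)) continuousAt_const ?_
      filter_upwards [hπ.continuous.continuousAt.eventually (gt_mem_nhds h)] with v hv
      exact (if_neg (not_lt.2 hv.le)).symm
    · refine ContinuousAt.congr (f := fun _ => (1 : ℝ)) continuousAt_const ?_
      filter_upwards [hπ.continuous.continuousAt.eventually (lt_mem_nhds h)] with v hv
      exact (if_pos hv).symm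

namespace IsStep

variable {Θ Θ' : ℝ × ℝ → ℝ} {c c' : ℝ}

lemma add (h : IsStep Θ c) (h' : IsStep Θ' c') : IsStep (fun v => Θ v + Θ' v) (c + c') where
  measurable := h.measurable.add h'.measurable
  bound := by
    obtain ⟨A, hA⟩ := h.bound
    obtain ⟨A', hA'⟩ := h'.bound
    exact ⟨A + A', fun v => (abs_add_le _ _).trans (add_le_add (hA v) (hA' v))⟩
  tails := by
    obtain ⟨M, hM, ht⟩ := h.tails
    obtain ⟨M', hM', ht'⟩ := h'.tails
    refine ⟨max M M', le_max_of_le_left hM, fun v => ⟨fun h1 h2 => ?_, fun h1 h2 => ?_⟩⟩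
    · have e1 := le_max_left M M'
      have e2 := le_max_right M M'
      rw [(ht v).1 (by linarith) (by linarith), (ht' v).1 (by linarith) (by linarith), add_zero]
    · have e1 := le_max_left M M'
      have e2 := le_max_right M M'
      rw [(ht v).2 (by linarith) (by linarith), (ht' v).2 (by linarith) (by linarith)]
  continuousAt m hm y := by
    filter_upwards [h.continuousAt m hm y, h'.continuousAt m hm y] with u h1 h2
    exact h1.add h2

lemma const_mul (h : IsStep Θ c) (b : ℝ) : IsStep (fun v => b * Θ v) (b * c) where
  measurable := h.measurable.const_mul b
  bound := by
    obtain ⟨A, hA⟩ := h.bound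
    exact ⟨|b| * A, fun v => by rw [abs_mul]; exact mul_le_mul_of_nonneg_left (hA v) (abs_nonneg b)⟩
  tails := by
    obtain ⟨M, hM, ht⟩ := h.tails
    exact ⟨M, hM, fun v => ⟨fun h1 h2 => by rw [(ht v).1 h1 h2, mul_zero],
      fun h1 h2 => by rw [(ht v).2 h1 h2]⟩⟩
  continuousAt m hm y := by
    filter_upwards [h.continuousAt m hm y] with u h1
    exact h1.const_mul b

/-- The proposition `b` stands for `0 < y` in the pressure and for `0 < k` in the particle sum.
Position and label may disagree about the side only at the origin, where both choices are allowed.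
-/
lemma exists_abs_le (h : IsStep Θ c) : ∃ A M, 0 ≤ A ∧ 0 ≤ M ∧ ∀ (b : Prop) [Decidable b] (y : ℝ)
    (u : ℝ × ℝ), (b → 0 ≤ y) → (¬ b → y ≤ 0) →
      |Θ (y + u.1, y + u.2) - c * (if b then 1 else 0)| ≤ A * near M y u := by
  obtain ⟨A, hA⟩ := h.bound
  obtain ⟨M, hM, ht⟩ := h.tails
  have hA0 : 0 ≤ A := (abs_nonneg _).trans (hA 0)
  refine ⟨A + |c|, M, by positivity, hM, fun b _ y u h1 h2 => ?_⟩
  have hu1 := (abs_le.1 (norm_fst_le u))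
  have hu2 := (abs_le.1 (norm_snd_le u))
  unfold near
  by_cases hn : |y| ≤ ‖u‖ + M
  · rw [if_pos hn, mul_one]
    refine (abs_sub _ _).trans (add_le_add (hA _) ?_)
    rw [abs_mul]
    refine mul_le_of_le_one_right (abs_nonneg c) ?_
    split_ifs <;> norm_num
  · rw [if_neg hn, mul_zero, abs_nonpos_iff]
    rw [not_le] at hn
    by_cases hb : b
    · rw [abs_of_nonneg (h1 hb)] at hn
      rw [if_pos hb, (ht _).2 (by simp only; linarith) (by simp only; linarith)]
      ring
    · rw [abs_of_nonpos (h2 hb)] at hn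
      rw [if_neg hb, (ht _).1 (by simp only; linarith) (by simp only; linarith)]
      ring

lemma isLocal (h : IsStep Θ c) : IsLocal (stepExponent Θ c) := by
  obtain ⟨A, M, hA, hM, hb⟩ := h.exists_abs_le
  refine ⟨?_, A, M, hA, hM, fun y u => hb (0 < y) y u (fun h => h.le) fun h => not_lt.1 h⟩
  have h1 : Measurable fun p : ℝ × ℝ × ℝ => Θ (p.1 + p.2.1, p.1 + p.2.2) :=
    h.measurable.comp (by fun_prop)
  have h2 : Measurable fun p : ℝ × ℝ × ℝ => c * (if 0 < p.1 then (1 : ℝ) else 0) :=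
    (Measurable.ite (measurableSet_lt measurable_const measurable_fst) measurable_const
      measurable_const).const_mul c
  exact h1.sub h2

variable {m : Measure (ℝ × ℝ)}

lemma integrable_exp (h : IsStep Θ c) (hm : IsDisplacementLaw m) (y : ℝ) :
    Integrable (fun u : ℝ × ℝ => Real.exp (Θ (y + u.1, y + u.2))) m := by
  have := hm.isProbabilityMeasure
  obtain ⟨A, hA⟩ := h.bound
  have hme : Measurable fun u : ℝ × ℝ => Real.exp (Θ (y + u.1, y + u.2)) :=
    Real.measurable_exp.comp (h.measurable.comp (by fun_prop))
  refine Integrable.of_bound hme.aestronglyMeasurable (Real.exp A)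
    (Eventually.of_forall fun u => ?_)
  rw [Real.norm_eq_abs, Real.abs_exp]
  exact Real.exp_le_exp.2 ((le_abs_self _).trans (hA _))

lemma exp_logMean (h : IsStep Θ c) (hm : IsDisplacementLaw m) (y : ℝ) :
    Real.exp (logMean m Θ y) = ∫ u : ℝ × ℝ, Real.exp (Θ (y + u.1, y + u.2)) ∂m := by
  have := hm.isProbabilityMeasure
  exact Real.exp_log (integral_exp_pos (h.integrable_exp hm y))

/-- `Θ` jumps, but averaging over displacements smooths the jumps; continuity is what the limit in
`IsInitialProfile` demands of its profiles. -/
lemma continuous_logMean (h : IsStep Θ c) (hm : IsDisplacementLaw m) :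
    Continuous (logMean m Θ) := by
  have := hm.isProbabilityMeasure
  obtain ⟨A, hA⟩ := h.bound
  have hc : Continuous fun y => ∫ u : ℝ × ℝ, Real.exp (Θ (y + u.1, y + u.2)) ∂m := by
    refine continuous_iff_continuousAt.2 fun y => ?_
    refine tendsto_integral_filter_of_dominated_convergence (fun _ => Real.exp A)
      (Eventually.of_forall fun z => (h.integrable_exp hm z).aestronglyMeasurable)
      (Eventually.of_forall fun z => Eventually.of_forall fun u => ?_) (integrable_const _) ?_
    · rw [Real.norm_eq_abs, Real.abs_exp]
      exact Real.exp_le_exp.2 ((le_abs_self _).trans (hA _))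
    · filter_upwards [h.continuousAt m hm y] with u hu
      have h1 : Tendsto (fun z : ℝ => (z + u.1, z + u.2)) (𝓝 y) (𝓝 (y + u.1, y + u.2)) :=
        Continuous.tendsto (by fun_prop) y
      exact (Real.continuous_exp.tendsto _).comp (hu.tendsto.comp h1)
  exact hc.log fun y => (integral_exp_pos (h.integrable_exp hm y)).ne'

lemma expMean_stepExponent (h : IsStep Θ c) (hm : IsDisplacementLaw m) (y : ℝ) :
    expMean m (stepExponent Θ c) y =
      Real.exp (logMean m Θ y - c * (if 0 < y then 1 else 0)) := by
  rw [Real.exp_sub, h.exp_logMean hm, ← integral_div]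
  exact integral_congr_ae (Eventually.of_forall fun u => Real.exp_sub _ _)

lemma exists_abs_logMean_le (h : IsStep Θ c) (hm : IsDisplacementLaw m) : ∃ K,
    (∀ y ≤ 0, |logMean m Θ y| ≤ K * (1 + y ^ 2)⁻¹) ∧
    ∀ y, 0 ≤ y → |logMean m Θ y - c| ≤ K * (1 + y ^ 2)⁻¹ := by
  obtain ⟨K, hK, hb⟩ := h.isLocal.abs_transform_le isRateTransform_log hm
  simp only [h.expMean_stepExponent hm, Real.log_exp] at hb
  have hpos : ∀ y, 0 < y → |logMean m Θ y - c| ≤ K * (1 + y ^ 2)⁻¹ := fun y hy => by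
    simpa [hy] using hb y
  refine ⟨K, fun y hy => by simpa [not_lt.2 hy] using hb y, fun y hy => ?_⟩
  rcases hy.eq_or_lt with rfl | hy
  -- At the origin `stepExponent` uses the left reference value, so the right bound is obtained
  -- there as a limit from the right.
  · have h1 : Tendsto (fun y => |logMean m Θ y - c|) (𝓝[>] 0) (𝓝 |logMean m Θ 0 - c|) :=
      (((h.continuous_logMean hm).sub continuous_const).abs.tendsto 0).mono_left nhdsWithin_le_nhds
    have h2 : Continuous fun y : ℝ => K * (1 + y ^ 2)⁻¹ :=
      continuous_const.mul ((by fun_prop : Continuous fun y : ℝ => 1 + y ^ 2).inv₀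
        fun y => by positivity)
    refine le_of_tendsto_of_tendsto h1 ((h2.tendsto 0).mono_left nhdsWithin_le_nhds) ?_
    filter_upwards [self_mem_nhdsWithin] with y hy
    exact hpos y hy
  · exact hpos y hy

lemma pressure_eq {ψ ψ' : ℝ → ℝ} (hψ : IsRateTransform ψ ψ') (h : IsStep Θ c)
    (hm : IsDisplacementLaw m) :
    pressure ψ m (stepExponent Θ c) = (∫ y in Set.Iic 0, ψ (Real.exp (logMean m Θ y))) +
      ∫ y in Set.Ioi 0, ψ (Real.exp (logMean m Θ y - c)) := by
  unfold pressure
  rw [← integral_add_compl (s := Set.Iic 0) measurableSet_Iic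
    (h.isLocal.integrable_transform hψ hm),
    Set.compl_Iic]
  congr 1
  · refine setIntegral_congr_fun measurableSet_Iic fun y hy => ?_
    simp only [h.expMean_stepExponent hm, if_neg (not_lt.2 (Set.mem_Iic.1 hy)), mul_zero, sub_zero]
  · refine setIntegral_congr_fun measurableSet_Ioi fun y hy => ?_
    simp only [h.expMean_stepExponent hm, if_pos (Set.mem_Ioi.1 hy), mul_one]

end IsStep

end SingleFile

namespace SingleFile

/-! ### Generating functions of the free particles -/

section

variable {Ω : Type*} [MeasurableSpace Ω] {P : Measure Ω} {V : ℤ → Ω → ℝ} {D : ℤ → Ω → ℝ × ℝ}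
  {m : Measure (ℝ × ℝ)}

lemma tendsto_Icc_neg_natCast : Tendsto (fun n : ℕ => Finset.Icc (-(n : ℤ)) n) atTop atTop := by
  refine tendsto_atTop_finset_of_monotone (fun a b hab => ?_) fun k => ⟨k.natAbs, ?_⟩
  · exact Finset.Icc_subset_Icc (by simpa using hab) (by simpa using hab)
  · rw [Finset.mem_Icc]; omega

lemma HasIndepDisplacements.lintegral_exp_sum_eq [IsProbabilityMeasure P]
    (hD : HasIndepDisplacements P V D m) {θ : ℤ → ℝ → ℝ × ℝ → ℝ}
    (hθ : ∀ k, Measurable (Function.uncurry (θ k))) {G : ℤ → ℝ → ℝ}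
    (hi : ∀ k y, Integrable (fun u => Real.exp (θ k y u)) m)
    (hG : ∀ k y, ∫ u, Real.exp (θ k y u) ∂m = Real.exp (G k y)) (S : Finset ℤ) :
    ∫⁻ ω, ENNReal.ofReal (Real.exp (∑ k ∈ S, θ k (V k ω) (D k ω))) ∂P =
      ∫⁻ ω, ENNReal.ofReal (Real.exp (∑ k ∈ S, G k (V k ω))) ∂P := by
  have e : ∀ (f : ℤ → ℝ), ENNReal.ofReal (Real.exp (∑ k ∈ S, f k)) =
      ∏ k ∈ S, ENNReal.ofReal (Real.exp (f k)) := fun f => by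
    rw [Real.exp_sum, ENNReal.ofReal_prod_of_nonneg fun k _ => (Real.exp_pos _).le]
  simp only [e]
  rw [hD.lintegral_prod_eq (g := fun k y u => ENNReal.ofReal (Real.exp (θ k y u)))
    fun k => ENNReal.measurable_ofReal.comp (Real.measurable_exp.comp (hθ k))]
  refine lintegral_congr fun ω => Finset.prod_congr rfl fun k _ => ?_
  rw [← hG, ofReal_integral_eq_lintegral_ofReal (hi k _)
    (Eventually.of_forall fun u => (Real.exp_pos _).le)]

/-- An almost surely finite envelope for the exponentials of local sums. -/
lemma HasIndepDisplacements.exists_envelope [IsProbabilityMeasure P]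
    (hD : HasIndepDisplacements P V D m) (hm : IsDisplacementLaw m) (hE : HasExpMoments P V)
    {A M : ℝ} (hA : 0 ≤ A) (hM : 0 ≤ M) :
    ∃ F : Ω → ℝ, Integrable F P ∧ ∀ᵐ ω ∂P, ∀ n : ℕ,
      Real.exp (∑ k ∈ Finset.Icc (-(n : ℤ)) n, A * near M (V k ω) (D k ω)) ≤ F ω := by
  have := hm.isProbabilityMeasure
  have hloc : IsLocal fun y u => A * near M y u := (isLocal_near hM).const_mul A
  obtain ⟨K, hK, hb⟩ := hloc.abs_transform_le isRateTransform_log hm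
  obtain ⟨D', hD', hS⟩ := hE K 1 hK one_pos
  have hmeas : ∀ n : ℕ, Measurable fun ω => ENNReal.ofReal (Real.exp
      (∑ k ∈ Finset.Icc (-(n : ℤ)) n, A * near M (V k ω) (D k ω))) := fun n =>
    ENNReal.measurable_ofReal.comp (Real.measurable_exp.comp
      (Finset.measurable_fun_sum _ fun k _ => ((measurable_near M).comp
        ((hD.measurable_init k).prodMk (hD.measurable k))).const_mul A))
  have hmono : Monotone fun (n : ℕ) ω => ENNReal.ofReal (Real.exp
      (∑ k ∈ Finset.Icc (-(n : ℤ)) n, A * near M (V k ω) (D k ω))) := by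
    intro a b hab ω
    refine ENNReal.ofReal_le_ofReal (Real.exp_le_exp.2
      (Finset.sum_le_sum_of_subset_of_nonneg
        (Finset.Icc_subset_Icc (by simpa using hab) (by simpa using hab)) fun k _ _ => ?_))
    exact mul_nonneg hA (near_nonneg _ _ _)
  have hle : ∫⁻ ω, ⨆ n : ℕ, ENNReal.ofReal (Real.exp
      (∑ k ∈ Finset.Icc (-(n : ℤ)) n, A * near M (V k ω) (D k ω))) ∂P ≤ D' := by
    rw [lintegral_iSup hmeas hmono]
    refine iSup_le fun n => ?_
    rw [hD.lintegral_exp_sum_eq (θ := fun _ y u => A * near M y u)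
      (G := fun _ y => Real.log (expMean m (fun y u => A * near M y u) y))
      (fun _ => hloc.measurable) (fun _ y => hloc.integrable_exp y)
      (fun _ y => (Real.exp_log (hloc.expMean_pos hm y)).symm)]
    refine (lintegral_mono fun ω => ?_).trans (hS (Finset.Icc (-(n : ℤ)) n))
    refine ENNReal.ofReal_le_ofReal (Real.exp_le_exp.2 (Finset.sum_le_sum fun k _ => ?_))
    rw [div_one]
    exact (le_abs_self _).trans (hb _)
  have hne := (hle.trans_lt hD'.lt_top).ne
  refine ⟨fun ω => (⨆ n : ℕ, ENNReal.ofReal (Real.exp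
      (∑ k ∈ Finset.Icc (-(n : ℤ)) n, A * near M (V k ω) (D k ω)))).toReal,
    integrable_toReal_of_lintegral_ne_top (Measurable.iSup hmeas).aemeasurable hne, ?_⟩
  filter_upwards [ae_lt_top (Measurable.iSup hmeas) hne] with ω hω n
  rw [← ENNReal.ofReal_le_iff_le_toReal hω.ne]
  exact le_iSup (fun n : ℕ => ENNReal.ofReal (Real.exp
      (∑ k ∈ Finset.Icc (-(n : ℤ)) n, A * near M (V k ω) (D k ω)))) n

variable {Θ : ℝ × ℝ → ℝ} {c : ℝ}

/-- The generating function of a step observable reduces to one of the initial configuration. -/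
lemma HasIndepDisplacements.integral_exp_relSum [IsProbabilityMeasure P]
    (hD : HasIndepDisplacements P V D m) (hm : IsDisplacementLaw m) (hE : HasExpMoments P V)
    (hord : ∀ᵐ ω ∂P, ∀ k, (k ≤ 0 → V k ω ≤ 0) ∧ (0 ≤ k → 0 ≤ V k ω)) (hΘ : IsStep Θ c)
    (hfin : ∀ᵐ ω ∂P, Set.Finite (Function.support fun k : ℤ =>
      Θ (V k ω + (D k ω).1, V k ω + (D k ω).2) - c * (if 0 < k then 1 else 0))) :
    Integrable (fun ω => Real.exp
      (relSum Θ c fun k => (V k ω + (D k ω).1, V k ω + (D k ω).2))) P ∧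
    ∫ ω, Real.exp (relSum Θ c fun k => (V k ω + (D k ω).1, V k ω + (D k ω).2)) ∂P =
      ∫ ω, Real.exp (∑' k, sided (logMean m Θ) (fun y => logMean m Θ y - c) k (V k ω)) ∂P := by
  set θ : ℤ → ℝ → ℝ × ℝ → ℝ := fun k y u =>
    Θ (y + u.1, y + u.2) - c * (if 0 < k then 1 else 0) with hθ
  set G : ℤ → ℝ → ℝ := fun k y => sided (logMean m Θ) (fun y => logMean m Θ y - c) k y with hG
  have hθm : ∀ k, Measurable (Function.uncurry (θ k)) := fun k => by
    have h1 : Measurable fun p : ℝ × ℝ × ℝ => Θ (p.1 + p.2.1, p.1 + p.2.2) :=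
      hΘ.measurable.comp (by fun_prop)
    exact h1.sub_const _
  have hθi : ∀ k y, Integrable (fun u => Real.exp (θ k y u)) m := fun k y => by
    simp only [hθ, Real.exp_sub]
    exact (hΘ.integrable_exp hm y).div_const _
  have hθG : ∀ k y, ∫ u, Real.exp (θ k y u) ∂m = Real.exp (G k y) := fun k y => by
    have e : G k y = logMean m Θ y - c * (if 0 < k then 1 else 0) := by
      simp only [hG, sided]
      rcases le_or_gt k 0 with hk | hk
      · rw [if_pos hk, if_neg (not_lt.2 hk)]; ring
      · rw [if_neg (not_le.2 hk), if_pos hk]; ring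
    rw [e, Real.exp_sub, hΘ.exp_logMean hm, ← integral_div]
    simp only [hθ, Real.exp_sub]
  have hGm : ∀ k, Measurable (G k) := fun k => by
    have h1 := (hΘ.continuous_logMean hm).measurable
    simp only [hG, sided]
    split_ifs
    · exact h1
    · exact h1.sub_const c
  obtain ⟨A, M, hA, hM, hAM⟩ := hΘ.exists_abs_le
  obtain ⟨F, hF, hFle⟩ := hD.exists_envelope hm hE hA hM
  set f : ℕ → Ω → ℝ := fun n ω =>
    Real.exp (∑ k ∈ Finset.Icc (-(n : ℤ)) n, θ k (V k ω) (D k ω)) with hf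
  have hfm : ∀ n, Measurable (f n) := fun n => Real.measurable_exp.comp
    (Finset.measurable_fun_sum _ fun k _ => (hθm k).comp
      ((hD.measurable_init k).prodMk (hD.measurable k)))
  have hfF : ∀ n, ∀ᵐ ω ∂P, ‖f n ω‖ ≤ F ω := fun n => by
    filter_upwards [hFle, hord] with ω h1 h2
    refine le_trans ?_ (h1 n)
    rw [Real.norm_eq_abs, Real.abs_exp]
    refine Real.exp_le_exp.2 (Finset.sum_le_sum fun k _ => (le_abs_self _).trans ?_)
    exact hAM (0 < k) _ _ (fun h => (h2 k).2 h.le) fun h => (h2 k).1 (not_lt.1 h)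
  have hflim : ∀ᵐ ω ∂P, Tendsto (fun n => f n ω) atTop (𝓝 (Real.exp
      (relSum Θ c fun k => (V k ω + (D k ω).1, V k ω + (D k ω).2)))) := by
    filter_upwards [hfin] with ω hω
    refine (Real.continuous_exp.tendsto _).comp ?_
    exact (summable_of_hasFiniteSupport hω).hasSum.comp tendsto_Icc_neg_natCast
  -- The same finite-window integrals will converge to both sides: here under the envelope `F` for
  -- displaced particles, below under the exponential moments of the initial configuration.
  have hlim1 := tendsto_integral_of_dominated_convergence F
    (fun n => (hfm n).aestronglyMeasurable) hF hfF hflim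
  have hint : Integrable (fun ω => Real.exp
      (relSum Θ c fun k => (V k ω + (D k ω).1, V k ω + (D k ω).2))) P := by
    refine hF.mono' (aestronglyMeasurable_of_tendsto_ae atTop
      (fun n => (hfm n).aestronglyMeasurable) hflim) ?_
    filter_upwards [hflim, ae_all_iff.2 hfF] with ω h1 h2
    exact le_of_tendsto h1.norm (Eventually.of_forall h2)
  refine ⟨hint, tendsto_nhds_unique hlim1 ?_⟩
  obtain ⟨K, hKl, hKr⟩ := hΘ.exists_abs_logMean_le hm
  have hK0 : 0 ≤ K := by
    have := (abs_nonneg _).trans (hKl 0 le_rfl); simpa using this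
  have hsum := hE.ae_summable hD.measurable_init one_pos
  have hbd := hE.integrable_exp_tsum hD.measurable_init hK0 one_pos
  have hGK : ∀ᵐ ω ∂P, ∀ k, |G k (V k ω)| ≤ K * (1 + (V k ω / 1) ^ 2)⁻¹ := by
    filter_upwards [hord] with ω h k
    rw [div_one]
    simp only [hG, sided]
    split_ifs with hk
    · exact hKl _ ((h k).1 hk)
    · exact hKr _ ((h k).2 (not_le.1 hk).le)
  have e : ∀ n, ∫ ω, f n ω ∂P =
      ∫ ω, Real.exp (∑ k ∈ Finset.Icc (-(n : ℤ)) n, G k (V k ω)) ∂P := fun n => by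
    rw [integral_eq_lintegral_of_nonneg_ae (Eventually.of_forall fun ω => (Real.exp_pos _).le)
      (hfm n).aestronglyMeasurable, hD.lintegral_exp_sum_eq hθm hθi hθG,
      ← integral_eq_lintegral_of_nonneg_ae (Eventually.of_forall fun ω => (Real.exp_pos _).le)]
    exact (Real.measurable_exp.comp (Finset.measurable_fun_sum _ fun k _ =>
      (hGm k).comp (hD.measurable_init k))).aestronglyMeasurable
  simp only [e]
  refine tendsto_integral_of_dominated_convergence _ (fun n => (Real.measurable_exp.comp
    (Finset.measurable_fun_sum _ fun k _ =>
      (hGm k).comp (hD.measurable_init k))).aestronglyMeasurable) hbd (fun n => ?_) ?_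
  · filter_upwards [hsum, hGK] with ω h1 h2
    rw [Real.norm_eq_abs, Real.abs_exp, ← tsum_mul_left]
    refine Real.exp_le_exp.2 ((Finset.sum_le_sum fun k _ =>
      (le_abs_self _).trans (h2 k)).trans ?_)
    exact (h1.mul_left K).sum_le_tsum _ fun k _ => by positivity
  · filter_upwards [hsum, hGK] with ω h1 h2
    refine (Real.continuous_exp.tendsto _).comp ?_
    exact (Summable.of_norm_bounded (h1.mul_left K) h2).hasSum.comp tendsto_Icc_neg_natCast

end

/-! ### The scaling limit of the generating functions -/

section Limit

variable {Ω : Type*} {σ ρ : ℝ} {Y : ℤ → Ω → ℝ} {W X : ℤ → ℝ≥0 → Ω → ℝ} {τ₁ τ₂ : ℝ≥0}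

/-- The rescaled positions of the free particles at the two times. -/
noncomputable def freePair (σ : ℝ) (τ₁ τ₂ : ℝ≥0) (Y : ℤ → Ω → ℝ) (W : ℤ → ℝ≥0 → Ω → ℝ) (t : ℝ≥0)
    (ω : Ω) (k : ℤ) : ℝ × ℝ :=
  ((Y k ω + σ / √2 * W k (τ₁ * t) ω) / √(t : ℝ), (Y k ω + σ / √2 * W k (τ₂ * t) ω) / √(t : ℝ))

lemma freePair_eq (t : ℝ≥0) (ω : Ω) (k : ℤ) : freePair σ τ₁ τ₂ Y W t ω k =
    (Y k ω / √(t : ℝ) + (displacement σ τ₁ τ₂ W t k ω).1,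
      Y k ω / √(t : ℝ) + (displacement σ τ₁ τ₂ W t k ω).2) := by
  simp only [freePair, displacement, add_div]

lemma IsSortedAtInfinity.finite_support {σ : ℝ} {ω : Ω} {Θ : ℝ × ℝ → ℝ} {c : ℝ}
    (hΘ : IsStep Θ c) {t : ℝ≥0} (ht : 0 < t) (hτ : τ₁ ≤ τ₂)
    (h : IsSortedAtInfinity (τ₂ * t) fun k t => Y k ω + σ / √2 * W k t ω) :
    Set.Finite (Function.support fun k : ℤ =>
      Θ (freePair σ τ₁ τ₂ Y W t ω k) - c * (if 0 < k then 1 else 0)) := by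
  obtain ⟨M, hM, htail⟩ := hΘ.tails
  have hL : 0 < √(t : ℝ) := Real.sqrt_pos.2 (by exact_mod_cast ht)
  obtain ⟨K, hK0, hK⟩ := h (M * √(t : ℝ))
  refine (Set.finite_Icc (-K) K).subset fun k hk => ?_
  by_contra hn
  rw [Set.mem_Icc, not_and_or, not_le, not_le] at hn
  refine hk ?_
  change Θ (freePair σ τ₁ τ₂ Y W t ω k) - c * (if 0 < k then 1 else 0) = 0
  have h1 := hK (τ₁ * t) (by gcongr) k
  have h2 := hK (τ₂ * t) le_rfl k
  rcases hn with hn | hn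
  · rw [(htail _).1, if_neg (by omega), mul_zero, sub_zero]
    · simp only [freePair]
      rw [div_lt_iff₀ hL, neg_mul]
      exact h1.2 hn
    · simp only [freePair]
      rw [div_lt_iff₀ hL, neg_mul]
      exact h2.2 hn
  · rw [(htail _).2, if_pos (by omega), mul_one, sub_self]
    · simp only [freePair]
      rw [lt_div_iff₀ hL]
      exact h1.1 hn
    · simp only [freePair]
      rw [lt_div_iff₀ hL]
      exact h2.1 hn

variable [MeasurableSpace Ω] {P : Measure Ω}

lemma HasExpMoments.div (h : HasExpMoments P Y) {L : ℝ} (hL : 0 < L) :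
    HasExpMoments P fun k ω => Y k ω / L := by
  intro C L' hC hL'
  obtain ⟨D, hD, hS⟩ := h C (L * L') hC (by positivity)
  exact ⟨D, hD, fun S => by simpa only [div_div] using hS S⟩

/-- The scaled cumulant generating function of a step observable. -/
lemma IsSingleFile.tendsto_log_integral_exp [IsProbabilityMeasure P] (hX : IsSingleFile P σ Y W X)
    {ψ ψ' : ℝ → ℝ} (hψ : IsRateTransform ψ ψ') (hI : IsInitialProfile P ψ ρ Y) (hτ : τ₁ ≤ τ₂)
    (hm : IsDisplacementLaw (displacementLaw σ τ₁ τ₂)) {Θ : ℝ × ℝ → ℝ} {c : ℝ}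
    (hΘ : IsStep Θ c) :
    (∀ t, 0 < t → Integrable (fun ω => Real.exp (relSum Θ c (freePair σ τ₁ τ₂ Y W t ω))) P) ∧
    Tendsto (fun t : ℝ≥0 => (√(t : ℝ))⁻¹ *
        Real.log (∫ ω, Real.exp (relSum Θ c (freePair σ τ₁ τ₂ Y W t ω)) ∂P)) atTop
      (𝓝 (ρ * pressure ψ (displacementLaw σ τ₁ τ₂) (stepExponent Θ c))) := by
  set m := displacementLaw σ τ₁ τ₂ with hmdef
  have key : ∀ t, 0 < t →
      Integrable (fun ω => Real.exp (relSum Θ c (freePair σ τ₁ τ₂ Y W t ω))) P ∧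
      ∫ ω, Real.exp (relSum Θ c (freePair σ τ₁ τ₂ Y W t ω)) ∂P =
        ∫ ω, Real.exp (∑' k, sided (logMean m Θ) (fun y => logMean m Θ y - c) k
          (Y k ω / √(t : ℝ))) ∂P := by
    intro t ht
    have hL : 0 < √(t : ℝ) := Real.sqrt_pos.2 (by exact_mod_cast ht)
    have hord : ∀ᵐ ω ∂P, ∀ k : ℤ, (k ≤ 0 → Y k ω / √(t : ℝ) ≤ 0) ∧
        (0 ≤ k → 0 ≤ Y k ω / √(t : ℝ)) := by
      filter_upwards [hI.ordered] with ω h k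
      exact ⟨fun hk => div_nonpos_of_nonpos_of_nonneg ((h k).1 hk) hL.le,
        fun hk => div_nonneg ((h k).2 hk) hL.le⟩
    have hfin : ∀ᵐ ω ∂P, Set.Finite (Function.support fun k : ℤ =>
        Θ (freePair σ τ₁ τ₂ Y W t ω k) - c * (if 0 < k then 1 else 0)) := by
      filter_upwards [hX.ae_isSortedAtInfinity hI.ordered hI.exp_moment (τ₂ * t) (σ / √2)] with ω h
      exact h.finite_support hΘ ht hτ
    have e : ∀ ω, freePair σ τ₁ τ₂ Y W t ω = fun k =>
        (Y k ω / √(t : ℝ) + (displacement σ τ₁ τ₂ W t k ω).1,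
          Y k ω / √(t : ℝ) + (displacement σ τ₁ τ₂ W t k ω).2) := fun ω =>
      funext fun k => freePair_eq t ω k
    simp only [e] at hfin ⊢
    exact (hX.hasIndepDisplacements hτ ht).integral_exp_relSum hm (hI.exp_moment.div hL) hord hΘ
      hfin
  refine ⟨fun t ht => (key t ht).1, ?_⟩
  obtain ⟨K, hKl, hKr⟩ := hΘ.exists_abs_logMean_le hm
  have hc := hΘ.continuous_logMean hm
  rw [hΘ.pressure_eq hψ hm]
  have h1 := (hI.limit (logMean m Θ) (fun y => logMean m Θ y - c) K hc (hc.sub continuous_const)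
    hKl hKr).comp (Real.tendsto_sqrt_atTop.comp
      (NNReal.tendsto_coe_atTop.2 tendsto_id))
  refine h1.congr' ?_
  filter_upwards [eventually_gt_atTop 0] with t ht
  simp only [Function.comp, (key t ht).2, id]

end Limit

end SingleFile

namespace SingleFile

/-! ### Large deviations from the generating functions of the counts -/

section LargeDeviations

variable {Ω : Type*} [MeasurableSpace Ω] {P : Measure Ω} {ψ ψ' : ℝ → ℝ} {m : Measure (ℝ × ℝ)}
  {ρ : ℝ} {V : ℝ≥0 → Ω → ℝ × ℝ} {q : (ℝ × ℝ → ℝ) → ℝ → ℝ≥0 → Ω → ℝ}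

/-- The linear combination of counts with weights `B` at the levels `ξ` and an additional
weight `s` at the level `ζ`. -/
noncomputable def weightedCount (q : (ℝ × ℝ → ℝ) → ℝ → ℝ≥0 → Ω → ℝ) (B ξ : ℝ × ℝ) (s : ℝ)
    (π : ℝ × ℝ → ℝ) (ζ : ℝ) (t : ℝ≥0) (ω : Ω) : ℝ :=
  B.1 * q Prod.fst ξ.1 t ω + B.2 * q Prod.snd ξ.2 t ω + s * q π ζ t ω

/-- The signs of the counts `q π ζ` tell on which side of the level `ζ` the coordinates of `V`
are, and the generating functions of the counts are governed by the pressure. -/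
structure HasCounts (P : Measure Ω) (ψ : ℝ → ℝ) (m : Measure (ℝ × ℝ)) (ρ : ℝ)
    (V : ℝ≥0 → Ω → ℝ × ℝ) (q : (ℝ × ℝ → ℝ) → ℝ → ℝ≥0 → Ω → ℝ) : Prop where
  sign : ∀ t, 0 < t → ∀ᵐ ω ∂P, ∀ π, IsCoord π → ∀ ζ,
    (ζ < π (V t ω) → 1 ≤ q π ζ t ω) ∧ (π (V t ω) ≤ ζ → q π ζ t ω ≤ 0)
  integrable : ∀ (B ξ : ℝ × ℝ) (s : ℝ) (π : ℝ × ℝ → ℝ) (ζ : ℝ), IsCoord π → ∀ t, 0 < t →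
    Integrable (fun ω => Real.exp (weightedCount q B ξ s π ζ t ω)) P
  limit : ∀ (B ξ : ℝ × ℝ) (s : ℝ) (π : ℝ × ℝ → ℝ) (ζ : ℝ), IsCoord π →
    Tendsto (fun t : ℝ≥0 => (√(t : ℝ))⁻¹ *
        Real.log (∫ ω, Real.exp (weightedCount q B ξ s π ζ t ω) ∂P)) atTop
      (𝓝 (ρ * pressure ψ m fun y u => crossings B ξ y u + s * crossing π ζ y u))

lemma tendsto_sqrt_coe_atTop : Tendsto (fun t : ℝ≥0 => √(t : ℝ)) atTop atTop :=
  Real.tendsto_sqrt_atTop.comp (NNReal.tendsto_coe_atTop.2 tendsto_id)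

lemma eventually_const_mul_exp_le (C : ℝ) {a b : ℝ} (hab : a < b) :
    ∀ᶠ t : ℝ≥0 in atTop, C * Real.exp (√(t : ℝ) * a) ≤ Real.exp (√(t : ℝ) * b) := by
  have h1 : Tendsto (fun t : ℝ≥0 => Real.exp (√(t : ℝ) * (b - a))) atTop atTop :=
    Real.tendsto_exp_atTop.comp (tendsto_sqrt_coe_atTop.atTop_mul_const (sub_pos.2 hab))
  filter_upwards [h1.eventually_ge_atTop C] with t ht
  calc C * Real.exp (√(t : ℝ) * a) ≤ Real.exp (√(t : ℝ) * (b - a)) * Real.exp (√(t : ℝ) * a) := by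
        gcongr
    _ = Real.exp (√(t : ℝ) * b) := by rw [← Real.exp_add]; ring_nf

namespace HasCounts

lemma lintegral_eq [NeZero P] (h : HasCounts P ψ m ρ V q) (B ξ : ℝ × ℝ) (s : ℝ) {π : ℝ × ℝ → ℝ}
    (hπ : IsCoord π) (ζ : ℝ) {t : ℝ≥0} (ht : 0 < t) :
    ∫⁻ ω, ENNReal.ofReal (Real.exp (weightedCount q B ξ s π ζ t ω)) ∂P =
      ENNReal.ofReal (Real.exp (√(t : ℝ) * ((√(t : ℝ))⁻¹ *
        Real.log (∫ ω, Real.exp (weightedCount q B ξ s π ζ t ω) ∂P)))) := by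
  have hL : 0 < √(t : ℝ) := Real.sqrt_pos.2 (by exact_mod_cast ht)
  have hi := h.integrable B ξ s π ζ hπ t ht
  rw [mul_inv_cancel_left₀ hL.ne', Real.exp_log (integral_exp_pos hi),
    ofReal_integral_eq_lintegral_ofReal hi (Eventually.of_forall fun ω => (Real.exp_pos _).le)]

lemma eventually_lintegral_le [NeZero P] (h : HasCounts P ψ m ρ V q) (B ξ : ℝ × ℝ) (s : ℝ)
    {π : ℝ × ℝ → ℝ} (hπ : IsCoord π) (ζ : ℝ) {a : ℝ}
    (ha : ρ * pressure ψ m (fun y u => crossings B ξ y u + s * crossing π ζ y u) < a) :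
    ∀ᶠ t : ℝ≥0 in atTop,
      ∫⁻ ω, ENNReal.ofReal (Real.exp (weightedCount q B ξ s π ζ t ω)) ∂P ≤
        ENNReal.ofReal (Real.exp (√(t : ℝ) * a)) := by
  filter_upwards [(h.limit B ξ s π ζ hπ).eventually (gt_mem_nhds ha), eventually_gt_atTop 0]
    with t h1 ht
  rw [h.lintegral_eq B ξ s hπ ζ ht]
  exact ENNReal.ofReal_le_ofReal (Real.exp_le_exp.2
    (mul_le_mul_of_nonneg_left h1.le (Real.sqrt_nonneg _)))

lemma eventually_le_lintegral [NeZero P] (h : HasCounts P ψ m ρ V q) (B ξ : ℝ × ℝ) (s : ℝ)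
    {π : ℝ × ℝ → ℝ} (hπ : IsCoord π) (ζ : ℝ) {a : ℝ}
    (ha : a < ρ * pressure ψ m (fun y u => crossings B ξ y u + s * crossing π ζ y u)) :
    ∀ᶠ t : ℝ≥0 in atTop, ENNReal.ofReal (Real.exp (√(t : ℝ) * a)) ≤
      ∫⁻ ω, ENNReal.ofReal (Real.exp (weightedCount q B ξ s π ζ t ω)) ∂P := by
  filter_upwards [(h.limit B ξ s π ζ hπ).eventually (lt_mem_nhds ha), eventually_gt_atTop 0]
    with t h1 ht
  rw [h.lintegral_eq B ξ s hπ ζ ht]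
  exact ENNReal.ofReal_le_ofReal (Real.exp_le_exp.2
    (mul_le_mul_of_nonneg_left h1.le (Real.sqrt_nonneg _)))

/-- Chernoff's bound. -/
lemma eventually_measure_le [NeZero P] (h : HasCounts P ψ m ρ V q) (B ξ : ℝ × ℝ) (s : ℝ)
    {π : ℝ × ℝ → ℝ} (hπ : IsCoord π) (ζ : ℝ) {a : ℝ}
    (ha : ρ * pressure ψ m (fun y u => crossings B ξ y u + s * crossing π ζ y u) < a)
    {S : Set (ℝ × ℝ)}
    (hS : ∀ t, 0 < t → ∀ᵐ ω ∂P, V t ω ∈ S → 0 ≤ weightedCount q B ξ s π ζ t ω) :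
    ∀ᶠ t : ℝ≥0 in atTop, P {ω | V t ω ∈ S} ≤ ENNReal.ofReal (Real.exp (√(t : ℝ) * a)) := by
  filter_upwards [h.eventually_lintegral_le B ξ s hπ ζ ha, eventually_gt_atTop 0] with t h1 ht
  refine le_trans ?_ h1
  have hm : AEMeasurable (fun ω =>
      ENNReal.ofReal (Real.exp (weightedCount q B ξ s π ζ t ω))) P :=
    (h.integrable B ξ s π ζ hπ t ht).aestronglyMeasurable.aemeasurable.ennreal_ofReal
  have h2 := mul_meas_ge_le_lintegral₀ hm 1
  rw [one_mul] at h2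
  refine le_trans (measure_mono_ae ?_) h2
  filter_upwards [hS t ht] with ω hω hV
  exact ENNReal.one_le_ofReal.2 (Real.one_le_exp (hω hV))

/-- A tracer within `η` of `ξ` is above `ξ - η` and below `ξ + η` at both times. Lowering the levels
with nonnegative weight and raising the others makes each weighted count nonnegative, so Chernoff's
bound applies; continuity of the pressure in the levels absorbs the shift. -/
lemma exists_nhds_measure_le [NeZero P] (h : HasCounts P ψ m ρ V q) (hψ : IsRateTransform ψ ψ')
    (hm : IsDisplacementLaw m) {B ξ : ℝ × ℝ} {a : ℝ}
    (ha : ρ * pressure ψ m (crossings B ξ) < a) :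
    ∃ N ∈ 𝓝 ξ, ∀ᶠ t : ℝ≥0 in atTop,
      P {ω | V t ω ∈ N} ≤ ENNReal.ofReal (Real.exp (√(t : ℝ) * a)) := by
  have hc : Continuous fun ξ' : ℝ × ℝ => ρ * pressure ψ m (crossings B ξ') :=
    continuous_const.mul ((continuous_pressure_crossings hψ hm).comp
      (Continuous.prodMk continuous_const continuous_id))
  obtain ⟨δ, hδ, hδa⟩ := Metric.eventually_nhds_iff.1 (hc.continuousAt.eventually (gt_mem_nhds ha))
  set η := δ / 2 with hη
  have hη0 : 0 < η := by positivity
  set ξ' : ℝ × ℝ := (if 0 ≤ B.1 then ξ.1 - η else ξ.1 + η, if 0 ≤ B.2 then ξ.2 - η else ξ.2 + η)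
    with hξ'
  have hdist : dist ξ' ξ < δ := by
    rw [Prod.dist_eq, max_lt_iff, Real.dist_eq, Real.dist_eq]
    constructor
    · simp only [hξ']; split_ifs <;> rw [abs_lt] <;> constructor <;> linarith
    · simp only [hξ']; split_ifs <;> rw [abs_lt] <;> constructor <;> linarith
  have hp := hδa hdist
  have hval : ∀ t, 0 < t → ∀ᵐ ω ∂P, V t ω ∈ Metric.ball ξ η →
      0 ≤ weightedCount q B ξ' 0 Prod.fst 0 t ω := by
    intro t ht
    filter_upwards [h.sign t ht] with ω hω hV
    have hV' : |(V t ω).1 - ξ.1| < η ∧ |(V t ω).2 - ξ.2| < η := by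
      rwa [Metric.mem_ball, Prod.dist_eq, max_lt_iff, Real.dist_eq, Real.dist_eq] at hV
    have h1 := abs_lt.1 hV'.1
    have h2 := abs_lt.1 hV'.2
    have t1 : 0 ≤ B.1 * q Prod.fst ξ'.1 t ω := by
      simp only [hξ']
      split_ifs with hB
      · have := (hω _ isCoord_fst (ξ.1 - η)).1 (by linarith)
        exact mul_nonneg hB (by linarith)
      · exact mul_nonneg_of_nonpos_of_nonpos (not_le.1 hB).le
          ((hω _ isCoord_fst (ξ.1 + η)).2 (by linarith))
    have t2 : 0 ≤ B.2 * q Prod.snd ξ'.2 t ω := by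
      simp only [hξ']
      split_ifs with hB
      · have := (hω _ isCoord_snd (ξ.2 - η)).1 (by linarith)
        exact mul_nonneg hB (by linarith)
      · exact mul_nonneg_of_nonpos_of_nonpos (not_le.1 hB).le
          ((hω _ isCoord_snd (ξ.2 + η)).2 (by linarith))
    unfold weightedCount
    linarith
  refine ⟨Metric.ball ξ η, Metric.ball_mem_nhds ξ hη0, ?_⟩
  refine h.eventually_measure_le B ξ' 0 isCoord_fst 0 ?_ hval
  simpa using hp

/-- Exponential tightness: Chernoff's bound with weight `1 / 2` at level `R`, or `-1 / 2` at `-R`,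
has exponent at most `ρ * (K - R / 4)`. -/
lemma exists_measure_compl_le [NeZero P] (h : HasCounts P ψ m ρ V q) (hψ : IsRateTransform ψ ψ')
    (hm : IsDisplacementLaw m) (hρ : 0 < ρ) (a : ℝ) :
    ∃ R : ℝ, ∀ᶠ t : ℝ≥0 in atTop, P {ω | V t ω ∈ (Metric.closedBall (0 : ℝ × ℝ) R)ᶜ} ≤
      4 * ENNReal.ofReal (Real.exp (√(t : ℝ) * a)) := by
  have key : ∀ π, IsCoord π → ∃ R₀ : ℝ, ∀ R, R₀ ≤ R → ∀ᶠ t : ℝ≥0 in atTop,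
      P {ω | V t ω ∈ {v | R < |π v|}} ≤ 2 * ENNReal.ofReal (Real.exp (√(t : ℝ) * a)) := by
    intro π hπ
    obtain ⟨K, hK⟩ := exists_pressure_crossing_le hψ hm hπ
    refine ⟨max 0 (4 * (K - a / ρ) + 1), fun R hR => ?_⟩
    have hR0 : 0 ≤ R := (le_max_left _ _).trans hR
    have hR1 : 4 * (K - a / ρ) + 1 ≤ R := (le_max_right _ _).trans hR
    have hlt : ρ * (K - R / 4) < a := by
      rw [mul_comm, ← lt_div_iff₀ hρ]; linarith
    have hz : ∀ s ζ : ℝ, (fun (y : ℝ) (u : ℝ × ℝ) =>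
        crossings 0 0 y u + s * crossing π ζ y u) = fun y u => s * crossing π ζ y u := by
      intro s ζ; funext y u; simp [crossings]
    have b1 := h.eventually_measure_le 0 0 (1 / 2) hπ R (a := a) (S := {v | R < π v}) (by
        rw [hz]
        refine lt_of_le_of_lt (mul_le_mul_of_nonneg_left
          (hK R (1 / 2) (by norm_num)) hρ.le) (lt_of_le_of_lt (le_of_eq ?_) hlt)
        rw [abs_of_nonneg hR0]; ring) (fun t ht => by
        filter_upwards [h.sign t ht] with ω hω hV
        have := (hω π hπ R).1 hV
        simp only [weightedCount, Prod.fst_zero, Prod.snd_zero, zero_mul, zero_add]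
        linarith)
    have b2 := h.eventually_measure_le 0 0 (-(1 / 2)) hπ (-R) (a := a) (S := {v | π v < -R}) (by
        rw [hz]
        refine lt_of_le_of_lt (mul_le_mul_of_nonneg_left
          (hK (-R) (-(1 / 2)) (by norm_num)) hρ.le) (lt_of_le_of_lt (le_of_eq ?_) hlt)
        rw [abs_neg, abs_of_nonneg hR0]; ring) (fun t ht => by
        filter_upwards [h.sign t ht] with ω hω hV
        have := (hω π hπ (-R)).2 (le_of_lt hV)
        simp only [weightedCount, Prod.fst_zero, Prod.snd_zero, zero_mul, zero_add]
        linarith)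
    filter_upwards [b1, b2] with t h1 h2
    rw [two_mul]
    refine le_trans (measure_mono (fun ω hω => ?_)) ((measure_union_le _ _).trans
      (add_le_add h1 h2))
    rcases lt_abs.1 (show R < |π (V t ω)| from hω) with h3 | h3
    · exact Or.inl h3
    · exact Or.inr (show π (V t ω) < -R by linarith)
  obtain ⟨R₁, hR₁⟩ := key _ isCoord_fst
  obtain ⟨R₂, hR₂⟩ := key _ isCoord_snd
  refine ⟨max R₁ R₂, ?_⟩
  filter_upwards [hR₁ _ (le_max_left _ _), hR₂ _ (le_max_right _ _)] with t h1 h2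
  rw [show (4 : ℝ≥0∞) = 2 + 2 by norm_num, add_mul]
  refine le_trans (measure_mono (fun ω hω => ?_)) ((measure_union_le _ _).trans
      (add_le_add h1 h2))
  have h3 : max R₁ R₂ < ‖V t ω‖ := by simpa using hω
  rw [Prod.norm_def, Real.norm_eq_abs, Real.norm_eq_abs] at h3
  rcases lt_max_iff.1 h3 with h4 | h4
  · exact Or.inl h4
  · exact Or.inr h4

/-- The large deviation upper bound for closed sets. -/
lemma eventually_measure_closed_le [NeZero P] (h : HasCounts P ψ m ρ V q)
    (hψ : IsRateTransform ψ ψ') (hm : IsDisplacementLaw m) (hρ : 0 < ρ) {C : Set (ℝ × ℝ)}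
    (hC : IsClosed C) {a b : ℝ} (hab : a < b)
    (hCa : ∀ ξ ∈ C, ∃ B, ρ * pressure ψ m (crossings B ξ) < a) :
    ∀ᶠ t : ℝ≥0 in atTop, P {ω | V t ω ∈ C} ≤ ENNReal.ofReal (Real.exp (√(t : ℝ) * b)) := by
  obtain ⟨R, hR⟩ := h.exists_measure_compl_le hψ hm hρ a
  have hK : IsCompact (Metric.closedBall (0 : ℝ × ℝ) R ∩ C) :=
    (isCompact_closedBall _ _).inter_right hC
  have hcover : ∃ n : ℕ, ∀ᶠ t : ℝ≥0 in atTop,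
      P {ω | V t ω ∈ Metric.closedBall (0 : ℝ × ℝ) R ∩ C} ≤
        n * ENNReal.ofReal (Real.exp (√(t : ℝ) * a)) := by
    refine hK.induction_on (p := fun S => ∃ n : ℕ, ∀ᶠ t : ℝ≥0 in atTop,
      P {ω | V t ω ∈ S} ≤ n * ENNReal.ofReal (Real.exp (√(t : ℝ) * a)))
      ⟨0, Eventually.of_forall fun t => by simp⟩ ?_ ?_ ?_
    · rintro S T hST ⟨n, hn⟩
      exact ⟨n, hn.mono fun t ht => (measure_mono (show {ω | V t ω ∈ S} ⊆ {ω | V t ω ∈ T} from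
        fun ω hω => hST hω)).trans ht⟩
    · rintro S T ⟨n, hn⟩ ⟨k, hk⟩
      refine ⟨n + k, ?_⟩
      filter_upwards [hn, hk] with t h1 h2
      push_cast
      rw [add_mul]
      exact (measure_union_le {ω | V t ω ∈ S} {ω | V t ω ∈ T}).trans (add_le_add h1 h2)
    · intro ξ hξ
      obtain ⟨B, hB⟩ := hCa ξ hξ.2
      obtain ⟨N, hN, hNt⟩ := h.exists_nhds_measure_le hψ hm hB
      exact ⟨N, mem_nhdsWithin_of_mem_nhds hN, 1, by simpa using hNt⟩
  obtain ⟨n, hn⟩ := hcover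
  -- The gap between `a` and `b` absorbs the number of covering sets.
  filter_upwards [hR, hn, eventually_const_mul_exp_le (4 + n) hab] with t h1 h2 h3
  have h4 : P {ω | V t ω ∈ C} ≤ (4 + n) * ENNReal.ofReal (Real.exp (√(t : ℝ) * a)) := by
    rw [add_mul]
    refine le_trans (measure_mono fun ω hω => ?_) ((measure_union_le _ _).trans
      (add_le_add h1 h2))
    by_cases hb : V t ω ∈ Metric.closedBall (0 : ℝ × ℝ) R
    · exact Or.inr ⟨hb, hω⟩
    · exact Or.inl hb
  refine h4.trans (le_trans (le_of_eq ?_) (ENNReal.ofReal_le_ofReal h3))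
  rw [ENNReal.ofReal_mul (by positivity), ENNReal.ofReal_add (by norm_num) (by positivity)]
  simp

end HasCounts

end LargeDeviations

end SingleFile

namespace SingleFile

/-! ### The lower bound by tilting -/

section LargeDeviations

variable {Ω : Type*} [MeasurableSpace Ω] {P : Measure Ω} {ψ ψ' : ℝ → ℝ} {m : Measure (ℝ × ℝ)}
  {ρ : ℝ} {V : ℝ≥0 → Ω → ℝ × ℝ} {q : (ℝ × ℝ → ℝ) → ℝ → ℝ≥0 → Ω → ℝ}

/-- A differentiable function with negative slope drops below its initial value. -/
lemma exists_pos_lt_of_hasDerivAt {f : ℝ → ℝ} {f' : ℝ} (hf : HasDerivAt f f' 0) (h : f' < 0) :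
    ∃ s, 0 < s ∧ f s < f 0 := by
  have h1 : Tendsto (slope f 0) (𝓝[>] 0) (𝓝 f') :=
    (hasDerivAt_iff_tendsto_slope.1 hf).mono_left
      (nhdsWithin_mono _ fun x hx => (Set.mem_Ioi.1 hx).ne')
  obtain ⟨s, hs, hs0⟩ := ((h1.eventually (gt_mem_nhds h)).and self_mem_nhdsWithin).exists
  have hs0' : 0 < s := hs0
  refine ⟨s, hs0', ?_⟩
  rw [slope_def_field, sub_zero] at hs
  have := (div_lt_iff₀ hs0').1 hs
  linarith

namespace HasCounts

/-- Under the tilted law the excess of a count over its mean is exponentially unlikely. -/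
lemma exists_tilted_le [NeZero P] (h : HasCounts P ψ m ρ V q) (hψ : IsRateTransform ψ ψ')
    (hm : IsDisplacementLaw m) {B ξ : ℝ × ℝ} {π : ℝ × ℝ → ℝ} (hπ : IsCoord π) {ζ κ η : ℝ}
    (hη : ρ * (κ * tiltMean ψ' m (crossings B ξ) (crossing π ζ)) < η) :
    ∃ s r, 0 < s ∧ 0 < r ∧ ∀ᶠ t : ℝ≥0 in atTop,
      ∫⁻ ω, ENNReal.ofReal (Real.exp (weightedCount q B ξ (s * κ) π ζ t ω - s * (η * √(t : ℝ)))) ∂P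
        ≤ ENNReal.ofReal (Real.exp (√(t : ℝ) * (ρ * pressure ψ m (crossings B ξ) - r))) := by
  have h1 := hasDerivAt_pressure hψ hm (isLocal_crossings B ξ)
    ((hπ.isLocal_crossing ζ).const_mul κ)
  rw [tiltMean_const_mul] at h1
  -- The slope at zero is the tilted mean minus `η`, hence negative: some `s > 0` gains a definite
  -- amount, half of which is `r`.
  have h2 : HasDerivAt (fun s => ρ * pressure ψ m (fun y u => crossings B ξ y u +
      s * (κ * crossing π ζ y u)) - s * η)
      (ρ * (κ * tiltMean ψ' m (crossings B ξ) (crossing π ζ)) - 1 * η) 0 :=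
    (h1.const_mul ρ).sub ((hasDerivAt_id 0).mul_const η)
  obtain ⟨s, hs, hlt⟩ := exists_pos_lt_of_hasDerivAt h2 (by linarith)
  simp only [zero_mul, add_zero, sub_zero] at hlt
  set Λ := pressure ψ m (fun y u => crossings B ξ y u + s * (κ * crossing π ζ y u)) with hΛ
  set r := (ρ * pressure ψ m (crossings B ξ) - (ρ * Λ - s * η)) / 2 with hr
  have hr0 : 0 < r := by rw [hr]; linarith
  have hΛ' : ρ * pressure ψ m (fun y u => crossings B ξ y u + (s * κ) * crossing π ζ y u) <
      ρ * pressure ψ m (crossings B ξ) - r + s * η := by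
    simp only [mul_assoc]
    rw [← hΛ]; linarith
  refine ⟨s, r, hs, hr0, ?_⟩
  filter_upwards [h.eventually_lintegral_le B ξ (s * κ) hπ ζ hΛ'] with t ht
  simp only [Real.exp_sub, div_eq_mul_inv, ← Real.exp_neg,
    ENNReal.ofReal_mul (Real.exp_pos _).le]
  rw [lintegral_mul_const' _ _ ENNReal.ofReal_ne_top]
  refine (mul_le_mul_left ht _).trans (le_of_eq ?_)
  rw [← ENNReal.ofReal_mul (Real.exp_pos _).le, ← Real.exp_add]
  congr 2
  ring

/-- The large deviation lower bound for open sets. -/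
lemma eventually_le_measure_open [NeZero P] (h : HasCounts P ψ m ρ V q)
    (hψ : IsRateTransform ψ ψ') (hm : IsDisplacementLaw m) (hρ : 0 < ρ) {U : Set (ℝ × ℝ)}
    (hU : IsOpen U) {ξ B : ℝ × ℝ} (hξ : ξ ∈ U) (hB : IsCritical ψ' m ξ B) {a : ℝ}
    (ha : a < ρ * pressure ψ m (crossings B ξ)) :
    ∀ᶠ t : ℝ≥0 in atTop, ENNReal.ofReal (Real.exp (√(t : ℝ) * a)) ≤ P {ω | V t ω ∈ U} := by
  set p := ρ * pressure ψ m (crossings B ξ) with hp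
  obtain ⟨δ, hδ, hδU⟩ := Metric.isOpen_iff.1 hU ξ hξ
  set β := |B.1| + |B.2| with hβ
  -- Chosen so that removing the tilt, when both counts are below `η * √t`, costs less than half of
  -- the available gap `p - a`.
  set η := (p - a) / (2 * (β + 1)) with hη
  have hη0 : 0 < η := div_pos (by linarith) (by positivity)
  have hβη : β * η < (p - a) / 2 := by
    have h1 : (β + 1) * η = (p - a) / 2 := by
      rw [hη]
      have : β + 1 ≠ 0 := by positivity
      field_simp
    have h2 : β * η < (β + 1) * η := by nlinarith
    linarith
  have hcrit : ∀ π, IsCoord π → tiltMean ψ' m (crossings B ξ) (crossing π (π ξ)) = 0 := by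
    intro π hπ
    rcases hπ with rfl | rfl
    · exact hB.1
    · exact hB.2
  -- the coordinate, the kind and the direction of a deviation
  set πj : Bool × Bool × Bool → ℝ × ℝ → ℝ := fun j => if j.1 then Prod.fst else Prod.snd with hπj
  set κj : Bool × Bool × Bool → ℝ := fun j => if j.2.2 then 1 else -1 with hκj
  set ζj : Bool × Bool × Bool → ℝ := fun j =>
    if j.2.1 then πj j ξ else πj j ξ + κj j * (δ / 2) with hζj
  set ηj : Bool × Bool × Bool → ℝ := fun j => if j.2.1 then η else 0 with hηj
  have hπc : ∀ j, IsCoord (πj j) := by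
    rintro ⟨_ | _, k⟩
    · exact isCoord_snd
    · exact isCoord_fst
  -- At `ξ` the tilted means vanish, and `η > 0` is the allowed fluctuation. At levels shifted by `δ
  -- / 2` strict monotonicity gives the mean a sign opposite to that of the deviation, so no
  -- allowance is needed.
  have hbad : ∀ j, ρ * (κj j * tiltMean ψ' m (crossings B ξ) (crossing (πj j) (ζj j))) < ηj j := by
    intro j
    have h0 := hcrit _ (hπc j)
    by_cases h1 : j.2.1
    · simp only [hζj, hηj, h1, if_true, h0, mul_zero, hη0]
    · simp only [hζj, hηj, h1]
      simp only [Bool.false_eq_true, if_false]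
      by_cases h2 : j.2.2
      · simp only [hκj, h2, if_true, one_mul]
        have := tiltMean_crossing_lt hψ hm (hπc j) (isLocal_crossings B ξ)
          (show πj j ξ < πj j ξ + δ / 2 by linarith)
        rw [h0] at this
        exact mul_neg_of_pos_of_neg hρ this
      · simp only [hκj, h2]
        simp only [Bool.false_eq_true, if_false]
        have := tiltMean_crossing_lt hψ hm (hπc j) (isLocal_crossings B ξ)
          (show πj j ξ + -1 * (δ / 2) < πj j ξ by linarith)
        rw [h0] at this
        exact mul_neg_of_pos_of_neg hρ (by linarith)
  choose s r hs hr hsr using fun j => h.exists_tilted_le hψ hm (hπc j) (hbad j)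
  obtain ⟨r₀, hr₀, hr₀j⟩ : ∃ r₀, 0 < r₀ ∧ ∀ j, r₀ ≤ r j := by
    obtain ⟨j₀, -, hj₀⟩ := Finset.exists_min_image Finset.univ r Finset.univ_nonempty
    exact ⟨r j₀, hr j₀, fun j => hj₀ j (Finset.mem_univ j)⟩
  set ε := min (r₀ / 2) ((p - a) / 4) with hε
  have hε0 : 0 < ε := lt_min (by linarith) (by linarith)
  have hε1 : ε ≤ r₀ / 2 := min_le_left _ _
  have hε2 : ε ≤ (p - a) / 4 := min_le_right _ _
  have hlow := h.eventually_le_lintegral B ξ 0 isCoord_fst 0 (a := p - ε)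
    (by simp only [zero_mul, add_zero]; linarith)
  filter_upwards [hlow, eventually_all.2 hsr, eventually_gt_atTop 0,
    eventually_const_mul_exp_le (2 * 8) (show p - r₀ < p - ε by linarith),
    eventually_const_mul_exp_le 2 (show a + β * η < p - ε by linarith)]
    with t hl hb ht he1 he2
  have hL : 0 < √(t : ℝ) := Real.sqrt_pos.2 (by exact_mod_cast ht)
  set g : Bool × Bool × Bool → Ω → ℝ≥0∞ := fun j ω => ENNReal.ofReal (Real.exp
    (weightedCount q B ξ (s j * κj j) (πj j) (ζj j) t ω - s j * (ηj j * √(t : ℝ)))) with hg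
  have hgm : ∀ j, AEMeasurable (g j) P := fun j => by
    have h1 := (h.integrable B ξ (s j * κj j) (πj j) (ζj j) (hπc j) t
      ht).aestronglyMeasurable.aemeasurable.div_const (Real.exp (s j * (ηj j * √(t : ℝ))))
    simp only [hg, Real.exp_sub]
    exact h1.ennreal_ofReal
  have hw : ∀ j ω, weightedCount q B ξ (s j * κj j) (πj j) (ζj j) t ω - s j * (ηj j * √(t : ℝ)) =
      weightedCount q B ξ 0 Prod.fst 0 t ω +
        s j * (κj j * q (πj j) (ζj j) t ω - ηj j * √(t : ℝ)) := by
    intro j ω; unfold weightedCount; ring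
  -- Either `V` is in `U` with both counts small, and the tilt is at most `exp (√t * (β * η))`; or
  -- one of the eight deviations occurs, and then its `g j` dominates the tilt.
  have hpt : ∀ᵐ ω ∂P, ENNReal.ofReal (Real.exp (weightedCount q B ξ 0 Prod.fst 0 t ω)) ≤
      Set.indicator {ω | V t ω ∈ U} (fun _ => ENNReal.ofReal (Real.exp (√(t : ℝ) * (β * η)))) ω +
        ∑ j, g j ω := by
    filter_upwards [h.sign t ht] with ω hω
    have hgood : ∀ j, 0 ≤ κj j * q (πj j) (ζj j) t ω - ηj j * √(t : ℝ) →
        ENNReal.ofReal (Real.exp (weightedCount q B ξ 0 Prod.fst 0 t ω)) ≤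
      Set.indicator {ω | V t ω ∈ U} (fun _ => ENNReal.ofReal (Real.exp (√(t : ℝ) * (β * η)))) ω +
        ∑ j, g j ω := by
      intro j hj
      refine le_trans ?_ (le_trans (Finset.single_le_sum (f := fun j => g j ω)
        (fun _ _ => zero_le) (Finset.mem_univ j)) (le_add_of_nonneg_left zero_le))
      simp only [hg, hw]
      exact ENNReal.ofReal_le_ofReal (Real.exp_le_exp.2
        (le_add_of_nonneg_right (mul_nonneg (hs j).le hj)))
    by_cases hV : V t ω ∈ U
    · rw [Set.indicator_of_mem (show ω ∈ {ω | V t ω ∈ U} from hV)]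
      by_cases hq : ∃ b : Bool, η * √(t : ℝ) ≤ |q (πj (b, true, true)) (ζj (b, true, true)) t ω|
      · obtain ⟨b, hq⟩ := hq
        rw [Set.indicator_of_mem (show ω ∈ {ω | V t ω ∈ U} from hV)] at hgood
        rcases le_abs.1 hq with h1 | h1
        · exact hgood (b, true, true) (by simp only [hκj, hηj, if_true, one_mul]; linarith)
        · refine hgood (b, true, false) ?_
          simp only [hκj, hηj, if_true]
          simp only [Bool.false_eq_true, if_false]
          have e : q (πj (b, true, false)) (ζj (b, true, false)) t ω =
            q (πj (b, true, true)) (ζj (b, true, true)) t ω := rfl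
          rw [e]; linarith
      · push Not at hq
        refine le_trans (ENNReal.ofReal_le_ofReal (Real.exp_le_exp.2 ?_)) le_self_add
        have q1 : |q Prod.fst ξ.1 t ω| < η * √(t : ℝ) := hq true
        have q2 : |q Prod.snd ξ.2 t ω| < η * √(t : ℝ) := hq false
        unfold weightedCount
        rw [zero_mul, add_zero]
        have t1 : B.1 * q Prod.fst ξ.1 t ω ≤ |B.1| * (η * √(t : ℝ)) :=
          (le_abs_self _).trans (by rw [abs_mul]; gcongr)
        have t2 : B.2 * q Prod.snd ξ.2 t ω ≤ |B.2| * (η * √(t : ℝ)) :=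
          (le_abs_self _).trans (by rw [abs_mul]; gcongr)
        rw [hβ]; linarith
    · have hnot : ¬ dist (V t ω) ξ < δ := fun hd => hV (hδU hd)
      have hex : ∃ b : Bool, δ / 2 < |πj (b, false, true) (V t ω) - πj (b, false, true) ξ| := by
        by_contra! hcon
        refine hnot ?_
        rw [Prod.dist_eq, max_lt_iff, Real.dist_eq, Real.dist_eq]
        have c1 : |(V t ω).1 - ξ.1| ≤ δ / 2 := hcon true
        have c2 : |(V t ω).2 - ξ.2| ≤ δ / 2 := hcon false
        constructor <;> linarith
      obtain ⟨b, hb⟩ := hex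
      rcases lt_abs.1 hb with h1 | h1
      · refine hgood (b, false, true) ?_
        have := (hω _ (hπc (b, false, true)) (ζj (b, false, true))).1 (by
          simp only [hζj, hκj]
          simp only [Bool.false_eq_true, if_false, if_true]
          linarith)
        simp only [hκj, hηj, if_true]
        simp only [Bool.false_eq_true, if_false]
        linarith
      · refine hgood (b, false, false) ?_
        have e : πj (b, false, false) = πj (b, false, true) := rfl
        have := (hω _ (hπc (b, false, false)) (ζj (b, false, false))).2 (by
          simp only [hζj, hκj, e]
          simp only [Bool.false_eq_true, if_false]
          linarith)
        simp only [hκj, hηj]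
        simp only [Bool.false_eq_true, if_false]
        linarith
  have hsum : ∫⁻ ω, ∑ j, g j ω ∂P ≤ ENNReal.ofReal (8 * Real.exp (√(t : ℝ) * (p - r₀))) := by
    rw [lintegral_finsetSum' _ fun j _ => hgm j]
    refine (Finset.sum_le_sum fun j _ => (hb j).trans (ENNReal.ofReal_le_ofReal
      (Real.exp_le_exp.2 (mul_le_mul_of_nonneg_left (sub_le_sub_left (hr₀j j) p) hL.le)))).trans ?_
    rw [Finset.sum_const, nsmul_eq_mul, ENNReal.ofReal_mul (by norm_num)]
    simp
  have hmain : ENNReal.ofReal (Real.exp (√(t : ℝ) * (p - ε))) ≤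
      ENNReal.ofReal (Real.exp (√(t : ℝ) * (β * η))) * P {ω | V t ω ∈ U} +
        ENNReal.ofReal (8 * Real.exp (√(t : ℝ) * (p - r₀))) := by
    refine hl.trans ((lintegral_mono_ae hpt).trans ?_)
    rw [lintegral_add_right' _ (Finset.aemeasurable_fun_sum _ fun j _ => hgm j)]
    exact add_le_add (lintegral_indicator_const_le _ _) hsum
  -- Otherwise the two terms on the right, one strictly and one weakly, stay below half of the left
  -- side, by `he2` and `he1`.
  by_contra! hlt
  have h1 : ENNReal.ofReal (Real.exp (√(t : ℝ) * (β * η))) * P {ω | V t ω ∈ U} <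
      ENNReal.ofReal (Real.exp (√(t : ℝ) * (a + β * η))) := by
    rw [mul_add, add_comm, Real.exp_add, ENNReal.ofReal_mul (Real.exp_pos _).le]
    exact ENNReal.mul_lt_mul_right (by simp [Real.exp_pos]) ENNReal.ofReal_ne_top hlt
  refine absurd (hmain.trans_lt (ENNReal.add_lt_add_right ENNReal.ofReal_ne_top h1)) (not_lt.2 ?_)
  rw [← ENNReal.ofReal_add (Real.exp_pos _).le (by positivity)]
  exact ENNReal.ofReal_le_ofReal (by linarith)

end HasCounts

/-! ### Passing to the logarithmic scale -/

lemma limsup_log_div_le {p : ℝ≥0 → ℝ≥0∞} {I : EReal}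
    (h : ∀ b : ℝ, ((-b : ℝ) : EReal) < I →
      ∀ᶠ t : ℝ≥0 in atTop, p t ≤ ENNReal.ofReal (Real.exp (√(t : ℝ) * b))) :
    limsup (fun t : ℝ≥0 => ENNReal.log (p t) / ((√(t : ℝ) : ℝ) : EReal)) atTop ≤ -I := by
  refine EReal.le_of_forall_lt_iff_le.1 fun b hb => limsup_le_of_le (by isBoundedDefault) ?_
  filter_upwards [h b (by rw [EReal.coe_neg]; exact EReal.neg_lt_comm.1 hb),
    eventually_gt_atTop 0] with t h1 ht
  have hL : 0 < √(t : ℝ) := Real.sqrt_pos.2 (by exact_mod_cast ht)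
  rw [EReal.div_le_iff_le_mul (by exact_mod_cast hL) (EReal.coe_ne_top _)]
  refine (ENNReal.log_le_log h1).trans (le_of_eq ?_)
  rw [ENNReal.log_ofReal_of_pos (Real.exp_pos _), Real.log_exp, EReal.coe_mul]

lemma le_liminf_log_div {p : ℝ≥0 → ℝ≥0∞} {I : EReal}
    (h : ∀ a : ℝ, I < ((-a : ℝ) : EReal) →
      ∀ᶠ t : ℝ≥0 in atTop, ENNReal.ofReal (Real.exp (√(t : ℝ) * a)) ≤ p t) :
    -I ≤ liminf (fun t : ℝ≥0 => ENNReal.log (p t) / ((√(t : ℝ) : ℝ) : EReal)) atTop := by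
  refine EReal.ge_of_forall_gt_iff_ge.1 fun a ha => le_liminf_of_le (by isBoundedDefault) ?_
  filter_upwards [h a (by rw [EReal.coe_neg]; exact EReal.lt_neg_comm.1 ha),
    eventually_gt_atTop 0] with t h1 ht
  have hL : 0 < √(t : ℝ) := Real.sqrt_pos.2 (by exact_mod_cast ht)
  rw [EReal.le_div_iff_mul_le (by exact_mod_cast hL) (EReal.coe_ne_top _)]
  refine le_trans (le_of_eq ?_) (ENNReal.log_le_log h1)
  rw [ENNReal.log_ofReal_of_pos (Real.exp_pos _), Real.log_exp, ← EReal.coe_mul, mul_comm]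

namespace HasCounts

/-- Critical weights minimise the pressure, so `φ` is a supremum over `B` of continuous functions of
`ξ`, hence lower semicontinuous. The same critical weights serve in Chernoff's bound and in the
tilt. -/
theorem hasLargeDeviationFunction [NeZero P] (h : HasCounts P ψ m ρ V q)
    (hψ : IsRateTransform ψ ψ') (hm : IsDisplacementLaw m) (hρ : 0 < ρ) {φ : ℝ × ℝ → ℝ}
    (hφ : ∀ ξ, ∃ B, IsCritical ψ' m ξ B ∧ φ ξ = -(ρ * pressure ψ m (crossings B ξ))) :
    HasLargeDeviationFunction P V φ where
  lowerSemicontinuous := by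
    intro ξ a ha
    obtain ⟨B, hB, hBφ⟩ := hφ ξ
    have hc : Continuous fun ξ' : ℝ × ℝ => -(ρ * pressure ψ m (crossings B ξ')) :=
      (continuous_const.mul ((continuous_pressure_crossings hψ hm).comp
        (Continuous.prodMk continuous_const continuous_id))).neg
    rw [hBφ] at ha
    filter_upwards [hc.continuousAt.eventually (lt_mem_nhds ha)] with ξ' hξ'
    obtain ⟨B', hB', hBφ'⟩ := hφ ξ'
    rw [hBφ']
    have := mul_le_mul_of_nonneg_left (hB'.pressure_le hψ hm B) hρ.le
    linarith
  upper C hC := by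
    refine limsup_log_div_le fun b hb => ?_
    obtain ⟨a, ha1, ha2⟩ := EReal.lt_iff_exists_real_btwn.1 hb
    have hab : -a < b := by
      have := EReal.coe_lt_coe_iff.1 ha1
      linarith
    refine h.eventually_measure_closed_le hψ hm hρ hC hab fun ξ hξ => ?_
    obtain ⟨B, hB, hBφ⟩ := hφ ξ
    have h1 : (a : EReal) < (φ ξ : EReal) := ha2.trans_le (iInf₂_le ξ hξ)
    have h2 := EReal.coe_lt_coe_iff.1 h1
    exact ⟨B, by linarith⟩
  lower U hU := by
    refine le_liminf_log_div fun a ha => ?_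
    obtain ⟨ξ, hlt⟩ := iInf_lt_iff.1 ha
    obtain ⟨hξ, hlt⟩ := iInf_lt_iff.1 hlt
    obtain ⟨B, hB, hBφ⟩ := hφ ξ
    have h2 := EReal.coe_lt_coe_iff.1 hlt
    exact h.eventually_le_measure_open hψ hm hρ hU hξ hB (by linarith)

end HasCounts

end LargeDeviations

end SingleFile

namespace SingleFile

/-! ### The counts of the single-file system -/

section Counts

variable {Ω : Type*} {σ : ℝ} {τ₁ τ₂ : ℝ≥0} {Y : ℤ → Ω → ℝ} {W X : ℤ → ℝ≥0 → Ω → ℝ}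

/-- The number of free particles beyond the level `ζ`, in macroscopic units. -/
noncomputable def freeCount (σ : ℝ) (τ₁ τ₂ : ℝ≥0) (Y : ℤ → Ω → ℝ) (W : ℤ → ℝ≥0 → Ω → ℝ)
    (π : ℝ × ℝ → ℝ) (ζ : ℝ) (t : ℝ≥0) (ω : Ω) : ℝ :=
  relSum (fun v => if ζ < π v then 1 else 0) 1 (freePair σ τ₁ τ₂ Y W t ω)

lemma freeCount_fst {t : ℝ≥0} (ht : 0 < t) (ζ : ℝ) (ω : Ω) :
    freeCount σ τ₁ τ₂ Y W Prod.fst ζ t ω =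
      excess (fun k => Y k ω + σ / √2 * W k (τ₁ * t) ω) (ζ * √(t : ℝ)) := by
  have hL : 0 < √(t : ℝ) := Real.sqrt_pos.2 (by exact_mod_cast ht)
  simp only [freeCount, relSum, excess, freePair, lt_div_iff₀ hL, one_mul]

lemma freeCount_snd {t : ℝ≥0} (ht : 0 < t) (ζ : ℝ) (ω : Ω) :
    freeCount σ τ₁ τ₂ Y W Prod.snd ζ t ω =
      excess (fun k => Y k ω + σ / √2 * W k (τ₂ * t) ω) (ζ * √(t : ℝ)) := by
  have hL : 0 < √(t : ℝ) := Real.sqrt_pos.2 (by exact_mod_cast ht)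
  simp only [freeCount, relSum, excess, freePair, lt_div_iff₀ hL, one_mul]

lemma relSum_const_mul (Θ : ℝ × ℝ → ℝ) (c b : ℝ) (v : ℤ → ℝ × ℝ) :
    relSum (fun x => b * Θ x) (b * c) v = b * relSum Θ c v := by
  unfold relSum
  rw [← tsum_mul_left]
  exact tsum_congr fun k => by ring

lemma relSum_add {Θ Θ' : ℝ × ℝ → ℝ} {c c' : ℝ} {v : ℤ → ℝ × ℝ}
    (h : (Function.support fun k : ℤ => Θ (v k) - c * (if 0 < k then 1 else 0)).Finite)
    (h' : (Function.support fun k : ℤ => Θ' (v k) - c' * (if 0 < k then 1 else 0)).Finite) :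
    relSum (fun x => Θ x + Θ' x) (c + c') v = relSum Θ c v + relSum Θ' c' v := by
  unfold relSum
  rw [← (summable_of_hasFiniteSupport h).tsum_add (summable_of_hasFiniteSupport h')]
  exact tsum_congr fun k => by ring

/-- The observable counting particles with weights `B` at the levels `ξ` and `s` at `ζ`. -/
noncomputable def weightedStep (B ξ : ℝ × ℝ) (s : ℝ) (π : ℝ × ℝ → ℝ) (ζ : ℝ) (v : ℝ × ℝ) : ℝ :=
  B.1 * (if ξ.1 < v.1 then 1 else 0) + B.2 * (if ξ.2 < v.2 then 1 else 0) +
    s * (if ζ < π v then 1 else 0)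

variable {π : ℝ × ℝ → ℝ}

lemma isStep_weightedStep (B ξ : ℝ × ℝ) (s : ℝ) (hπ : IsCoord π) (ζ : ℝ) :
    IsStep (weightedStep B ξ s π ζ) (B.1 * 1 + B.2 * 1 + s * 1) :=
  (((isStep_indicator isCoord_fst ξ.1).const_mul B.1).add
    ((isStep_indicator isCoord_snd ξ.2).const_mul B.2)).add
    ((isStep_indicator hπ ζ).const_mul s)

lemma stepExponent_weightedStep (B ξ : ℝ × ℝ) (s : ℝ) (hπ : IsCoord π) (ζ : ℝ) :
    stepExponent (weightedStep B ξ s π ζ) (B.1 * 1 + B.2 * 1 + s * 1) =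
      fun y u => crossings B ξ y u + s * crossing π ζ y u := by
  funext y u
  have e : π (y + u.1, y + u.2) = y + π u := by rcases hπ with rfl | rfl <;> rfl
  simp only [stepExponent, weightedStep, crossings, crossing, e]
  ring

/-- Infinite sums may be combined here because, for sorted paths, each has only finitely many
nonzero terms. -/
lemma weightedCount_freeCount {t : ℝ≥0} (ht : 0 < t) (hτ : τ₁ ≤ τ₂) {ω : Ω}
    (h : IsSortedAtInfinity (τ₂ * t) fun k t => Y k ω + σ / √2 * W k t ω) (B ξ : ℝ × ℝ) (s : ℝ)
    (hπ : IsCoord π) (ζ : ℝ) :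
    weightedCount (freeCount σ τ₁ τ₂ Y W) B ξ s π ζ t ω =
      relSum (weightedStep B ξ s π ζ) (B.1 * 1 + B.2 * 1 + s * 1)
        (freePair σ τ₁ τ₂ Y W t ω) := by
  have h1 := (isStep_indicator isCoord_fst ξ.1).const_mul B.1
  have h2 := (isStep_indicator isCoord_snd ξ.2).const_mul B.2
  have h3 := (isStep_indicator hπ ζ).const_mul s
  have e1 := relSum_add (Θ := fun v => B.1 * if ξ.1 < v.1 then 1 else 0)
    (Θ' := fun v => B.2 * if ξ.2 < v.2 then 1 else 0) (v := freePair σ τ₁ τ₂ Y W t ω)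
    (h.finite_support h1 ht hτ) (h.finite_support h2 ht hτ)
  have e2 := relSum_add
    (Θ := fun v => (B.1 * if ξ.1 < v.1 then 1 else 0) + B.2 * if ξ.2 < v.2 then 1 else 0)
    (Θ' := fun v => s * if ζ < π v then 1 else 0)
    (v := freePair σ τ₁ τ₂ Y W t ω) (h.finite_support (h1.add h2) ht hτ)
    (h.finite_support h3 ht hτ)
  rw [relSum_const_mul, relSum_const_mul] at e1
  rw [relSum_const_mul (fun v => if ζ < π v then 1 else 0) 1 s, e1] at e2
  exact e2.symm

variable [MeasurableSpace Ω] {P : Measure Ω} {ψ ψ' : ℝ → ℝ} {ρ : ℝ}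

lemma IsSingleFile.hasCounts [IsProbabilityMeasure P] (hX : IsSingleFile P σ Y W X)
    (hψ : IsRateTransform ψ ψ') (hI : IsInitialProfile P ψ ρ Y) (hτ : τ₁ ≤ τ₂)
    (hm : IsDisplacementLaw (displacementLaw σ τ₁ τ₂)) :
    HasCounts P ψ (displacementLaw σ τ₁ τ₂) ρ (rescaledTracer τ₁ τ₂ X)
      (freeCount σ τ₁ τ₂ Y W) where
  sign t ht := by
    have hL : 0 < √(t : ℝ) := Real.sqrt_pos.2 (by exact_mod_cast ht)
    filter_upwards [hX.ae_excess_free hI.ordered hI.exp_moment (τ₁ * t),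
      hX.ae_excess_free hI.ordered hI.exp_moment (τ₂ * t)] with ω h1 h2 π hπ ζ
    rcases hπ with rfl | rfl
    · rw [freeCount_fst ht]
      simp only [rescaledTracer, lt_div_iff₀ hL, div_le_iff₀ hL]
      exact h1.2 _
    · rw [freeCount_snd ht]
      simp only [rescaledTracer, lt_div_iff₀ hL, div_le_iff₀ hL]
      exact h2.2 _
  integrable B ξ s π ζ hπ t ht := by
    refine ((hX.tendsto_log_integral_exp hψ hI hτ hm
      (isStep_weightedStep B ξ s hπ ζ)).1 t ht).congr ?_
    filter_upwards [hX.ae_excess_free hI.ordered hI.exp_moment (τ₂ * t)] with ω h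
    rw [weightedCount_freeCount ht hτ h.1 B ξ s hπ ζ]
  limit B ξ s π ζ hπ := by
    have h := (hX.tendsto_log_integral_exp hψ hI hτ hm (isStep_weightedStep B ξ s hπ ζ)).2
    rw [stepExponent_weightedStep B ξ s hπ ζ] at h
    refine h.congr' ?_
    filter_upwards [eventually_gt_atTop 0] with t ht
    congr 2
    refine integral_congr_ae ?_
    filter_upwards [hX.ae_excess_free hI.ordered hI.exp_moment (τ₂ * t)] with ω h
    rw [weightedCount_freeCount ht hτ h.1 B ξ s hπ ζ]

end Counts

/-! ### The parametric formula -/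

section Parametric

variable {m : Measure (ℝ × ℝ)} {ψ ψ' : ℝ → ℝ} {ρ : ℝ}

lemma isStationary_iff (hψ : IsRateTransform ψ ψ') (hm : IsDisplacementLaw m) (hρ : 0 < ρ)
    (ξ B : ℝ × ℝ) :
    IsStationary (fun B => -(ρ * pressure ψ m (crossings B ξ))) B ↔ IsCritical ψ' m ξ B := by
  have h1 := ((hasDerivAt_pressure_crossings_fst hψ hm B ξ).const_mul ρ).neg
  have h2 := ((hasDerivAt_pressure_crossings_snd hψ hm B ξ).const_mul ρ).neg
  constructor
  · rintro ⟨e1, e2⟩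
    have f1 := e1.unique h1
    have f2 := e2.unique h2
    constructor
    · simpa [hρ.ne'] using f1.symm
    · simpa [hρ.ne'] using f2.symm
  · rintro ⟨e1, e2⟩
    rw [e1, mul_zero, neg_zero] at h1
    rw [e2, mul_zero, neg_zero] at h2
    exact ⟨h1, h2⟩

/-- Existence of the large deviation function given by the parametric formula. -/
lemma exists_isParametrizedBy (hψ : IsRateTransform ψ ψ') (hm : IsDisplacementLaw m) (hρ : 0 < ρ)
    {Φ : ℝ × ℝ → ℝ × ℝ → ℝ} (hΦ : ∀ ξ B, Φ ξ B = -(ρ * pressure ψ m (crossings B ξ))) :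
    ∃ φ : ℝ × ℝ → ℝ, IsParametrizedBy φ Φ ∧
      ∀ ξ, ∃ B, IsCritical ψ' m ξ B ∧ φ ξ = -(ρ * pressure ψ m (crossings B ξ)) := by
  choose b hb hbu using fun ξ => existsUnique_isCritical hψ hm ξ
  have hst : ∀ ξ B, IsStationary (Φ ξ) B ↔ IsCritical ψ' m ξ B := fun ξ B => by
    rw [funext (hΦ ξ)]
    exact isStationary_iff hψ hm hρ ξ B
  refine ⟨fun ξ => Φ ξ (b ξ), fun ξ => ⟨⟨b ξ, (hst ξ _).2 (hb ξ), fun B hB =>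
    hbu ξ B ((hst ξ B).1 hB)⟩, fun B hB => ?_⟩, fun ξ => ⟨b ξ, hb ξ, hΦ ξ _⟩⟩
  rw [hbu ξ B ((hst ξ B).1 hB)]

end Parametric

end SingleFile

/-! ### The annealed and quenched statements -/

open SingleFile in
theorem mainTheorem3 (ρ σ : ℝ) (hρ : 0 < ρ) (hσ : 0 < σ) (τ₁ τ₂ : ℝ≥0)
    (hτ₁ : 0 < τ₁) (hτ : τ₁ < τ₂) :
    -- the integrands in both formulas make sense and are integrable
    (∀ (η : ℝ) (B ξ : ℝ × ℝ), 0 < singleParticle σ τ₁ τ₂ η B ξ) ∧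
    (∀ B ξ : ℝ × ℝ,
      IntegrableOn (fun η => singleParticle σ τ₁ τ₂ η B ξ - 1) (Set.Ioi 0) ∧
      IntegrableOn (fun η => Real.log (singleParticle σ τ₁ τ₂ η B ξ)) (Set.Ioi 0)) ∧
    -- annealed case
    (∃ φ : ℝ × ℝ → ℝ, IsParametrizedBy φ (annealedFormula ρ σ τ₁ τ₂) ∧
      ∀ (Ω : Type*) [MeasurableSpace Ω] (P : Measure Ω) [IsProbabilityMeasure P]
        (Y : ℤ → Ω → ℝ) (W X : ℤ → ℝ≥0 → Ω → ℝ),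
        IsAnnealedInitial P ρ Y → IsSingleFile P σ Y W X →
        HasLargeDeviationFunction P (rescaledTracer τ₁ τ₂ X) φ) ∧
    -- quenched case
    (∃ φ : ℝ × ℝ → ℝ, IsParametrizedBy φ (quenchedFormula ρ σ τ₁ τ₂) ∧
      ∀ (Ω : Type*) [MeasurableSpace Ω] (P : Measure Ω) [IsProbabilityMeasure P]
        (y : ℤ → ℝ) (W X : ℤ → ℝ≥0 → Ω → ℝ),
        IsQuenchedInitial ρ y → IsSingleFile P σ (fun k _ => y k) W X →
        HasLargeDeviationFunction P (rescaledTracer τ₁ τ₂ X) φ) := by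
  have hm := isDisplacementLaw_displacementLaw hσ hτ₁ hτ
  refine ⟨fun η B ξ => singleParticle_pos hσ hτ₁ hτ η B ξ, fun B ξ =>
    ⟨integrableOn_singleParticle isRateTransform_sub_one hσ hτ₁ hτ B ξ,
      integrableOn_singleParticle isRateTransform_log hσ hτ₁ hτ B ξ⟩, ?_, ?_⟩
  · obtain ⟨φ, hφ, hφc⟩ := exists_isParametrizedBy isRateTransform_sub_one hm hρ
      (Φ := annealedFormula ρ σ τ₁ τ₂) fun ξ B => by
        rw [pressure_crossings_eq isRateTransform_sub_one hσ hτ₁ hτ, annealedFormula]; ring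
    refine ⟨φ, hφ, fun Ω _ P _ Y W X hY hX => ?_⟩
    exact (hX.hasCounts isRateTransform_sub_one (hY.isInitialProfile hρ hX.measurable_init) hτ.le
      hm).hasLargeDeviationFunction isRateTransform_sub_one hm hρ hφc
  · obtain ⟨φ, hφ, hφc⟩ := exists_isParametrizedBy isRateTransform_log hm hρ
      (Φ := quenchedFormula ρ σ τ₁ τ₂) fun ξ B => by
        rw [pressure_crossings_eq isRateTransform_log hσ hτ₁ hτ, quenchedFormula]; ring
    refine ⟨φ, hφ, fun Ω _ P _ y W X hy hX => ?_⟩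
    exact (hX.hasCounts isRateTransform_log (hy.isInitialProfile hρ) hτ.le
      hm).hasLargeDeviationFunction isRateTransform_log hm hρ hφc
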